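/- **Theorem.** Let $(M,\boldsymbol g)$ be a smooth Riemannian surface with Gauss curvature $K$, and suppose that either $K>0$ everywhere (the elliptic case) or $K<0$ everywhere (the hyperbolic case). *The embedding system.* Let $\mathcal F_{\mathbb R^3}$ be the bundle of orthonormal frames $(\rho;e_1,e_2,e_3)$ of $\mathbb R^3$, with the 1-forms $\omega^i=e_i\cdot d\rho$ and $\omega^i_j=e_i\cdot de_j$. For a local orthonormal framing of $\boldsymbol g$ on an open set $U\subset M$ let $\eta^1,\eta^2$ be the dual coframing and $\eta^1_2$ its connection form, so that $d\eta^1=-\eta^1_2\wedge\eta^2$, $d\eta^2=\eta^1_2\wedge\eta^1$, $d\eta^1_2=K\,\eta^1\wedge\eta^2$. The isometric embedding system of $\boldsymbol g$ is the exterior differential system $\mathcal I$ on $U\times\mathcal F_{\mathbb R^3}$ generated by $$\omega^3,\qquad \omega^1-\eta^1,\qquad \omega^2-\eta^2,\qquad \omega^1_2-\eta^1_2 .$$ *Darboux integrability.* $\mathcal I$ is Darboux integrable if about each point there is a coframe $\theta^1,\dots,\theta^r,\hat\sigma^1,\dots,\hat\sigma^p,\check\sigma^1,\dots,\check\sigma^q$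 with $p,q\ge2$, together with 2-forms $\hat\Omega^1,\dots,\hat\Omega^s\in\Omega^2(\hat\sigma)$ and $\check\Omega^1,\dots,\check\Omega^t\in\Omega^2(\check\sigma)$ with $s,t\ge 1$, such that: $\mathcal I$ is algebraically generated by the $\theta^i,\hat\Omega^b,\check\Omega^\beta$; the two singular systems $\{\theta,\hat\sigma,\check\Omega\}$ and $\{\theta,\check\sigma,\hat\Omega\}$ are Pfaffian; and $\hat V=\mathrm{span}\{\theta,\hat\sigma\}$, $\check V=\mathrm{span}\{\theta,\check\sigma\}$ form a Darboux pair. The last condition means that, with $V^\infty$ the final member of the derived flag of $V$, (a) $\hat V+\check V^\infty$ and $\check V+\hat V^\infty$ are the whole cotangent bundle, (b) $\hat V^\infty\cap\check V^\infty=0$, and (c) $d\omega\in\Omega^2(\hat V)+\Omega^2(\check V)$ for every section $\omega$ of $\hat V\cap\check V$. In the hyperbolic case all forms are real; in the elliptic case they are complex-valued, i.e. sections of the complexified cotangent bundle and its exterior powers. *Conclusion.* Suppose that the isometric embedding system of $\boldsymbol g$ is Darboux integrable. Then the set of points with $dK\neq0$ is dense in $M$, and about each such point there are local coordinates $(u,v)$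 in which $\boldsymbol g$ has one of the following forms, where $c>0$ is a constant. In the elliptic case: 1. $\boldsymbol g=c\left(\cosh^4u\,du^2+\sinh^2u\,dv^2\right)$, $u>0$; 2. $\boldsymbol g=c\left(\sinh^4u\,du^2+\cosh^2u\,dv^2\right)$, $u>0$; 3. $\boldsymbol g=u^2\left(du^2+dv^2\right)$, $u>0$. In the hyperbolic case: 4. $\boldsymbol g=c\left(\cos^4u\,du^2+\sin^2u\,dv^2\right)$, $0<u<\pi/2$. -/

import Mathlib

open scoped Manifold ContDiff Topology

noncomputable section

namespace DarbouxEmbedding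

/-! ### Differential forms of degree one and two on a real normed space

The coefficient field `𝕜` is `ℝ` or `ℂ`; for `𝕜 = ℂ` the forms are sections of the complexified
exterior powers of the cotangent bundle. -/

section Forms

variable {𝕜 : Type*} [RCLike 𝕜] {E : Type*} [NormedAddCommGroup E] [NormedSpace ℝ E]

/-- The wedge product `α ∧ β` of two covectors, as a bilinear form:
`(α ∧ β) (v, w) = α v * β w - α w * β v`. -/
def wedge (α β : E →L[ℝ] 𝕜) : E →L[ℝ] E →L[ℝ] 𝕜 :=
  (ContinuousLinearMap.mul ℝ 𝕜).bilinearComp α β -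
    ((ContinuousLinearMap.mul ℝ 𝕜).bilinearComp α β).flip

theorem wedge_apply (α β : E →L[ℝ] 𝕜) (v w : E) :
    wedge α β v w = α v * β w - α w * β v := by
  simp [wedge]

/-- The exterior derivative `dζ` at `x` of a `1`-form `ζ`, as a bilinear form:
`dζ (v, w) = D_v ζ (w) - D_w ζ (v)`. -/
def extD (ζ : E → E →L[ℝ] 𝕜) (x : E) : E →L[ℝ] E →L[ℝ] 𝕜 :=
  fderiv ℝ ζ x - (fderiv ℝ ζ x).flip

theorem extD_apply (ζ : E → E →L[ℝ] 𝕜) (x v w : E) :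
    extD ζ x v w = fderiv ℝ ζ x v w - fderiv ℝ ζ x w v := by
  simp [extD]

/-- `extD` is the exterior derivative of Mathlib, specialised to degree one. -/
theorem extD_eq_extDeriv (ζ : E → E →L[ℝ] 𝕜) (x v w : E) (h : DifferentiableAt ℝ ζ x) :
    extD ζ x v w =
      extDeriv (fun y => ContinuousAlternatingMap.ofSubsingleton ℝ E 𝕜 (0 : Fin 1) (ζ y)) x
        ![v, w] := by
  let L : (E →L[ℝ] 𝕜) →L[ℝ] (E [⋀^Fin 1]→L[ℝ] 𝕜) :=
    (ContinuousAlternatingMap.ofSubsingletonLIE (𝕜 := ℝ) (E := E) (F := 𝕜)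
      (0 : Fin 1)).toContinuousLinearEquiv.toContinuousLinearMap
  have hd : HasFDerivAt
      (fun y => ContinuousAlternatingMap.ofSubsingleton ℝ E 𝕜 (0 : Fin 1) (ζ y))
      (L.comp (fderiv ℝ ζ x)) x :=
    (L.hasFDerivAt (x := ζ x)).comp x h.hasFDerivAt
  have h1 : (Fin.removeNth 1 ![v, w] : Fin 1 → E) 0 = v := rfl
  rw [extDeriv, hd.fderiv]
  simp [L, extD_apply, ContinuousAlternatingMap.alternatizeUncurryFin_apply,
    Fin.sum_univ_two, h1, sub_eq_add_neg]

/-- For a subspace `V` of covectors at a point, the degree two part of the ideal generated by `V`: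
the span of all `α ∧ β` with `α ∈ V` and `β` an arbitrary covector. -/
def ideal₂ (V : Submodule 𝕜 (E →L[ℝ] 𝕜)) : Submodule 𝕜 (E →L[ℝ] E →L[ℝ] 𝕜) :=
  Submodule.span 𝕜 {Ω | ∃ α ∈ V, ∃ β : E →L[ℝ] 𝕜, Ω = wedge α β}

/-- The second exterior power `Λ² V` of a subspace `V` of covectors at a point. -/
def exterior₂ (V : Submodule 𝕜 (E →L[ℝ] 𝕜)) : Submodule 𝕜 (E →L[ℝ] E →L[ℝ] 𝕜) :=
  Submodule.span 𝕜 {Ω | ∃ α ∈ V, ∃ β ∈ V, Ω = wedge α β}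

/-- `ζ` is, near `x`, a smooth section of the family of subspaces `V` of the cotangent spaces. -/
def IsSectionNear (V : E → Submodule 𝕜 (E →L[ℝ] 𝕜)) (ζ : E → E →L[ℝ] 𝕜) (x : E) : Prop :=
  ∀ᶠ y in 𝓝 x, ContDiffAt ℝ ∞ ζ y ∧ ζ y ∈ V y

/-- The derived system `V⁽¹⁾` of a Pfaffian system `V`: its fibre at `x` consists of the values at
`x` of the local sections `ζ` of `V` with `dζ ≡ 0` modulo `V`. -/
def derivedSystem (V : E → Submodule 𝕜 (E →L[ℝ] 𝕜)) (x : E) : Submodule 𝕜 (E →L[ℝ] 𝕜) :=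
  Submodule.span 𝕜
    {α | ∃ ζ : E → E →L[ℝ] 𝕜, IsSectionNear V ζ x ∧ (∀ᶠ y in 𝓝 x, extD ζ y ∈ ideal₂ (V y)) ∧
      ζ x = α}

/-- The `k`-th member `V⁽ᵏ⁾` of the derived flag of `V`. -/
def derivedFlag (V : E → Submodule 𝕜 (E →L[ℝ] 𝕜)) : ℕ → E → Submodule 𝕜 (E →L[ℝ] 𝕜)
  | 0 => V
  | k + 1 => derivedSystem (derivedFlag V k)

/-- The final member `V^∞` of the (decreasing) derived flag of `V`. -/
def derivedLimit (V : E → Submodule 𝕜 (E →L[ℝ] 𝕜)) (x : E) : Submodule 𝕜 (E →L[ℝ] 𝕜) :=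
  ⨅ k : ℕ, derivedFlag V k x

/-- The defining conditions, at the point `x`, for two Pfaffian systems `V`, `W` to form
a Darboux pair. -/
structure DarbouxPairCond (V W : E → Submodule 𝕜 (E →L[ℝ] 𝕜)) (x : E) : Prop where
  sup_left : V x ⊔ derivedLimit W x = ⊤
  sup_right : W x ⊔ derivedLimit V x = ⊤
  inf_limit : derivedLimit V x ⊓ derivedLimit W x = ⊥
  extD_mem : ∀ ζ : E → E →L[ℝ] 𝕜, IsSectionNear (fun y => V y ⊓ W y) ζ x →
    extD ζ x ∈ exterior₂ (V x) ⊔ exterior₂ (W x)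

/-- The span at `x` of a finite family of `1`-forms. -/
def spanAt {n : ℕ} (θ : Fin n → E → E →L[ℝ] 𝕜) (x : E) : Submodule 𝕜 (E →L[ℝ] 𝕜) :=
  Submodule.span 𝕜 (Set.range fun i => θ i x)

/-- The span at `x` of a finite family of `2`-forms. -/
def spanAt₂ {n : ℕ} (Ω : Fin n → E → E →L[ℝ] E →L[ℝ] 𝕜) (x : E) :
    Submodule 𝕜 (E →L[ℝ] E →L[ℝ] 𝕜) :=
  Submodule.span 𝕜 (Set.range fun i => Ω i x)

/-- The degree two part at `x` of the exterior differential system generated (differentially) by the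
`1`-forms `θ i`: the span of all `θ i ∧ β` and all `dθ i`.  The degree one part is `spanAt θ x`. -/
def pfaffian₂ {n : ℕ} (θ : Fin n → E → E →L[ℝ] 𝕜) (x : E) :
    Submodule 𝕜 (E →L[ℝ] E →L[ℝ] 𝕜) :=
  ideal₂ (spanAt θ x) ⊔ spanAt₂ (fun i => extD (θ i)) x

/-- Let `I` be the exterior differential system generated by the `1`-forms `ϑ i`.  The smooth forms
`θ, σ, τ` (of degree one) and `Φ, Ψ` (of degree two), defined near `x`, exhibit `I` as decomposable
of type `[p, q]` near `x`: the forms `θ, σ, τ` are a coframe, `Φ b ∈ Λ²(σ)`, `Ψ b ∈ Λ²(τ)`, and `I`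
is generated algebraically by the `1`-forms `θ` and the `2`-forms `Φ`, `Ψ`. -/
structure IsDecomposition {n r p q s t : ℕ} (ϑ : Fin n → E → E →L[ℝ] 𝕜) (x : E)
    (θ : Fin r → E → E →L[ℝ] 𝕜) (σ : Fin p → E → E →L[ℝ] 𝕜) (τ : Fin q → E → E →L[ℝ] 𝕜)
    (Φ : Fin s → E → E →L[ℝ] E →L[ℝ] 𝕜) (Ψ : Fin t → E → E →L[ℝ] E →L[ℝ] 𝕜) : Prop where
  two_le_p : 2 ≤ p
  two_le_q : 2 ≤ q
  one_le_s : 1 ≤ s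
  one_le_t : 1 ≤ t
  smooth_θ : ∀ i, ∀ᶠ y in 𝓝 x, ContDiffAt ℝ ∞ (θ i) y
  smooth_σ : ∀ i, ∀ᶠ y in 𝓝 x, ContDiffAt ℝ ∞ (σ i) y
  smooth_τ : ∀ i, ∀ᶠ y in 𝓝 x, ContDiffAt ℝ ∞ (τ i) y
  smooth_Φ : ∀ i, ∀ᶠ y in 𝓝 x, ContDiffAt ℝ ∞ (Φ i) y
  smooth_Ψ : ∀ i, ∀ᶠ y in 𝓝 x, ContDiffAt ℝ ∞ (Ψ i) y
  linearIndependent : ∀ᶠ y in 𝓝 x, LinearIndependent 𝕜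
    (Sum.elim (fun i => θ i y) (Sum.elim (fun i => σ i y) (fun i => τ i y)))
  span_eq_top : ∀ᶠ y in 𝓝 x, spanAt θ y ⊔ spanAt σ y ⊔ spanAt τ y = ⊤
  Φ_mem : ∀ i, ∀ᶠ y in 𝓝 x, Φ i y ∈ exterior₂ (spanAt σ y)
  Ψ_mem : ∀ i, ∀ᶠ y in 𝓝 x, Ψ i y ∈ exterior₂ (spanAt τ y)
  degree_one : ∀ᶠ y in 𝓝 x, spanAt θ y = spanAt ϑ y
  degree_two : ∀ᶠ y in 𝓝 x,
    ideal₂ (spanAt θ y) ⊔ spanAt₂ Φ y ⊔ spanAt₂ Ψ y = pfaffian₂ ϑ y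

/-- The exterior differential system generated by the `1`-forms `ϑ i` is Darboux integrable near
`x`: it is decomposable near `x`, for some decomposition as in `IsDecomposition` the singular systems
`{θ, σ, Ψ}` and `{θ, τ, Φ}` are Pfaffian (that is, generated by their `1`-forms `θ, σ`, resp.
`θ, τ`, and the exterior derivatives of these), and their degree one parts form a Darboux pair. -/
def IsDarbouxIntegrableAt {n : ℕ} (ϑ : Fin n → E → E →L[ℝ] 𝕜) (x : E) : Prop :=
  ∃ (r p q s t : ℕ) (θ : Fin r → E → E →L[ℝ] 𝕜)
    (σ : Fin p → E → E →L[ℝ] 𝕜) (τ : Fin q → E → E →L[ℝ] 𝕜)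
    (Φ : Fin s → E → E →L[ℝ] E →L[ℝ] 𝕜) (Ψ : Fin t → E → E →L[ℝ] E →L[ℝ] 𝕜),
    IsDecomposition ϑ x θ σ τ Φ Ψ ∧
    (∀ᶠ y in 𝓝 x, ideal₂ (spanAt θ y ⊔ spanAt σ y) ⊔ spanAt₂ Ψ y =
      pfaffian₂ (Fin.append θ σ) y) ∧
    (∀ᶠ y in 𝓝 x, ideal₂ (spanAt θ y ⊔ spanAt τ y) ⊔ spanAt₂ Φ y =
      pfaffian₂ (Fin.append θ τ) y) ∧
    (∀ᶠ y in 𝓝 x, DarbouxPairCond (fun z => spanAt θ z ⊔ spanAt σ z)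
      (fun z => spanAt θ z ⊔ spanAt τ z) y)

end Forms

/-! ### Local coordinates on the orthonormal frame bundle of Euclidean space -/

/-- The Euclidean plane, on which surfaces are modelled. -/
abbrev E2 := EuclideanSpace ℝ (Fin 2)

/-- Euclidean `3`-space. -/
abbrev E3 := EuclideanSpace ℝ (Fin 3)

/-- The coordinate space of the `6`-dimensional orthonormal frame bundle of `ℝ³`. -/
abbrev E6 := EuclideanSpace ℝ (Fin 6)

/-- Local coordinates on the bundle of orthonormal frames of `ℝ³`, given by the inverse
`y ↦ (ρ y; e₁ y, e₂ y, e₃ y)` of a coordinate chart: an injective immersion of an open subset of `ℝ⁶`. -/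
structure FrameCoordinates where
  /-- The coordinate domain. -/
  domain : Set E6
  /-- The base point of the frame. -/
  ρ : E6 → E3
  /-- The vectors of the frame. -/
  e : Fin 3 → E6 → E3
  isOpen_domain : IsOpen domain
  smooth_ρ : ContDiffOn ℝ ∞ ρ domain
  smooth_e : ∀ a, ContDiffOn ℝ ∞ (e a) domain
  orthonormal : ∀ y ∈ domain, Orthonormal ℝ (fun a => e a y)
  injOn : Set.InjOn (fun y => (ρ y, fun a => e a y)) domain
  immersion : ∀ y ∈ domain, ∀ v : E6,
    fderiv ℝ ρ y v = 0 → (∀ a, fderiv ℝ (e a) y v = 0) → v = 0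

namespace FrameCoordinates

variable (Y : FrameCoordinates)

/-- The canonical forms `ωᵃ = ⟨e_a, dρ⟩`, so that `dρ = ∑ e_a ωᵃ`. -/
def coform (a : Fin 3) (y : E6) : E6 →L[ℝ] ℝ :=
  (innerSL ℝ (Y.e a y)).comp (fderiv ℝ Y.ρ y)

/-- The connection forms `ωᵃ_b = ⟨e_a, de_b⟩`, so that `de_b = ∑ e_a ωᵃ_b`. -/
def conn (a b : Fin 3) (y : E6) : E6 →L[ℝ] ℝ :=
  (innerSL ℝ (Y.e a y)).comp (fderiv ℝ (Y.e b) y)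

end FrameCoordinates

/-! ### Orthonormal framings of a Riemannian surface -/

section Surface

variable {M : Type*} [TopologicalSpace M] [ChartedSpace E2 M] [IsManifold 𝓘(ℝ, E2) ∞ M]

/-- Smooth Riemannian metrics on the surface `M`. -/
abbrev Metric (M : Type*) [TopologicalSpace M] [ChartedSpace E2 M] [IsManifold 𝓘(ℝ, E2) ∞ M] :=
  Bundle.ContMDiffRiemannianMetric 𝓘(ℝ, E2) ∞ E2 (fun p : M => TangentSpace 𝓘(ℝ, E2) p)

/-- The expression of the metric `g` in the local coordinates `φ`, at the point of `M` with
coordinates `x`. -/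
def localMetric (g : Metric M) (φ : OpenPartialHomeomorph M E2) (x : E2) : E2 →L[ℝ] E2 →L[ℝ] ℝ :=
  let G : E2 →L[ℝ] E2 →L[ℝ] ℝ := g.inner (φ.symm x)
  let D : E2 →L[ℝ] E2 := mfderiv 𝓘(ℝ, E2) 𝓘(ℝ, E2) φ.symm x
  G.bilinearComp D D

theorem localMetric_apply (g : Metric M) (φ : OpenPartialHomeomorph M E2) (x a b : E2) :
    localMetric g φ x a b =
      g.inner (φ.symm x) (mfderiv 𝓘(ℝ, E2) 𝓘(ℝ, E2) φ.symm x a)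
        (mfderiv 𝓘(ℝ, E2) 𝓘(ℝ, E2) φ.symm x b) :=
  rfl

/-- A smooth orthonormal framing `v₁, v₂` for `g` on the domain of a coordinate chart of `M`,
expressed in these coordinates. -/
structure Framing (g : Metric M) where
  /-- The coordinate chart. -/
  chart : OpenPartialHomeomorph M E2
  /-- The coordinate expressions of the two vector fields. -/
  v : Fin 2 → E2 → E2
  chart_mem : chart ∈ IsManifold.maximalAtlas 𝓘(ℝ, E2) ∞ M
  smooth : ∀ i, ContDiffOn ℝ ∞ (v i) chart.target
  orthonormal : ∀ x ∈ chart.target, ∀ i j,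
    localMetric g chart x (v i x) (v j x) = if i = j then 1 else 0

namespace Framing

variable {g : Metric M} (F : Framing g)

/-- The dual coframing `η¹, η²`. -/
def η (i : Fin 2) (x : E2) : E2 →L[ℝ] ℝ :=
  localMetric g F.chart x (F.v i x)

/-- The connection form `η¹₂`, characterised by the structure equations `dη¹ = -η¹₂ ∧ η²` and
`dη² = η¹₂ ∧ η¹`. -/
def conn (x : E2) : E2 →L[ℝ] ℝ :=
  -(extD (F.η 0) x (F.v 0 x) (F.v 1 x)) • F.η 0 x - (extD (F.η 1) x (F.v 0 x) (F.v 1 x)) • F.η 1 x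

/-- The Gauss curvature `K` (in the coordinates of the framing), characterised by the structure
equation `dη¹₂ = K η¹ ∧ η²`. -/
def K (x : E2) : ℝ :=
  extD F.conn x (F.v 0 x) (F.v 1 x)

/-- The generators `θ₀ = ω³`, `θ₁ = ω¹ - η¹`, `θ₂ = ω² - η²`, `θ₃ = ω¹₂ - η¹₂` of the isometric
embedding system on the product of the surface and the orthonormal frame bundle of `ℝ³`, in local
coordinates. -/
def θ (Y : FrameCoordinates) : Fin 4 → E2 × E6 → (E2 × E6 →L[ℝ] ℝ) :=
  let π₁ := ContinuousLinearMap.fst ℝ E2 E6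
  let π₂ := ContinuousLinearMap.snd ℝ E2 E6
  ![fun z => (Y.coform 2 z.2).comp π₂,
    fun z => (Y.coform 0 z.2).comp π₂ - (F.η 0 z.1).comp π₁,
    fun z => (Y.coform 1 z.2).comp π₂ - (F.η 1 z.1).comp π₁,
    fun z => (Y.conn 0 1 z.2).comp π₂ - (F.conn z.1).comp π₁]

/-- The same generators, regarded as forms with coefficients in `𝕜 = ℝ` or `ℂ`. -/
def θExt (𝕜 : Type*) [RCLike 𝕜] (Y : FrameCoordinates) (i : Fin 4) (z : E2 × E6) :
    E2 × E6 →L[ℝ] 𝕜 :=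
  RCLike.ofRealCLM.comp (F.θ Y i z)

end Framing

/-- The isometric embedding system of `g` into `ℝ³` is Darboux integrable over `𝕜`: for every local
orthonormal framing of `M`, about every point `(x; ρ₀, f)` of the product of the coordinate domain with
the orthonormal frame bundle of `ℝ³`, the system is Darboux integrable in suitable local coordinates.
(Changing the framing by a rotation or reflection amounts to a diffeomorphism of this product.) -/
def EmbeddingIntegrable (𝕜 : Type*) [RCLike 𝕜] (g : Metric M) : Prop :=
  ∀ F : Framing g, ∀ x ∈ F.chart.target, ∀ (ρ₀ : E3) (f : Fin 3 → E3), Orthonormal ℝ f →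
    ∃ Y : FrameCoordinates, ∃ y ∈ Y.domain, Y.ρ y = ρ₀ ∧ (∀ a, Y.e a y = f a) ∧
      IsDarbouxIntegrableAt (F.θExt 𝕜 Y) (x, y)

/-- The elliptic case: the Gauss curvature is positive. -/
def IsElliptic (g : Metric M) : Prop :=
  ∀ F : Framing g, ∀ x ∈ F.chart.target, 0 < F.K x

/-- The hyperbolic case: the Gauss curvature is negative. -/
def IsHyperbolic (g : Metric M) : Prop :=
  ∀ F : Framing g, ∀ x ∈ F.chart.target, F.K x < 0

/-- `dK ≠ 0` at the point `p`, where `K` is the Gauss curvature of `g`. -/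
def CurvatureRegularAt (g : Metric M) (p : M) : Prop :=
  ∃ F : Framing g, p ∈ F.chart.source ∧ fderiv ℝ F.K (F.chart p) ≠ 0

/-- There are local coordinates `(u, v)` about `p` with values in `{u ∈ I}` in which
`g = A(u) du² + B(u) dv²`. -/
def HasLocalForm (g : Metric M) (p : M) (I : Set ℝ) (A B : ℝ → ℝ) : Prop :=
  ∃ φ ∈ IsManifold.maximalAtlas 𝓘(ℝ, E2) ∞ M, p ∈ φ.source ∧
    ∀ x ∈ φ.target, x 0 ∈ I ∧ ∀ a b : E2,
      localMetric g φ x a b = A (x 0) * (a 0 * b 0) + B (x 0) * (a 1 * b 1)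

end Surface

end DarbouxEmbedding

end

open DarbouxEmbedding

/-! Write `ψ₁ = ω³₁`, `ψ₂ = ω³₂` and let `k` be a square root of `-K`: real in the hyperbolic case,
imaginary in the elliptic case. Modulo the generators, `dω³ ≡ -ψ₁∧ω₁ - ψ₂∧ω₂` and `d(ω¹₂ - η¹₂) ≡
ψ₁∧ψ₂ + k² ω₁∧ω₂`. The decomposable members of this pencil are the multiples of `(ψ₁ ∓ kω₂)∧(ψ₂ ±
kω₁)`. Hence the singular systems of any decomposition are rank 6 systems on an 8-dimensional space,
determined by the two signs of `k` (`exists_eventually_le`).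

A Darboux pair requires the final derived system of such a `V` to have rank at least 2. The first
two derived systems lie in explicit spans of 5 and 3 forms (`derivedSystem_le_frame₁`,
`derivedSystem_le_frame₂`). Membership in the third imposes seven linear equations on three
coefficients, so rank 2 forces all seven to be proportional. The solution of this algebraic problem
(`second_order_of_proportional`) is an equation for `P = dK/4K`, namely `∇P = 3 P⊗P - K g`
(`DP_of_embeddingIntegrable`). Only inclusions of the derived systems are used, so no constancy of
rank is needed.

Let `ε` be the sign of `K` and `w = |K|^(-1/4)`. The equation becomes `∇(w² dw) = (ε/w) g`: the
Hessian of `w³/3` is a multiple of the metric, so `g` is a warped product. Explicitly, `|w² dw|² =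
εw² + C` for a constant `C`, the form `⋆(w² dw)/|w² dw|²` is closed, hence locally some `dv`, and `g
= w⁴ dw²/(εw² + C) + (εw² + C) dv²` (`exists_warped`). For `ε = 1` the sign of `C` separates the
three elliptic forms. For `ε = -1` positivity forces `C > 0`, which leaves one form. If `dK`
vanished on an open set, then `P = 0` there and the equation would give `K = 0`, whence the density.
-/

noncomputable section

namespace DarbouxEmbedding

/-! ### Exterior calculus at a point and the linear conditions defining a derived system. -/

section PointwiseForms

variable {𝕜 : Type*} [RCLike 𝕜] {E : Type*} [NormedAddCommGroup E] [NormedSpace ℝ E]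

/-- The value of a `𝕜`-valued bilinear form on two vectors with coefficients in `𝕜`, the latter
being regarded as functionals on the `𝕜`-valued covectors. -/
def eval₂ (X Y : (E →L[ℝ] 𝕜) →L[𝕜] 𝕜) : (E →L[ℝ] E →L[ℝ] 𝕜) →ₗ[𝕜] 𝕜 where
  toFun B := X ((Y.restrictScalars ℝ).comp B)
  map_add' B C := by rw [ContinuousLinearMap.comp_add, map_add]
  map_smul' c B := by
    have : (Y.restrictScalars ℝ).comp (c • B) = c • (Y.restrictScalars ℝ).comp B := by
      ext v; simp
    rw [this, map_smul]; rfl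

theorem eval₂_apply (X Y : (E →L[ℝ] 𝕜) →L[𝕜] 𝕜) (B : E →L[ℝ] E →L[ℝ] 𝕜) :
    eval₂ X Y B = X ((Y.restrictScalars ℝ).comp B) := rfl

@[simp]
theorem eval₂_wedge (X Y : (E →L[ℝ] 𝕜) →L[𝕜] 𝕜) (α β : E →L[ℝ] 𝕜) :
    eval₂ X Y (wedge α β) = X α * Y β - X β * Y α := by
  have : (Y.restrictScalars ℝ).comp (wedge α β) = Y β • α - Y α • β := by
    ext v
    have h : wedge α β v = α v • β - β v • α := by
      ext w; simp [wedge_apply]; ring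
    simp [h]; ring
  rw [eval₂_apply, this, map_sub, map_smul, map_smul, smul_eq_mul, smul_eq_mul]; ring

theorem covector_add_smul (a b : 𝕜) (α : E →L[ℝ] 𝕜) : (a + b) • α = a • α + b • α :=
  add_smul a b α

theorem covector_zero_smul (α : E →L[ℝ] 𝕜) : (0 : 𝕜) • α = 0 := zero_smul 𝕜 α

theorem covector_mul_smul (a b : 𝕜) (α : E →L[ℝ] 𝕜) : (a * b) • α = a • b • α :=
  mul_smul a b α

/-- This turns congruences modulo `V` into scalar equations: each `α ∧ β` with `α ∈ V` dies on two
vectors annihilating `V`. -/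
theorem eval₂_eq_zero_of_mem_ideal₂ {V : Submodule 𝕜 (E →L[ℝ] 𝕜)} {B : E →L[ℝ] E →L[ℝ] 𝕜}
    (hB : B ∈ ideal₂ V) {X Y : (E →L[ℝ] 𝕜) →L[𝕜] 𝕜} (hX : ∀ α ∈ V, X α = 0)
    (hY : ∀ α ∈ V, Y α = 0) : eval₂ X Y B = 0 := by
  have : ideal₂ V ≤ LinearMap.ker (eval₂ X Y) := by
    refine Submodule.span_le.2 ?_
    rintro _ ⟨α, hα, β, rfl⟩
    simp [hX α hα, hY α hα]
  exact this hB

theorem extD_fun_add {ζ ξ : E → E →L[ℝ] 𝕜} {x : E} (hζ : DifferentiableAt ℝ ζ x)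
    (hξ : DifferentiableAt ℝ ξ x) : extD (fun y => ζ y + ξ y) x = extD ζ x + extD ξ x := by
  ext v w
  simp only [extD_apply, fderiv_fun_add hζ hξ, add_apply]; ring

theorem extD_fun_sub {ζ ξ : E → E →L[ℝ] 𝕜} {x : E} (hζ : DifferentiableAt ℝ ζ x)
    (hξ : DifferentiableAt ℝ ξ x) : extD (fun y => ζ y - ξ y) x = extD ζ x - extD ξ x := by
  ext v w
  simp only [extD_apply, fderiv_fun_sub hζ hξ, sub_apply]; ring

theorem extD_fun_smul {f : E → 𝕜} {ζ : E → E →L[ℝ] 𝕜} {x : E} (hf : DifferentiableAt ℝ f x)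
    (hζ : DifferentiableAt ℝ ζ x) :
    extD (fun y => f y • ζ y) x = wedge (fderiv ℝ f x) (ζ x) + f x • extD ζ x := by
  ext v w
  simp only [extD_apply, fderiv_fun_smul hf hζ, add_apply,
    smul_apply, ContinuousLinearMap.smulRight_apply, wedge_apply, smul_eq_mul]
  ring

theorem extD_fun_sum {ι : Type*} {s : Finset ι} {ζ : ι → E → E →L[ℝ] 𝕜} {x : E}
    (hζ : ∀ i ∈ s, DifferentiableAt ℝ (ζ i) x) :
    extD (fun y => ∑ i ∈ s, ζ i y) x = ∑ i ∈ s, extD (ζ i) x := by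
  ext v w
  simp only [extD_apply, fderiv_fun_sum hζ, sum_apply, Finset.sum_sub_distrib]

theorem _root_.Filter.EventuallyEq.extD_eq {ζ ξ : E → E →L[ℝ] 𝕜} {x : E} (h : ζ =ᶠ[𝓝 x] ξ) :
    extD ζ x = extD ξ x := by
  rw [extD, extD, h.fderiv_eq]

theorem linearIndependent_of_dual {ι : Type*} [Fintype ι] [DecidableEq ι] {V : Type*}
    [AddCommGroup V] [Module 𝕜 V] {w : ι → V} {X : ι → V →ₗ[𝕜] 𝕜}
    (h : ∀ i j, X i (w j) = if i = j then 1 else 0) : LinearIndependent 𝕜 w := by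
  rw [Fintype.linearIndependent_iff]
  intro c hc i
  simpa [h] using congrArg (X i) hc

theorem exists_dual_of_linearIndependent {ι : Type*} {V : Type*}
    [NormedAddCommGroup V] [NormedSpace 𝕜 V] [FiniteDimensional 𝕜 V] {w : ι → V}
    (h : LinearIndependent 𝕜 w) (t : ι → 𝕜) : ∃ X : V →L[𝕜] 𝕜, ∀ i, X (w i) = t i := by
  classical
  let B := Module.Basis.sumExtend h
  let X : V →ₗ[𝕜] 𝕜 := B.constr 𝕜 (Sum.elim t 0)
  refine ⟨LinearMap.toContinuousLinearMap X, fun i => ?_⟩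
  have hB : B (Sum.inl i) = w i := by
    simp only [B, Module.Basis.sumExtend, Module.Basis.reindex_apply]
    rw [Module.Basis.extend_apply_self]; rfl
  change X (w i) = t i
  rw [← hB, Module.Basis.constr_basis]; rfl

variable [FiniteDimensional ℝ E]

instance : FiniteDimensional 𝕜 (E →L[ℝ] 𝕜) := by
  have : FiniteDimensional ℝ (E →L[ℝ] 𝕜) := inferInstance
  exact FiniteDimensional.right ℝ 𝕜 (E →L[ℝ] 𝕜)

/-- The coefficients of a differentiable section of the span of a differentiable frame are
differentiable. -/
theorem exists_differentiableAt_coeff {n : ℕ} {w : Fin n → E → E →L[ℝ] 𝕜} {x : E}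
    (hw : ∀ i, DifferentiableAt ℝ (w i) x) (hli : LinearIndependent 𝕜 (fun i => w i x))
    {ζ : E → E →L[ℝ] 𝕜} (hζ : DifferentiableAt ℝ ζ x) (hmem : ∀ᶠ y in 𝓝 x, ζ y ∈ spanAt w y) :
    ∃ c : Fin n → E → 𝕜, (∀ i, DifferentiableAt ℝ (c i) x) ∧
      ∀ᶠ y in 𝓝 x, ζ y = ∑ i, c i y • w i y := by
  classical
  have hX : ∀ j, ∃ X : (E →L[ℝ] 𝕜) →L[𝕜] 𝕜, ∀ i, X (w i x) = if i = j then 1 else 0 := fun j =>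
    exists_dual_of_linearIndependent hli _
  choose X hX using hX
  let A : (E →L[ℝ] 𝕜) →L[ℝ] (Fin n → 𝕜) :=
    ContinuousLinearMap.pi fun j => (X j).restrictScalars ℝ
  -- `L y` is the matrix of the frame at `y` against functionals dual to the frame at `x`. It is the
  -- identity at `x`, hence invertible nearby, and its inverse recovers the coefficients.
  let L : E → (Fin n → 𝕜) →L[ℝ] (Fin n → 𝕜) := fun y =>
    A.comp (∑ i, ((ContinuousLinearMap.lsmul ℝ 𝕜).flip (w i y)).comp
      (ContinuousLinearMap.proj i))
  have hLapply : ∀ y c, L y c = A (∑ i, c i • w i y) := by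
    intro y c; simp [L]
  have hL : DifferentiableAt ℝ L x := by
    simp only [L]; fun_prop
  have hLx : L x = 1 := by
    ext c j
    simp [hLapply, A, hX]
  have hunit : ∀ᶠ y in 𝓝 x, IsUnit (L y) := by
    have h1 : L x ∈ {B : (Fin n → 𝕜) →L[ℝ] (Fin n → 𝕜) | IsUnit B} := by
      rw [hLx]; exact isUnit_one
    have h2 : ∀ᶠ B in 𝓝 (L x), B ∈ {B : (Fin n → 𝕜) →L[ℝ] (Fin n → 𝕜) | IsUnit B} :=
      (Units.isOpen (R := (Fin n → 𝕜) →L[ℝ] (Fin n → 𝕜))).eventually_mem h1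
    exact hL.continuousAt.eventually h2
  have hinv : DifferentiableAt ℝ (fun y => Ring.inverse (L y)) x := by
    have h1 : IsUnit (L x) := by rw [hLx]; exact isUnit_one
    exact DifferentiableAt.inverse (𝕜 := ℝ) (R := (Fin n → 𝕜) →L[ℝ] (Fin n → 𝕜)) (h := L) hL h1
  have hc : DifferentiableAt ℝ (fun y => Ring.inverse (L y) (A (ζ y))) x := by fun_prop
  refine ⟨fun i y => Ring.inverse (L y) (A (ζ y)) i, fun i => differentiableAt_pi.1 hc i, ?_⟩
  filter_upwards [hunit, hmem] with y hu hy
  obtain ⟨d, hd⟩ := (Submodule.mem_span_range_iff_exists_fun 𝕜).1 hy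
  have : Ring.inverse (L y) (A (ζ y)) = d := by
    rw [← hd, ← hLapply, ← mul_apply_eq_comp, Ring.inverse_mul_cancel _ hu]; rfl
  rw [this, hd]

/-- The value at `x` of an element of the derived system of a Pfaffian system with frame `w`
satisfies the linear equations that the exterior derivatives of the `w i`, restricted to the
annihilator of the system, impose. -/
theorem exists_coeff_of_mem_derivedSystem {n : ℕ} {w : Fin n → E → E →L[ℝ] 𝕜} {x : E}
    (hw : ∀ i, DifferentiableAt ℝ (w i) x) (hli : LinearIndependent 𝕜 (fun i => w i x))
    {V : E → Submodule 𝕜 (E →L[ℝ] 𝕜)} (hV : ∀ᶠ y in 𝓝 x, V y ≤ spanAt w y) {α : E →L[ℝ] 𝕜}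
    (hα : α ∈ derivedSystem V x) :
    ∃ c : Fin n → 𝕜, α = ∑ i, c i • w i x ∧
      ∀ X Y : (E →L[ℝ] 𝕜) →L[𝕜] 𝕜, (∀ i, X (w i x) = 0) → (∀ i, Y (w i x) = 0) →
        ∑ i, c i * eval₂ X Y (extD (w i) x) = 0 := by
  induction hα using Submodule.span_induction with
  | mem α h =>
    obtain ⟨ζ, h₁, h₂, rfl⟩ := h
    obtain ⟨c, hc, hζ⟩ := exists_differentiableAt_coeff hw hli
      (h₁.self_of_nhds.1.differentiableAt (by simp))
      (by filter_upwards [h₁, hV] with y hy hy' using hy' hy.2)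
    refine ⟨fun i => c i x, hζ.self_of_nhds, fun X Y hX hY => ?_⟩
    -- In the Leibniz expansion the terms `dcᵢ ∧ wᵢ` vanish on vectors annihilating the frame; so
    -- does `dζ` itself, which lies in the ideal of `V`.
    have hd : extD ζ x = ∑ i, (wedge (fderiv ℝ (c i) x) (w i x) + c i x • extD (w i) x) := by
      rw [Filter.EventuallyEq.extD_eq hζ,
        extD_fun_sum (ζ := fun i y => c i y • w i y) (fun i _ => (hc i).smul (hw i))]
      exact Finset.sum_congr rfl fun i _ => extD_fun_smul (hc i) (hw i)
    have hann : ∀ Z : (E →L[ℝ] 𝕜) →L[𝕜] 𝕜, (∀ i, Z (w i x) = 0) → ∀ α ∈ V x, Z α = 0 := by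
      intro Z hZ α hα
      have : spanAt w x ≤ LinearMap.ker (Z : (E →L[ℝ] 𝕜) →ₗ[𝕜] 𝕜) := by
        refine Submodule.span_le.2 ?_
        rintro _ ⟨i, rfl⟩
        exact hZ i
      exact this (hV.self_of_nhds hα)
    have h0 := eval₂_eq_zero_of_mem_ideal₂ h₂.self_of_nhds (hann X hX) (hann Y hY)
    rw [hd, map_sum] at h0
    simpa [hX, hY] using h0
  | zero => exact ⟨0, by simp [covector_zero_smul], by simp⟩
  | add α β _ _ hα hβ =>
    obtain ⟨c, rfl, hc⟩ := hα
    obtain ⟨d, rfl, hd⟩ := hβ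
    refine ⟨c + d, by simp [covector_add_smul, Finset.sum_add_distrib], fun X Y hX hY => ?_⟩
    simp [add_mul, Finset.sum_add_distrib, hc X Y hX hY, hd X Y hX hY]
  | smul r α _ hα =>
    obtain ⟨c, rfl, hc⟩ := hα
    refine ⟨r • c, by simp [Finset.smul_sum, covector_mul_smul], fun X Y hX hY => ?_⟩
    simp [mul_assoc, ← Finset.mul_sum, hc X Y hX hY]

end PointwiseForms

/-! ### The derived flag of the singular system. -/

section DerivedFlag

/-- The canonical and connection forms of a frame of `ℝ³`, the coframing of a surface with its
connection form, and functions `k, p, q, a, b, c`, all on the same space. -/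
structure EmbeddingCoframe (𝕜 : Type*) [RCLike 𝕜] (E : Type*) [NormedAddCommGroup E]
    [NormedSpace ℝ E] where
  (ω₁ ω₂ ω₃ ω₁₂ ψ₁ ψ₂ η₁ η₂ η₁₂ : E → E →L[ℝ] 𝕜)
  (k p q a b c : E → 𝕜)

namespace EmbeddingCoframe

variable {𝕜 : Type*} [RCLike 𝕜] {E : Type*} [NormedAddCommGroup E] [NormedSpace ℝ E]
  (F : EmbeddingCoframe 𝕜 E)

/-- The structure equations, with Gauss curvature `-k²`; the functions `p, q` are the components of
`dk / 2k`, and `a, b, c` express the second covariant derivatives. -/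
structure IsAdaptedAt (x : E) : Prop where
  indep : LinearIndependent 𝕜
    ![F.ω₁ x, F.ω₂ x, F.ω₃ x, F.ω₁₂ x, F.ψ₁ x, F.ψ₂ x, F.η₁ x, F.η₂ x]
  conn_mem : ∃ h₁ h₂ : 𝕜, F.η₁₂ x = h₁ • F.η₁ x + h₂ • F.η₂ x
  k_ne : F.k x ≠ 0
  diff_ω₁ : DifferentiableAt ℝ F.ω₁ x
  diff_ω₂ : DifferentiableAt ℝ F.ω₂ x
  diff_ω₃ : DifferentiableAt ℝ F.ω₃ x
  diff_ω₁₂ : DifferentiableAt ℝ F.ω₁₂ x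
  diff_ψ₁ : DifferentiableAt ℝ F.ψ₁ x
  diff_ψ₂ : DifferentiableAt ℝ F.ψ₂ x
  diff_η₁ : DifferentiableAt ℝ F.η₁ x
  diff_η₂ : DifferentiableAt ℝ F.η₂ x
  diff_η₁₂ : DifferentiableAt ℝ F.η₁₂ x
  diff_k : DifferentiableAt ℝ F.k x
  diff_p : DifferentiableAt ℝ F.p x
  diff_q : DifferentiableAt ℝ F.q x
  diff_a : DifferentiableAt ℝ F.a x
  diff_b : DifferentiableAt ℝ F.b x
  diff_c : DifferentiableAt ℝ F.c x
  d_ω₁ : extD F.ω₁ x = wedge (F.ψ₁ x) (F.ω₃ x) - wedge (F.ω₁₂ x) (F.ω₂ x)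
  d_ω₂ : extD F.ω₂ x = wedge (F.ψ₂ x) (F.ω₃ x) + wedge (F.ω₁₂ x) (F.ω₁ x)
  d_ω₃ : extD F.ω₃ x = - wedge (F.ψ₁ x) (F.ω₁ x) - wedge (F.ψ₂ x) (F.ω₂ x)
  d_ω₁₂ : extD F.ω₁₂ x = wedge (F.ψ₁ x) (F.ψ₂ x)
  d_ψ₁ : extD F.ψ₁ x = wedge (F.ψ₂ x) (F.ω₁₂ x)
  d_ψ₂ : extD F.ψ₂ x = - wedge (F.ψ₁ x) (F.ω₁₂ x)
  d_η₁ : extD F.η₁ x = - wedge (F.η₁₂ x) (F.η₂ x)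
  d_η₂ : extD F.η₂ x = wedge (F.η₁₂ x) (F.η₁ x)
  d_η₁₂ : extD F.η₁₂ x = (-F.k x ^ 2) • wedge (F.η₁ x) (F.η₂ x)
  d_k : fderiv ℝ F.k x = (2 * F.k x * F.p x) • F.η₁ x + (2 * F.k x * F.q x) • F.η₂ x
  d_p : fderiv ℝ F.p x = (-F.q x) • F.η₁₂ x
    + (F.p x ^ 2 - F.k x ^ 2 - 2 * F.k x * F.a x) • F.η₁ x
    + (F.p x * F.q x - 2 * F.k x * F.b x) • F.η₂ x
  d_q : fderiv ℝ F.q x = F.p x • F.η₁₂ x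
    + (F.p x * F.q x - 2 * F.k x * F.b x) • F.η₁ x
    + (F.q x ^ 2 - F.k x ^ 2 - 2 * F.k x * F.c x) • F.η₂ x
  d_a : ∃ u v : 𝕜, fderiv ℝ F.a x = u • F.η₁ x + v • F.η₂ x
  d_b : ∃ u v : 𝕜, fderiv ℝ F.b x = u • F.η₁ x + v • F.η₂ x
  d_c : ∃ u v : 𝕜, fderiv ℝ F.c x = u • F.η₁ x + v • F.η₂ x

def θ₁ (y : E) : E →L[ℝ] 𝕜 := F.ω₁ y - F.η₁ y
def θ₂ (y : E) : E →L[ℝ] 𝕜 := F.ω₂ y - F.η₂ y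
def θ₃ (y : E) : E →L[ℝ] 𝕜 := F.ω₁₂ y - F.η₁₂ y
-- `s₁ ∧ s₂` is congruent to `dθ₃ - k dω₃` modulo the system: one of the two decomposable forms of
-- the pencil.
def s₁ (y : E) : E →L[ℝ] 𝕜 := F.ψ₁ y - F.k y • F.ω₂ y
def s₂ (y : E) : E →L[ℝ] 𝕜 := F.ψ₂ y + F.k y • F.ω₁ y
-- On the vectors dual to `ω₁, ω₂`, the forms `dω₃, dθ₃, ds₁, ds₂` take the values `2k, 2k², -2kp,
-- -2kq`; the multiples of `ω₃` added in `α, β₁, β₂` cancel the last three.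
def α (y : E) : E →L[ℝ] 𝕜 := F.θ₃ y - F.k y • F.ω₃ y
def β₁ (y : E) : E →L[ℝ] 𝕜 := F.s₁ y + F.p y • F.ω₃ y
def β₂ (y : E) : E →L[ℝ] 𝕜 := F.s₂ y + F.q y • F.ω₃ y
-- In the same way, the multiples of `θ₁, θ₂` added here remove the obstructions to passing from the
-- first derived system to the second.
def α' (y : E) : E →L[ℝ] 𝕜 := F.α y - F.p y • F.θ₂ y + F.q y • F.θ₁ y
def β₁' (y : E) : E →L[ℝ] 𝕜 := F.β₁ y - F.a y • F.θ₂ y + F.b y • F.θ₁ y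
def β₂' (y : E) : E →L[ℝ] 𝕜 := F.β₂ y - F.b y • F.θ₂ y + F.c y • F.θ₁ y

/-- A frame of the singular system. -/
def frame₀ : Fin 6 → E → E →L[ℝ] 𝕜 := ![F.ω₃, F.θ₁, F.θ₂, F.θ₃, F.s₁, F.s₂]

/-- A frame of the first derived system. -/
def frame₁ : Fin 5 → E → E →L[ℝ] 𝕜 := ![F.θ₁, F.θ₂, F.α, F.β₁, F.β₂]

/-- A frame of the second derived system. -/
def frame₂ : Fin 3 → E → E →L[ℝ] 𝕜 := ![F.α', F.β₁', F.β₂']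

theorem apply_smul (X : (E →L[ℝ] 𝕜) →L[𝕜] 𝕜) (c : 𝕜) (ζ : E →L[ℝ] 𝕜) : X (c • ζ) = c * X ζ :=
  map_smul X c ζ

theorem eval₂_smul (X Y : (E →L[ℝ] 𝕜) →L[𝕜] 𝕜) (c : 𝕜) (B : E →L[ℝ] E →L[ℝ] 𝕜) :
    eval₂ X Y (c • B) = c * eval₂ X Y B :=
  map_smul (eval₂ X Y) c B

theorem eval₂_sub (X Y : (E →L[ℝ] 𝕜) →L[𝕜] 𝕜) (B C : E →L[ℝ] E →L[ℝ] 𝕜) :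
    eval₂ X Y (B - C) = eval₂ X Y B - eval₂ X Y C :=
  map_sub (eval₂ X Y) B C

theorem eval₂_neg (X Y : (E →L[ℝ] 𝕜) →L[𝕜] 𝕜) (B : E →L[ℝ] E →L[ℝ] 𝕜) :
    eval₂ X Y (-B) = -eval₂ X Y B :=
  map_neg (eval₂ X Y) B

namespace IsAdaptedAt

variable {F} {x : E} (h : F.IsAdaptedAt x)
include h

theorem diff_θ₁ : DifferentiableAt ℝ F.θ₁ x := h.diff_ω₁.sub h.diff_η₁
theorem diff_θ₂ : DifferentiableAt ℝ F.θ₂ x := h.diff_ω₂.sub h.diff_η₂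
theorem diff_θ₃ : DifferentiableAt ℝ F.θ₃ x := h.diff_ω₁₂.sub h.diff_η₁₂
theorem diff_s₁ : DifferentiableAt ℝ F.s₁ x := h.diff_ψ₁.sub (h.diff_k.smul h.diff_ω₂)
theorem diff_s₂ : DifferentiableAt ℝ F.s₂ x := h.diff_ψ₂.add (h.diff_k.smul h.diff_ω₁)
theorem diff_α : DifferentiableAt ℝ F.α x := h.diff_θ₃.sub (h.diff_k.smul h.diff_ω₃)
theorem diff_β₁ : DifferentiableAt ℝ F.β₁ x := h.diff_s₁.add (h.diff_p.smul h.diff_ω₃)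
theorem diff_β₂ : DifferentiableAt ℝ F.β₂ x := h.diff_s₂.add (h.diff_q.smul h.diff_ω₃)
theorem diff_α' : DifferentiableAt ℝ F.α' x :=
  (h.diff_α.sub (h.diff_p.smul h.diff_θ₂)).add (h.diff_q.smul h.diff_θ₁)
theorem diff_β₁' : DifferentiableAt ℝ F.β₁' x :=
  (h.diff_β₁.sub (h.diff_a.smul h.diff_θ₂)).add (h.diff_b.smul h.diff_θ₁)
theorem diff_β₂' : DifferentiableAt ℝ F.β₂' x :=
  (h.diff_β₂.sub (h.diff_b.smul h.diff_θ₂)).add (h.diff_c.smul h.diff_θ₁)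

theorem d_θ₁ : extD F.θ₁ x = extD F.ω₁ x - extD F.η₁ x := extD_fun_sub h.diff_ω₁ h.diff_η₁
theorem d_θ₂ : extD F.θ₂ x = extD F.ω₂ x - extD F.η₂ x := extD_fun_sub h.diff_ω₂ h.diff_η₂
theorem d_θ₃ : extD F.θ₃ x = extD F.ω₁₂ x - extD F.η₁₂ x := extD_fun_sub h.diff_ω₁₂ h.diff_η₁₂
theorem d_s₁ : extD F.s₁ x =
    extD F.ψ₁ x - (wedge (fderiv ℝ F.k x) (F.ω₂ x) + F.k x • extD F.ω₂ x) := by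
  rw [← extD_fun_smul h.diff_k h.diff_ω₂]
  exact extD_fun_sub h.diff_ψ₁ (h.diff_k.smul h.diff_ω₂)
theorem d_s₂ : extD F.s₂ x =
    extD F.ψ₂ x + (wedge (fderiv ℝ F.k x) (F.ω₁ x) + F.k x • extD F.ω₁ x) := by
  rw [← extD_fun_smul h.diff_k h.diff_ω₁]
  exact extD_fun_add h.diff_ψ₂ (h.diff_k.smul h.diff_ω₁)
theorem d_α : extD F.α x =
    extD F.θ₃ x - (wedge (fderiv ℝ F.k x) (F.ω₃ x) + F.k x • extD F.ω₃ x) := by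
  rw [← extD_fun_smul h.diff_k h.diff_ω₃]
  exact extD_fun_sub h.diff_θ₃ (h.diff_k.smul h.diff_ω₃)
theorem d_β₁ : extD F.β₁ x =
    extD F.s₁ x + (wedge (fderiv ℝ F.p x) (F.ω₃ x) + F.p x • extD F.ω₃ x) := by
  rw [← extD_fun_smul h.diff_p h.diff_ω₃]
  exact extD_fun_add h.diff_s₁ (h.diff_p.smul h.diff_ω₃)
theorem d_β₂ : extD F.β₂ x =
    extD F.s₂ x + (wedge (fderiv ℝ F.q x) (F.ω₃ x) + F.q x • extD F.ω₃ x) := by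
  rw [← extD_fun_smul h.diff_q h.diff_ω₃]
  exact extD_fun_add h.diff_s₂ (h.diff_q.smul h.diff_ω₃)

omit h in
theorem extD_sub_smul_add_smul {ζ ξ₁ ξ₂ : E → E →L[ℝ] 𝕜} {f g : E → 𝕜}
    (hζ : DifferentiableAt ℝ ζ x) (h₁ : DifferentiableAt ℝ ξ₁ x) (h₂ : DifferentiableAt ℝ ξ₂ x)
    (hf : DifferentiableAt ℝ f x) (hg : DifferentiableAt ℝ g x) :
    extD (fun y => ζ y - f y • ξ₂ y + g y • ξ₁ y) x = extD ζ x
      - (wedge (fderiv ℝ f x) (ξ₂ x) + f x • extD ξ₂ x)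
      + (wedge (fderiv ℝ g x) (ξ₁ x) + g x • extD ξ₁ x) := by
  rw [← extD_fun_smul hf h₂, ← extD_fun_smul hg h₁,
    ← extD_fun_sub hζ (ξ := fun y => f y • ξ₂ y) (hf.smul h₂)]
  exact extD_fun_add (hζ.sub (hf.smul h₂)) (hg.smul h₁)

theorem d_α' : extD F.α' x = extD F.α x
    - (wedge (fderiv ℝ F.p x) (F.θ₂ x) + F.p x • extD F.θ₂ x)
    + (wedge (fderiv ℝ F.q x) (F.θ₁ x) + F.q x • extD F.θ₁ x) :=
  extD_sub_smul_add_smul h.diff_α h.diff_θ₁ h.diff_θ₂ h.diff_p h.diff_q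
theorem d_β₁' : extD F.β₁' x = extD F.β₁ x
    - (wedge (fderiv ℝ F.a x) (F.θ₂ x) + F.a x • extD F.θ₂ x)
    + (wedge (fderiv ℝ F.b x) (F.θ₁ x) + F.b x • extD F.θ₁ x) :=
  extD_sub_smul_add_smul h.diff_β₁ h.diff_θ₁ h.diff_θ₂ h.diff_a h.diff_b
theorem d_β₂' : extD F.β₂' x = extD F.β₂ x
    - (wedge (fderiv ℝ F.b x) (F.θ₂ x) + F.b x • extD F.θ₂ x)
    + (wedge (fderiv ℝ F.c x) (F.θ₁ x) + F.c x • extD F.θ₁ x) :=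
  extD_sub_smul_add_smul h.diff_β₂ h.diff_θ₁ h.diff_θ₂ h.diff_b h.diff_c

variable [FiniteDimensional ℝ E]

/-- There is a vector with prescribed values on an adapted coframe. -/
theorem exists_vector {h₁ h₂ : 𝕜} (hη : F.η₁₂ x = h₁ • F.η₁ x + h₂ • F.η₂ x)
    (t₀ t₁ t₂ t₃ v₁ v₂ u₁ u₂ : 𝕜) :
    ∃ X : (E →L[ℝ] 𝕜) →L[𝕜] 𝕜, X (F.ω₁ x) = u₁ ∧ X (F.ω₂ x) = u₂ ∧ X (F.ω₃ x) = t₀ ∧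
      X (F.ω₁₂ x) = h₁ * (u₁ - t₁) + h₂ * (u₂ - t₂) + t₃ ∧
      X (F.ψ₁ x) = v₁ + F.k x * u₂ ∧ X (F.ψ₂ x) = v₂ - F.k x * u₁ ∧
      X (F.η₁ x) = u₁ - t₁ ∧ X (F.η₂ x) = u₂ - t₂ ∧
      X (F.η₁₂ x) = h₁ * (u₁ - t₁) + h₂ * (u₂ - t₂) := by
  -- The eight parameters are the values of `X` on `ω₃, θ₁, θ₂, θ₃, s₁, s₂, ω₁, ω₂`, here converted
  -- to values on the independent family `indep`.
  obtain ⟨X, hX⟩ := exists_dual_of_linearIndependent h.indep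
    ![u₁, u₂, t₀, h₁ * (u₁ - t₁) + h₂ * (u₂ - t₂) + t₃, v₁ + F.k x * u₂, v₂ - F.k x * u₁,
      u₁ - t₁, u₂ - t₂]
  refine ⟨X, hX 0, hX 1, hX 2, hX 3, hX 4, hX 5, hX 6, hX 7, ?_⟩
  have h6 : X (F.η₁ x) = u₁ - t₁ := hX 6
  have h7 : X (F.η₂ x) = u₂ - t₂ := hX 7
  rw [hη, map_add, apply_smul, apply_smul, h6, h7]

end IsAdaptedAt

end EmbeddingCoframe
end DerivedFlag

section DerivedFlag
namespace EmbeddingCoframe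

variable {𝕜 : Type*} [RCLike 𝕜] {E : Type*} [NormedAddCommGroup E] [NormedSpace ℝ E]
  [FiniteDimensional ℝ E] {F : EmbeddingCoframe 𝕜 E} {x : E}

namespace IsAdaptedAt

variable (h : F.IsAdaptedAt x)
include h

theorem linearIndependent_frame₀ : LinearIndependent 𝕜 (fun i => F.frame₀ i x) := by
  obtain ⟨h₁, h₂, hη⟩ := h.conn_mem
  obtain ⟨X₀, a1, a2, a3, a4, a5, a6, a7, a8, a9⟩ := h.exists_vector hη 1 0 0 0 0 0 0 0
  obtain ⟨X₁, b1, b2, b3, b4, b5, b6, b7, b8, b9⟩ := h.exists_vector hη 0 1 0 0 0 0 0 0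
  obtain ⟨X₂, c1, c2, c3, c4, c5, c6, c7, c8, c9⟩ := h.exists_vector hη 0 0 1 0 0 0 0 0
  obtain ⟨X₃, d1, d2, d3, d4, d5, d6, d7, d8, d9⟩ := h.exists_vector hη 0 0 0 1 0 0 0 0
  obtain ⟨X₄, e1, e2, e3, e4, e5, e6, e7, e8, e9⟩ := h.exists_vector hη 0 0 0 0 1 0 0 0
  obtain ⟨X₅, f1, f2, f3, f4, f5, f6, f7, f8, f9⟩ := h.exists_vector hη 0 0 0 0 0 1 0 0
  refine linearIndependent_of_dual
    (X := ![X₀.toLinearMap, X₁.toLinearMap, X₂.toLinearMap, X₃.toLinearMap, X₄.toLinearMap,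
      X₅.toLinearMap]) fun i j => ?_
  fin_cases i <;> fin_cases j <;>
    simp [frame₀, θ₁, θ₂, θ₃, s₁, s₂, *]

/-- The vectors dual to `ω₁` and `ω₂` annihilate `frame₀` and give one relation among six
coefficients. Since `2k ≠ 0`, it determines the coefficient of `ω₃`. -/
theorem derivedSystem_le_frame₁ {V : E → Submodule 𝕜 (E →L[ℝ] 𝕜)}
    (hV : ∀ᶠ y in 𝓝 x, V y ≤ spanAt F.frame₀ y) :
    derivedSystem V x ≤ spanAt F.frame₁ x := by
  obtain ⟨h₁, h₂, hη⟩ := h.conn_mem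
  have hli := h.linearIndependent_frame₀
  intro ζ hζ
  obtain ⟨r, rfl, hr⟩ := exists_coeff_of_mem_derivedSystem (w := F.frame₀) (fun i => by
    fin_cases i
    exacts [h.diff_ω₃, h.diff_θ₁, h.diff_θ₂, h.diff_θ₃, h.diff_s₁, h.diff_s₂]) hli hV hζ
  obtain ⟨X, a1, a2, a3, a4, a5, a6, a7, a8, a9⟩ := h.exists_vector hη 0 0 0 0 0 0 1 0
  obtain ⟨Y, b1, b2, b3, b4, b5, b6, b7, b8, b9⟩ := h.exists_vector hη 0 0 0 0 0 0 0 1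
  have key := hr X Y
    (fun i => by fin_cases i <;> simp [frame₀, θ₁, θ₂, θ₃, s₁, s₂, *])
    (fun i => by fin_cases i <;> simp [frame₀, θ₁, θ₂, θ₃, s₁, s₂, *])
  simp only [frame₀, Fin.sum_univ_six, Matrix.cons_val, h.d_θ₁, h.d_θ₂, h.d_θ₃, h.d_s₁, h.d_s₂,
    h.d_ω₁, h.d_ω₂, h.d_ω₃, h.d_ω₁₂, h.d_ψ₁, h.d_ψ₂, h.d_η₁, h.d_η₂, h.d_η₁₂, h.d_k, map_add,
    eval₂_sub, eval₂_neg, eval₂_smul, eval₂_wedge, apply_smul, a1, a2, a3, a4, a5, a6, a7, a8, a9,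
    b1, b2, b3, b4, b5, b6, b7, b8, b9] at key
  have h0 : r 0 = -F.k x * r 3 + F.p x * r 4 + F.q x * r 5 := by
    refine mul_left_cancel₀ (mul_ne_zero two_ne_zero h.k_ne) ?_
    linear_combination key
  have hsum : ∑ i, r i • F.frame₀ i x = r 1 • F.θ₁ x + r 2 • F.θ₂ x + r 3 • F.α x
      + r 4 • F.β₁ x + r 5 • F.β₂ x := by
    ext v
    simp [frame₀, Fin.sum_univ_six, α, β₁, β₂, h0]
    ring
  rw [hsum]
  have hm : ∀ i, F.frame₁ i x ∈ spanAt F.frame₁ x := fun i =>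
    Submodule.subset_span (Set.mem_range_self i)
  have m0 : F.θ₁ x ∈ spanAt F.frame₁ x := hm 0
  have m1 : F.θ₂ x ∈ spanAt F.frame₁ x := hm 1
  have m2 : F.α x ∈ spanAt F.frame₁ x := hm 2
  have m3 : F.β₁ x ∈ spanAt F.frame₁ x := hm 3
  have m4 : F.β₂ x ∈ spanAt F.frame₁ x := hm 4
  exact add_mem (add_mem (add_mem (add_mem (Submodule.smul_mem _ _ m0) (Submodule.smul_mem _ _ m1))
    (Submodule.smul_mem _ _ m2)) (Submodule.smul_mem _ _ m3)) (Submodule.smul_mem _ _ m4)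

/-- A third vector `T` annihilates `frame₁`. Pairing it with those dual to `ω₁, ω₂` gives two
relations, which determine the coefficients of `θ₂` and `θ₁`. -/
theorem derivedSystem_le_frame₂ {V : E → Submodule 𝕜 (E →L[ℝ] 𝕜)}
    (hV : ∀ᶠ y in 𝓝 x, V y ≤ spanAt F.frame₁ y) :
    derivedSystem V x ≤ spanAt F.frame₂ x := by
  obtain ⟨h₁, h₂, hη⟩ := h.conn_mem
  have hli : LinearIndependent 𝕜 (fun i => F.frame₁ i x) := by
    obtain ⟨X₁, b1, b2, b3, b4, b5, b6, b7, b8, b9⟩ := h.exists_vector hη 0 1 0 0 0 0 0 0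
    obtain ⟨X₂, c1, c2, c3, c4, c5, c6, c7, c8, c9⟩ := h.exists_vector hη 0 0 1 0 0 0 0 0
    obtain ⟨X₃, d1, d2, d3, d4, d5, d6, d7, d8, d9⟩ := h.exists_vector hη 0 0 0 1 0 0 0 0
    obtain ⟨X₄, e1, e2, e3, e4, e5, e6, e7, e8, e9⟩ := h.exists_vector hη 0 0 0 0 1 0 0 0
    obtain ⟨X₅, f1, f2, f3, f4, f5, f6, f7, f8, f9⟩ := h.exists_vector hη 0 0 0 0 0 1 0 0
    refine linearIndependent_of_dual
      (X := ![X₁.toLinearMap, X₂.toLinearMap, X₃.toLinearMap, X₄.toLinearMap,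
        X₅.toLinearMap]) fun i j => ?_
    fin_cases i <;> fin_cases j <;>
      simp [frame₁, α, β₁, β₂, θ₁, θ₂, θ₃, s₁, s₂, *]
  intro ζ hζ
  obtain ⟨r, rfl, hr⟩ := exists_coeff_of_mem_derivedSystem (w := F.frame₁) (fun i => by
    fin_cases i
    exacts [h.diff_θ₁, h.diff_θ₂, h.diff_α, h.diff_β₁, h.diff_β₂]) hli hV hζ
  -- The vector dual to `ω₃`, corrected so as to annihilate `α, β₁, β₂`.
  obtain ⟨T, c1, c2, c3, c4, c5, c6, c7, c8, c9⟩ :=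
    h.exists_vector hη 1 0 0 (F.k x) (-F.p x) (-F.q x) 0 0
  obtain ⟨X, a1, a2, a3, a4, a5, a6, a7, a8, a9⟩ := h.exists_vector hη 0 0 0 0 0 0 1 0
  obtain ⟨Y, b1, b2, b3, b4, b5, b6, b7, b8, b9⟩ := h.exists_vector hη 0 0 0 0 0 0 0 1
  have hT : ∀ i, T (F.frame₁ i x) = 0 := fun i => by
    fin_cases i <;> simp [frame₁, α, β₁, β₂, θ₁, θ₂, θ₃, s₁, s₂, *]
  have key₁ := hr T X hT
    (fun i => by fin_cases i <;> simp [frame₁, α, β₁, β₂, θ₁, θ₂, θ₃, s₁, s₂, *])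
  have key₂ := hr T Y hT
    (fun i => by fin_cases i <;> simp [frame₁, α, β₁, β₂, θ₁, θ₂, θ₃, s₁, s₂, *])
  simp only [frame₁, Fin.sum_univ_five, Matrix.cons_val, h.d_α, h.d_β₁, h.d_β₂,
    h.d_θ₁, h.d_θ₂, h.d_θ₃, h.d_s₁, h.d_s₂,
    h.d_ω₁, h.d_ω₂, h.d_ω₃, h.d_ω₁₂, h.d_ψ₁, h.d_ψ₂, h.d_η₁, h.d_η₂, h.d_η₁₂, h.d_k, h.d_p, h.d_q,
    map_add, eval₂_sub, eval₂_neg, eval₂_smul, eval₂_wedge, apply_smul, a1, a2, a3, a4, a5, a6, a7, a8,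
    a9, b1, b2, b3, b4, b5, b6, b7, b8, b9, c1, c2, c3, c4, c5, c6, c7, c8, c9] at key₁ key₂
  have h0 : r 1 = -F.p x * r 2 - F.a x * r 3 - F.b x * r 4 := by
    refine mul_left_cancel₀ (mul_ne_zero two_ne_zero h.k_ne) ?_
    linear_combination key₁
  have h1 : r 0 = F.q x * r 2 + F.b x * r 3 + F.c x * r 4 := by
    refine mul_left_cancel₀ (mul_ne_zero two_ne_zero h.k_ne) ?_
    linear_combination -key₂
  have hsum : ∑ i, r i • F.frame₁ i x = r 2 • F.α' x + r 3 • F.β₁' x + r 4 • F.β₂' x := by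
    ext v
    simp [frame₁, Fin.sum_univ_five, α', β₁', β₂', h0, h1]
    ring
  rw [hsum]
  have hm : ∀ i, F.frame₂ i x ∈ spanAt F.frame₂ x := fun i =>
    Submodule.subset_span (Set.mem_range_self i)
  have m0 : F.α' x ∈ spanAt F.frame₂ x := hm 0
  have m1 : F.β₁' x ∈ spanAt F.frame₂ x := hm 1
  have m2 : F.β₂' x ∈ spanAt F.frame₂ x := hm 2
  exact add_mem (add_mem (Submodule.smul_mem _ _ m0) (Submodule.smul_mem _ _ m1))
    (Submodule.smul_mem _ _ m2)

end IsAdaptedAt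
end EmbeddingCoframe
end DerivedFlag

section DerivedFlag
namespace EmbeddingCoframe

variable {𝕜 : Type*} [RCLike 𝕜] {E : Type*} [NormedAddCommGroup E] [NormedSpace ℝ E]
  [FiniteDimensional ℝ E] {F : EmbeddingCoframe 𝕜 E} {x : E}

namespace IsAdaptedAt

variable (h : F.IsAdaptedAt x)
include h

set_option maxHeartbeats 1600000 in
/-- The linear equations satisfied by the coefficients of the third derived system. -/
theorem exists_coeff_of_mem_derivedSystem_frame₂ {V : E → Submodule 𝕜 (E →L[ℝ] 𝕜)}
    (hV : ∀ᶠ y in 𝓝 x, V y ≤ spanAt F.frame₂ y) :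
    ∃ a₁ a₂ b₁ b₂ c₁ c₂ : 𝕜, ∀ ζ ∈ derivedSystem V x, ∃ r : Fin 3 → 𝕜,
      ζ = ∑ i, r i • F.frame₂ i x ∧
      (-2 * F.k x * F.p x) * r 0
        + (F.p x ^ 2 + F.q x ^ 2 - F.k x ^ 2 + F.b x ^ 2 - F.a x * F.c x
            - 2 * F.k x * F.a x) * r 1
        + (-2 * F.k x * F.b x) * r 2 = 0 ∧
      (-2 * F.k x * F.q x) * r 0 + (-2 * F.k x * F.b x) * r 1
        + (F.p x ^ 2 + F.q x ^ 2 - F.k x ^ 2 + F.b x ^ 2 - F.a x * F.c x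
            - 2 * F.k x * F.c x) * r 2 = 0 ∧
      (2 * F.k x * F.b x) * r 0 + (F.p x * F.b x + F.a x * F.q x - b₁) * r 1
        + (-c₁ - 2 * F.k x * F.p x + 2 * F.q x * F.b x) * r 2 = 0 ∧
      (2 * F.k x * F.c x) * r 0 + (2 * F.k x * F.p x + F.p x * F.c x + F.b x * F.q x - b₂) * r 1
        + (-c₂ + 2 * F.q x * F.c x) * r 2 = 0 ∧
      (-2 * F.k x * F.a x) * r 0 + (a₁ - 2 * F.p x * F.a x) * r 1
        + (-2 * F.k x * F.q x - F.q x * F.a x - F.b x * F.p x + b₁) * r 2 = 0 ∧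
      (-2 * F.k x * F.b x) * r 0 + (a₂ + 2 * F.k x * F.q x - 2 * F.p x * F.b x) * r 1
        + (-F.q x * F.b x - F.c x * F.p x + b₂) * r 2 = 0 ∧
      (F.p x ^ 2 + F.q x ^ 2 - F.k x ^ 2 + F.a x * F.c x - F.b x ^ 2
            - 2 * F.k x * (F.a x + F.c x)) * r 0
        + (F.b x * F.q x - F.c x * F.p x + a₁ + b₂) * r 1
        + (F.b x * F.p x - F.a x * F.q x + c₂ + b₁) * r 2 = 0 := by
  obtain ⟨h₁, h₂, hη⟩ := h.conn_mem
  obtain ⟨a₁, a₂, ha⟩ := h.d_a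
  obtain ⟨b₁, b₂, hb⟩ := h.d_b
  obtain ⟨c₁, c₂, hc⟩ := h.d_c
  have hli : LinearIndependent 𝕜 (fun i => F.frame₂ i x) := by
    obtain ⟨X₃, d1, d2, d3, d4, d5, d6, d7, d8, d9⟩ := h.exists_vector hη 0 0 0 1 0 0 0 0
    obtain ⟨X₄, e1, e2, e3, e4, e5, e6, e7, e8, e9⟩ := h.exists_vector hη 0 0 0 0 1 0 0 0
    obtain ⟨X₅, f1, f2, f3, f4, f5, f6, f7, f8, f9⟩ := h.exists_vector hη 0 0 0 0 0 1 0 0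
    refine linearIndependent_of_dual
      (X := ![X₃.toLinearMap, X₄.toLinearMap, X₅.toLinearMap]) fun i j => ?_
    fin_cases i <;> fin_cases j <;>
      simp [frame₂, α', β₁', β₂', α, β₁, β₂, θ₁, θ₂, θ₃, s₁, s₂, d1, d2, d3, d4, d5, d6, d7, d8,
        d9, e1, e2, e3, e4, e5, e6, e7, e8, e9, f1, f2, f3, f4, f5, f6, f7, f8, f9]
  -- These are the components of the covariant derivative of the symmetric tensor with entries `a,
  -- b, c`; with them the connection coefficients `h₁, h₂` drop out of the equations.
  refine ⟨a₁ + 2 * F.b x * h₁, a₂ + 2 * F.b x * h₂, b₁ + (F.c x - F.a x) * h₁,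
    b₂ + (F.c x - F.a x) * h₂, c₁ - 2 * F.b x * h₁, c₂ - 2 * F.b x * h₂, fun ζ hζ => ?_⟩
  obtain ⟨r, hr₀, hr⟩ := exists_coeff_of_mem_derivedSystem (w := F.frame₂) (fun i => by
    fin_cases i
    exacts [h.diff_α', h.diff_β₁', h.diff_β₂']) hli hV hζ
  refine ⟨r, hr₀, ?_⟩
  -- `T₀, T₁, T₂` are the vectors dual to `ω₃, θ₁, θ₂`, corrected so as to annihilate `frame₂`.
  obtain ⟨T₀, o1, o2, o3, o4, o5, o6, o7, o8, o9⟩ :=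
    h.exists_vector hη 1 0 0 (F.k x) (-F.p x) (-F.q x) 0 0
  obtain ⟨T₁, p1, p2, p3, p4, p5, p6, p7, p8, p9⟩ :=
    h.exists_vector hη 0 1 0 (-F.q x) (-F.b x) (-F.c x) 0 0
  obtain ⟨T₂, q1, q2, q3, q4, q5, q6, q7, q8, q9⟩ :=
    h.exists_vector hη 0 0 1 (F.p x) (F.a x) (F.b x) 0 0
  obtain ⟨U₁, v1, v2, v3, v4, v5, v6, v7, v8, v9⟩ := h.exists_vector hη 0 0 0 0 0 0 1 0
  obtain ⟨U₂, w1, w2, w3, w4, w5, w6, w7, w8, w9⟩ := h.exists_vector hη 0 0 0 0 0 0 0 1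
  have hT₀ : ∀ i, T₀ (F.frame₂ i x) = 0 := fun i => by
    fin_cases i <;> simp [frame₂, α', β₁', β₂', α, β₁, β₂, θ₁, θ₂, θ₃, s₁, s₂, *]
  have hT₁ : ∀ i, T₁ (F.frame₂ i x) = 0 := fun i => by
    fin_cases i <;> simp [frame₂, α', β₁', β₂', α, β₁, β₂, θ₁, θ₂, θ₃, s₁, s₂, *]
  have hT₂ : ∀ i, T₂ (F.frame₂ i x) = 0 := fun i => by
    fin_cases i <;> simp [frame₂, α', β₁', β₂', α, β₁, β₂, θ₁, θ₂, θ₃, s₁, s₂, *]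
  have hU₁ : ∀ i, U₁ (F.frame₂ i x) = 0 := fun i => by
    fin_cases i <;> simp [frame₂, α', β₁', β₂', α, β₁, β₂, θ₁, θ₂, θ₃, s₁, s₂, *]
  have hU₂ : ∀ i, U₂ (F.frame₂ i x) = 0 := fun i => by
    fin_cases i <;> simp [frame₂, α', β₁', β₂', α, β₁, β₂, θ₁, θ₂, θ₃, s₁, s₂, *]
  -- The pairs `(T₀, Uᵢ)` and `(U₁, U₂)` would give nothing new: their conditions are those already
  -- built into `frame₁` and `frame₂`.
  have k01 := hr T₀ T₁ hT₀ hT₁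
  have k02 := hr T₀ T₂ hT₀ hT₂
  have k11 := hr T₁ U₁ hT₁ hU₁
  have k12 := hr T₁ U₂ hT₁ hU₂
  have k21 := hr T₂ U₁ hT₂ hU₁
  have k22 := hr T₂ U₂ hT₂ hU₂
  have k33 := hr T₁ T₂ hT₁ hT₂
  clear hT₀ hT₁ hT₂ hU₁ hU₂ hr
  simp only [frame₂, Fin.sum_univ_three, Matrix.cons_val, h.d_α', h.d_β₁', h.d_β₂', h.d_α, h.d_β₁,
    h.d_β₂, h.d_θ₁, h.d_θ₂, h.d_θ₃, h.d_s₁, h.d_s₂, h.d_ω₁, h.d_ω₂, h.d_ω₃, h.d_ω₁₂, h.d_ψ₁, h.d_ψ₂,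
    h.d_η₁, h.d_η₂, h.d_η₁₂, h.d_k, h.d_p, h.d_q, ha, hb, hc, θ₁, θ₂, map_sub,
    map_add, eval₂_sub, eval₂_neg, eval₂_smul, eval₂_wedge, apply_smul, o1, o2, o3, o4, o5, o6, o7,
    o8, o9, p1, p2, p3, p4, p5, p6, p7, p8, p9, q1, q2, q3, q4, q5, q6, q7, q8, q9, v1, v2, v3, v4,
    v5, v6, v7, v8, v9, w1, w2, w3, w4, w5, w6, w7, w8, w9] at k01 k02 k11 k12 k21 k22 k33
  refine ⟨?_, ?_, ?_, ?_, ?_, ?_, ?_⟩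
  · linear_combination k01
  · linear_combination k02
  · linear_combination k11
  · linear_combination k12
  · linear_combination k21
  · linear_combination k22
  · linear_combination k33

end IsAdaptedAt
end EmbeddingCoframe
end DerivedFlag

section DerivedFlag

/-- Two independent elements of `D` have independent coefficient vectors, even if `w` is dependent;
the conclusion is that the cross product of `r` and `s` is nonzero. -/
theorem exists_coeff_of_two_le_finrank {𝕜 V : Type*} [Field 𝕜] [AddCommGroup V] [Module 𝕜 V]
    [FiniteDimensional 𝕜 V] {D : Submodule 𝕜 V} (hD : 2 ≤ Module.finrank 𝕜 D) {w : Fin 3 → V}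
    {P : (Fin 3 → 𝕜) → Prop} (h : ∀ ζ ∈ D, ∃ r : Fin 3 → 𝕜, ζ = ∑ i, r i • w i ∧ P r) :
    ∃ r s : Fin 3 → 𝕜, P r ∧ P s ∧ (r 1 * s 2 - r 2 * s 1 ≠ 0 ∨ r 2 * s 0 - r 0 * s 2 ≠ 0 ∨
      r 0 * s 1 - r 1 * s 0 ≠ 0) := by
  obtain ⟨f, hf⟩ := exists_linearIndependent_of_le_finrank hD
  obtain ⟨r, hr, hPr⟩ := h _ (f 0).2
  obtain ⟨s, hs, hPs⟩ := h _ (f 1).2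
  refine ⟨r, s, hPr, hPs, ?_⟩
  by_contra! hcon
  obtain ⟨e0, e1, e2⟩ := hcon
  have hli : ∀ u v : 𝕜, (∀ i, u * r i + v * s i = 0) → u = 0 ∧ v = 0 := by
    intro u v huv
    refine LinearIndependent.pair_iff.1
      (show LinearIndependent 𝕜 ![f 0, f 1] by convert hf using 1; ext i; fin_cases i <;> rfl)
      u v ?_
    apply Subtype.ext
    have : u • (f 0 : V) + v • (f 1 : V) = ∑ i, (u * r i + v * s i) • w i := by
      rw [hr, hs]
      simp only [Finset.smul_sum, ← Finset.sum_add_distrib, add_smul, mul_smul]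
    simpa [huv] using this
  -- If the cross product vanishes, then `sᵢ r - rᵢ s = 0` for every `i`, a linear relation between
  -- the two elements.
  have hs0 : ∀ i, s i = 0 := by
    intro i
    have key : ∀ j, s i * r j + -r i * s j = 0 := by
      intro j
      fin_cases i <;> fin_cases j <;> simp only [Fin.zero_eta, Fin.mk_one, Fin.reduceFinMk] <;>
        first | ring1 | linear_combination e0 | linear_combination -e0 | linear_combination e1 |
          linear_combination -e1 | linear_combination e2 | linear_combination -e2
    exact (hli _ _ key).1
  have := (hli 0 1 (fun i => by simp [hs0 i])).2
  exact one_ne_zero this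

/-- The algebraic consequences of the integrability of the second derived system. -/
theorem second_order_of_proportional {𝕜 : Type*} [Field 𝕜] [NeZero (2 : 𝕜)]
    {k p q a b c m l : 𝕜} (hk : k ≠ 0)
    (h₁ : p ^ 2 + q ^ 2 - k ^ 2 + b ^ 2 - a * c - 2 * k * a = -2 * k * p * m) (h₂ : b = q * m)
    (h₃ : p ^ 2 + q ^ 2 - k ^ 2 + b ^ 2 - a * c - 2 * k * c = -2 * k * q * l) (h₄ : b = p * l)
    (h₅ : q = a * l - b * m) (h₆ : p = c * m - b * l) :
    k * a = -(k ^ 2 + p ^ 2) ∧ k * b = -(p * q) ∧ k * c = -(k ^ 2 + q ^ 2) := by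
  have key : ∀ {p q a b c m l : 𝕜}, p ≠ 0 →
      p ^ 2 + q ^ 2 - k ^ 2 + b ^ 2 - a * c - 2 * k * a = -2 * k * p * m → b = q * m →
      p ^ 2 + q ^ 2 - k ^ 2 + b ^ 2 - a * c - 2 * k * c = -2 * k * q * l → b = p * l →
      p = c * m - b * l →
      k * a = -(k ^ 2 + p ^ 2) ∧ k * b = -(p * q) ∧ k * c = -(k ^ 2 + q ^ 2) := by
    intro p q a b c m l hp h₁ h₂ h₃ h₄ h₆
    -- For `p ≠ 0` the symmetric tensor with entries `a, b, c` takes the form `n·1 + t (p,q)⊗(p,q)`.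
    -- Then `h₆` gives `tn = 1`, and `h₁` becomes `(n + k)² = 0`, so `n = -k`.
    obtain ⟨t, rfl⟩ : ∃ t, m = p * t := ⟨m / p, by field_simp⟩
    have hl : l = q * t := mul_left_cancel₀ hp (by linear_combination h₂ - h₄)
    subst hl h₂
    obtain ⟨n, rfl⟩ : ∃ n, c = n + q ^ 2 * t := ⟨c - q ^ 2 * t, by ring⟩
    have hnt : t * n = 1 := mul_left_cancel₀ hp (by linear_combination -h₆)
    have ha : a = n + p ^ 2 * t := by
      refine mul_left_cancel₀ (mul_ne_zero two_ne_zero hk) ?_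
      linear_combination h₃ - h₁
    subst ha
    have hn : (n + k) ^ 2 = 0 := by
      linear_combination -h₁ - (p ^ 2 + q ^ 2) * hnt
    have hn' : n = -k := by linear_combination pow_eq_zero_iff (two_ne_zero) |>.1 hn
    subst hn'
    exact ⟨by linear_combination -p ^ 2 * hnt, by linear_combination -(p * q) * hnt,
      by linear_combination -q ^ 2 * hnt⟩
  by_cases hp : p = 0
  · by_cases hq : q = 0
    · subst hp hq
      have hb : b = 0 := by rw [h₂]; ring
      subst hb
      have hac : a = c := by
        refine mul_left_cancel₀ (mul_ne_zero two_ne_zero hk) ?_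
        linear_combination h₃ - h₁
      subst hac
      have hn : (a + k) ^ 2 = 0 := by linear_combination -h₁
      have ha : a = -k := by linear_combination pow_eq_zero_iff (two_ne_zero) |>.1 hn
      subst ha
      exact ⟨by ring, by ring, by ring⟩
    -- The equations are symmetric under interchange of the two directions of the surface.
    · obtain ⟨r₁, r₂, r₃⟩ := key (p := q) (q := p) (a := c) (b := b) (c := a) (m := l) (l := m) hq
        (by linear_combination h₃) h₄ (by linear_combination h₁) h₂ h₅
      exact ⟨r₃, by linear_combination r₂, r₁⟩
  · exact key hp h₁ h₂ h₃ h₄ h₆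

namespace EmbeddingCoframe

variable {𝕜 : Type*} [RCLike 𝕜] {E : Type*} [NormedAddCommGroup E] [NormedSpace ℝ E]
  [FiniteDimensional ℝ E] {F : EmbeddingCoframe 𝕜 E} {x : E}

/-- Two independent solutions in three unknowns make every row of the linear system a multiple of
their cross product `(n₀, n₁, n₂)`. Once `n₀ ≠ 0`, each row is its first entry times `(1, m, l)`. -/
theorem IsAdaptedAt.second_order_of_derivedSystem (h : F.IsAdaptedAt x)
    {V : E → Submodule 𝕜 (E →L[ℝ] 𝕜)} (hV : ∀ᶠ y in 𝓝 x, V y ≤ spanAt F.frame₂ y)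
    (hfin : 2 ≤ Module.finrank 𝕜 (derivedSystem V x)) :
    F.k x * F.a x = -(F.k x ^ 2 + F.p x ^ 2) ∧ F.k x * F.b x = -(F.p x * F.q x) ∧
      F.k x * F.c x = -(F.k x ^ 2 + F.q x ^ 2) := by
  obtain ⟨a₁, a₂, b₁, b₂, c₁, c₂, hD⟩ := h.exists_coeff_of_mem_derivedSystem_frame₂ hV
  obtain ⟨r, s, hr, hs, hne⟩ := exists_coeff_of_two_le_finrank hfin hD
  have hk := h.k_ne
  generalize F.k x = k at *
  generalize F.p x = p at *
  generalize F.q x = q at *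
  generalize F.a x = a at *
  generalize F.b x = b at *
  generalize F.c x = c at *
  have h2k : 2 * k ≠ 0 := mul_ne_zero two_ne_zero hk
  obtain ⟨n₀, hn₀⟩ : ∃ n₀, n₀ = r 1 * s 2 - r 2 * s 1 := ⟨_, rfl⟩
  obtain ⟨n₁, hn₁⟩ : ∃ n₁, n₁ = r 2 * s 0 - r 0 * s 2 := ⟨_, rfl⟩
  obtain ⟨n₂, hn₂⟩ : ∃ n₂, n₂ = r 0 * s 1 - r 1 * s 0 := ⟨_, rfl⟩
  rw [← hn₀, ← hn₁, ← hn₂] at hne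
  have minor : ∀ {u v w : 𝕜}, u * r 0 + v * r 1 + w * r 2 = 0 →
      u * s 0 + v * s 1 + w * s 2 = 0 → u * n₁ = v * n₀ ∧ u * n₂ = w * n₀ := by
    intro u v w h₁ h₂
    rw [hn₀, hn₁, hn₂]
    exact ⟨by linear_combination r 2 * h₂ - s 2 * h₁, by linear_combination s 1 * h₁ - r 1 * h₂⟩
  obtain ⟨r₁, r₂, r₃, r₄, r₅, r₆, r₇⟩ := hr
  obtain ⟨s₁, s₂, s₃, s₄, s₅, s₆, s₇⟩ := hs
  have m₁ := minor r₁ s₁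
  have m₂ := minor r₂ s₂
  have m₃ := minor r₃ s₃
  have m₄ := minor r₄ s₄
  have m₅ := minor r₅ s₅
  have m₆ := minor r₆ s₆
  have m₇ := minor r₇ s₇
  -- If `n₀ = 0`, the first entry of every row vanishes; rows one to five give `p = q = b = c = a =
  -- 0`, and the last row then says `-k² = 0`.
  have hn : n₀ ≠ 0 := by
    rintro rfl
    have zero : ∀ {u v w : 𝕜}, u * n₁ = v * 0 ∧ u * n₂ = w * 0 → u = 0 := by
      intro u v w ⟨h₁, h₂⟩
      rw [mul_zero] at h₁ h₂
      rcases hne with h0 | h0 | h0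
      · exact absurd rfl h0
      · exact (mul_eq_zero.1 h₁).resolve_right h0
      · exact (mul_eq_zero.1 h₂).resolve_right h0
    have hp : p = 0 := mul_left_cancel₀ h2k (by linear_combination -zero m₁)
    have hq : q = 0 := mul_left_cancel₀ h2k (by linear_combination -zero m₂)
    have hb : b = 0 := mul_left_cancel₀ h2k (by linear_combination zero m₃)
    have hc : c = 0 := mul_left_cancel₀ h2k (by linear_combination zero m₄)
    have ha : a = 0 := mul_left_cancel₀ h2k (by linear_combination -zero m₅)
    have := zero m₇
    subst hp hq hb hc ha
    refine hk (pow_eq_zero_iff (two_ne_zero) |>.1 (?_ : k ^ 2 = 0))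
    linear_combination -this
  obtain ⟨m, rfl⟩ : ∃ m, n₁ = m * n₀ := ⟨n₁ / n₀, by field_simp⟩
  obtain ⟨l, rfl⟩ : ∃ l, n₂ = l * n₀ := ⟨n₂ / n₀, by field_simp⟩
  have cancel : ∀ {u v w : 𝕜}, u * (m * n₀) = v * n₀ ∧ u * (l * n₀) = w * n₀ →
      v = u * m ∧ w = u * l := fun h' =>
    ⟨mul_right_cancel₀ hn (by linear_combination -h'.1),
      mul_right_cancel₀ hn (by linear_combination -h'.2)⟩
  refine second_order_of_proportional (m := m) (l := l) hk ?_ ?_ ?_ ?_ ?_ ?_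
  · linear_combination (cancel m₁).1
  · exact mul_left_cancel₀ h2k (by linear_combination -(cancel m₂).1)
  · linear_combination (cancel m₂).2
  · exact mul_left_cancel₀ h2k (by linear_combination -(cancel m₁).2)
  -- The third order unknowns `b₁` and `b₂` cancel in the sums of rows three and five, and of rows
  -- four and six.
  · exact mul_left_cancel₀ h2k (by linear_combination -(cancel m₃).1 - (cancel m₅).2)
  · exact mul_left_cancel₀ h2k (by linear_combination (cancel m₄).1 + (cancel m₆).2)

/-- If a Pfaffian system is contained in the singular system and the final member of its derived
flag has rank at least two, then the second covariant derivatives of `log k` are determined. -/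
theorem second_order_of_derivedLimit (h : ∀ᶠ y in 𝓝 x, F.IsAdaptedAt y)
    {V : E → Submodule 𝕜 (E →L[ℝ] 𝕜)} (hV : ∀ᶠ y in 𝓝 x, V y ≤ spanAt F.frame₀ y)
    (hfin : 2 ≤ Module.finrank 𝕜 (derivedLimit V x)) :
    F.k x * F.a x = -(F.k x ^ 2 + F.p x ^ 2) ∧ F.k x * F.b x = -(F.p x * F.q x) ∧
      F.k x * F.c x = -(F.k x ^ 2 + F.q x ^ 2) := by
  have hV₁ : ∀ᶠ y in 𝓝 x, derivedFlag V 1 y ≤ spanAt F.frame₁ y := by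
    filter_upwards [h, hV.eventually_nhds] with y hy hy' using hy.derivedSystem_le_frame₁ hy'
  have hV₂ : ∀ᶠ y in 𝓝 x, derivedFlag V 2 y ≤ spanAt F.frame₂ y := by
    filter_upwards [h, hV₁.eventually_nhds] with y hy hy' using hy.derivedSystem_le_frame₂ hy'
  refine h.self_of_nhds.second_order_of_derivedSystem hV₂ (hfin.trans ?_)
  exact Submodule.finrank_mono (iInf_le _ 3)

end EmbeddingCoframe
end DerivedFlag

/-! ### The singular systems of an arbitrary decomposition. -/

section Decomposition

variable {𝕜 : Type*} [RCLike 𝕜] {E : Type*} [NormedAddCommGroup E] [NormedSpace ℝ E]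

theorem eval₂_of_mem_exterior₂ {σ : Fin 2 → E →L[ℝ] 𝕜} {B : E →L[ℝ] E →L[ℝ] 𝕜}
    (hB : B ∈ exterior₂ (Submodule.span 𝕜 (Set.range σ))) :
    ∃ e : 𝕜, ∀ X Y, eval₂ X Y B = e * (X (σ 0) * Y (σ 1) - X (σ 1) * Y (σ 0)) := by
  induction hB using Submodule.span_induction with
  | mem B h =>
    obtain ⟨α, hα, β, hβ, rfl⟩ := h
    obtain ⟨c, rfl⟩ := (Submodule.mem_span_range_iff_exists_fun 𝕜).1 hα
    obtain ⟨d, rfl⟩ := (Submodule.mem_span_range_iff_exists_fun 𝕜).1 hβ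
    refine ⟨c 0 * d 1 - c 1 * d 0, fun X Y => ?_⟩
    simp only [Fin.sum_univ_two, eval₂_wedge, map_add, EmbeddingCoframe.apply_smul]
    ring
  | zero => exact ⟨0, by simp⟩
  | add B C _ _ hB hC =>
    obtain ⟨e, he⟩ := hB
    obtain ⟨f, hf⟩ := hC
    exact ⟨e + f, fun X Y => by rw [map_add, he, hf]; ring⟩
  | smul c B _ hB =>
    obtain ⟨e, he⟩ := hB
    exact ⟨c * e, fun X Y => by rw [EmbeddingCoframe.eval₂_smul, he]; ring⟩

/-- Since `Λ²` of a span of two covectors is at most a line, only multiples of `σ₀ ∧ σ₁` and `τ₀ ∧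
τ₁` survive on the annihilator of `T`. -/
theorem eval₂_of_mem_ideal₂_sup {T : Submodule 𝕜 (E →L[ℝ] 𝕜)} {σ τ : Fin 2 → E →L[ℝ] 𝕜} {s t : ℕ}
    {Φ : Fin s → E →L[ℝ] E →L[ℝ] 𝕜} {Ψ : Fin t → E →L[ℝ] E →L[ℝ] 𝕜}
    (hΦ : ∀ i, Φ i ∈ exterior₂ (Submodule.span 𝕜 (Set.range σ)))
    (hΨ : ∀ i, Ψ i ∈ exterior₂ (Submodule.span 𝕜 (Set.range τ))) {B : E →L[ℝ] E →L[ℝ] 𝕜}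
    (hB : B ∈ ideal₂ T ⊔ Submodule.span 𝕜 (Set.range Φ) ⊔ Submodule.span 𝕜 (Set.range Ψ)) :
    ∃ e f : 𝕜, ∀ X Y : (E →L[ℝ] 𝕜) →L[𝕜] 𝕜, (∀ α ∈ T, X α = 0) → (∀ α ∈ T, Y α = 0) →
      eval₂ X Y B = e * (X (σ 0) * Y (σ 1) - X (σ 1) * Y (σ 0)) +
        f * (X (τ 0) * Y (τ 1) - X (τ 1) * Y (τ 0)) := by
  have hspan : ∀ {n : ℕ} {Ξ : Fin n → E →L[ℝ] E →L[ℝ] 𝕜} {υ : Fin 2 → E →L[ℝ] 𝕜},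
      (∀ i, Ξ i ∈ exterior₂ (Submodule.span 𝕜 (Set.range υ))) →
      Submodule.span 𝕜 (Set.range Ξ) ≤ exterior₂ (Submodule.span 𝕜 (Set.range υ)) := by
    intro n Ξ υ h
    refine Submodule.span_le.2 ?_
    rintro _ ⟨i, rfl⟩
    exact h i
  obtain ⟨B', hB', B₃, h₃, rfl⟩ := Submodule.mem_sup.1 hB
  obtain ⟨B₁, h₁, B₂, h₂, rfl⟩ := Submodule.mem_sup.1 hB'
  obtain ⟨e, he⟩ := eval₂_of_mem_exterior₂ (hspan hΦ h₂)
  obtain ⟨f, hf⟩ := eval₂_of_mem_exterior₂ (hspan hΨ h₃)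
  refine ⟨e, f, fun X Y hX hY => ?_⟩
  rw [map_add, map_add, eval₂_eq_zero_of_mem_ideal₂ h₁ hX hY, he, hf, zero_add]

namespace EmbeddingCoframe

variable (F : EmbeddingCoframe 𝕜 E)

/-- The generators of the isometric embedding system. -/
def system : Fin 4 → E → E →L[ℝ] 𝕜 := ![F.ω₃, F.θ₁, F.θ₂, F.θ₃]

/-- The other choice of the square root of minus the Gauss curvature. -/
def neg : EmbeddingCoframe 𝕜 E :=
  { F with
    k := fun y => -F.k y
    a := fun y => -F.a y
    b := fun y => -F.b y
    c := fun y => -F.c y }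

variable {F} {x : E}

/-- The functions `p, q` come from `dk / 2k` and ignore the sign of `k`; `a, b, c` enter only
through `ka, kb, kc`, so they change sign with `k`. -/
theorem IsAdaptedAt.neg (h : F.IsAdaptedAt x) : F.neg.IsAdaptedAt x where
  indep := h.indep
  conn_mem := h.conn_mem
  k_ne := neg_ne_zero.2 h.k_ne
  diff_ω₁ := h.diff_ω₁
  diff_ω₂ := h.diff_ω₂
  diff_ω₃ := h.diff_ω₃
  diff_ω₁₂ := h.diff_ω₁₂
  diff_ψ₁ := h.diff_ψ₁
  diff_ψ₂ := h.diff_ψ₂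
  diff_η₁ := h.diff_η₁
  diff_η₂ := h.diff_η₂
  diff_η₁₂ := h.diff_η₁₂
  diff_k := h.diff_k.neg
  diff_p := h.diff_p
  diff_q := h.diff_q
  diff_a := h.diff_a.neg
  diff_b := h.diff_b.neg
  diff_c := h.diff_c.neg
  d_ω₁ := h.d_ω₁
  d_ω₂ := h.d_ω₂
  d_ω₃ := h.d_ω₃
  d_ω₁₂ := h.d_ω₁₂
  d_ψ₁ := h.d_ψ₁
  d_ψ₂ := h.d_ψ₂
  d_η₁ := h.d_η₁
  d_η₂ := h.d_η₂
  d_η₁₂ := by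
    have := h.d_η₁₂
    simp only [EmbeddingCoframe.neg, neg_sq]
    exact this
  d_k := by
    have : fderiv ℝ F.neg.k x = -fderiv ℝ F.k x := fderiv_fun_neg
    rw [this, h.d_k]
    ext v
    simp [EmbeddingCoframe.neg]
    ring
  d_p := by
    have := h.d_p
    simp only [EmbeddingCoframe.neg, neg_sq, mul_neg, neg_mul, neg_neg] at this ⊢
    exact this
  d_q := by
    have := h.d_q
    simp only [EmbeddingCoframe.neg, neg_sq, mul_neg, neg_mul, neg_neg] at this ⊢
    exact this
  d_a := by
    obtain ⟨u, v, huv⟩ := h.d_a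
    refine ⟨-u, -v, ?_⟩
    have : fderiv ℝ F.neg.a x = -fderiv ℝ F.a x := fderiv_fun_neg
    rw [this, huv]
    ext w
    simp [EmbeddingCoframe.neg]
    ring
  d_b := by
    obtain ⟨u, v, huv⟩ := h.d_b
    refine ⟨-u, -v, ?_⟩
    have : fderiv ℝ F.neg.b x = -fderiv ℝ F.b x := fderiv_fun_neg
    rw [this, huv]
    ext w
    simp [EmbeddingCoframe.neg]
    ring
  d_c := by
    obtain ⟨u, v, huv⟩ := h.d_c
    refine ⟨-u, -v, ?_⟩
    have : fderiv ℝ F.neg.c x = -fderiv ℝ F.c x := fderiv_fun_neg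
    rw [this, huv]
    ext w
    simp [EmbeddingCoframe.neg]
    ring

variable [FiniteDimensional ℝ E]

/-- A covector whose restriction to the annihilator of the system vanishes belongs to it. -/
theorem IsAdaptedAt.mem_span_system (h : F.IsAdaptedAt x)
    (hdim : Module.finrank 𝕜 (E →L[ℝ] 𝕜) = 8) {ζ : E →L[ℝ] 𝕜}
    (hζ : ∀ X : (E →L[ℝ] 𝕜) →L[𝕜] 𝕜, (∀ α ∈ spanAt F.system x, X α = 0) → X ζ = 0) :
    ζ ∈ spanAt F.system x := by
  obtain ⟨h₁, h₂, hη⟩ := h.conn_mem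
  have htop := h.indep.span_eq_top_of_card_eq_finrank (by simp [hdim])
  obtain ⟨r, rfl⟩ := (Submodule.mem_span_range_iff_exists_fun 𝕜).1
    (htop.symm ▸ Submodule.mem_top : ζ ∈ Submodule.span 𝕜 (Set.range _))
  have hann : ∀ X : (E →L[ℝ] 𝕜) →L[𝕜] 𝕜, X (F.ω₃ x) = 0 → X (F.θ₁ x) = 0 → X (F.θ₂ x) = 0 →
      X (F.θ₃ x) = 0 → ∀ α ∈ spanAt F.system x, X α = 0 := by
    intro X e₀ e₁ e₂ e₃ α hα
    obtain ⟨c, rfl⟩ := (Submodule.mem_span_range_iff_exists_fun 𝕜).1 hα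
    simp [system, Fin.sum_univ_four, e₀, e₁, e₂, e₃]
  obtain ⟨S₁, v1, v2, v3, v4, v5, v6, v7, v8, v9⟩ := h.exists_vector hη 0 0 0 0 1 0 0 0
  obtain ⟨S₂, w1, w2, w3, w4, w5, w6, w7, w8, w9⟩ := h.exists_vector hη 0 0 0 0 0 1 0 0
  -- Together with `S₁, S₂`, these are the vectors in the annihilator of the system dual to `ψ₁, ψ₂,
  -- ω₁, ω₂`; the entries `±k` convert values on `s₁, s₂` into zero values on `ψ₁, ψ₂`.
  obtain ⟨U₁, p1, p2, p3, p4, p5, p6, p7, p8, p9⟩ := h.exists_vector hη 0 0 0 0 0 (F.k x) 1 0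
  obtain ⟨U₂, q1, q2, q3, q4, q5, q6, q7, q8, q9⟩ := h.exists_vector hη 0 0 0 0 (-F.k x) 0 0 1
  have e₁ := hζ S₁ (hann S₁ v3 (by simp [θ₁, v1, v7]) (by simp [θ₂, v2, v8])
    (by simp [θ₃, v4, v9]))
  have e₂ := hζ S₂ (hann S₂ w3 (by simp [θ₁, w1, w7]) (by simp [θ₂, w2, w8])
    (by simp [θ₃, w4, w9]))
  have e₃ := hζ U₁ (hann U₁ p3 (by simp [θ₁, p1, p7]) (by simp [θ₂, p2, p8])
    (by simp [θ₃, p4, p9]))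
  have e₄ := hζ U₂ (hann U₂ q3 (by simp [θ₁, q1, q7]) (by simp [θ₂, q2, q8])
    (by simp [θ₃, q4, q9]))
  simp only [Fin.sum_univ_eight, Matrix.cons_val, map_add, apply_smul, v1, v2, v3, v4, v5, v6, v7,
    v8, w1, w2, w3, w4, w5, w6, w7, w8, p1, p2, p3, p4, p5, p6, p7, p8, q1, q2, q3, q4, q5, q6, q7,
    q8] at e₁ e₂ e₃ e₄
  have f₁ : r 4 = 0 := by linear_combination e₁
  have f₂ : r 5 = 0 := by linear_combination e₂
  have f₃ : r 6 = -r 0 - h₁ * r 3 := by linear_combination e₃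
  have f₄ : r 7 = -r 1 - h₂ * r 3 := by linear_combination e₄
  refine (Submodule.mem_span_range_iff_exists_fun 𝕜).2 ⟨![r 2, r 0, r 1, r 3], ?_⟩
  ext v
  simp [system, Fin.sum_univ_four, Fin.sum_univ_eight, θ₁, θ₂, θ₃, hη, f₁, f₂, f₃, f₄]
  ring

end EmbeddingCoframe
end Decomposition

section Decomposition

variable {𝕜 : Type*} [RCLike 𝕜] {E : Type*} [NormedAddCommGroup E] [NormedSpace ℝ E]
  [FiniteDimensional ℝ E]

namespace EmbeddingCoframe

variable {F : EmbeddingCoframe 𝕜 E} {x : E}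

omit [FiniteDimensional ℝ E] in
variable (F) in
theorem span_frame₀_le {S : Submodule 𝕜 (E →L[ℝ] 𝕜)} (hS : spanAt F.system x ≤ S)
    (h₁ : F.s₁ x ∈ S) (h₂ : F.s₂ x ∈ S) : spanAt F.frame₀ x ≤ S := by
  have hm : ∀ i, F.system i x ∈ S := fun i => hS (Submodule.subset_span (Set.mem_range_self i))
  refine Submodule.span_le.2 ?_
  rintro _ ⟨i, rfl⟩
  fin_cases i
  exacts [hm 0, hm 1, hm 2, hm 3, h₁, h₂]

/-- If the system is generated, in degree two, by two decomposable `2`-forms, then these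
are the decomposable `2`-forms of the pencil spanned by `dω³` and `d(ω¹₂ - η¹₂)`. -/
theorem IsAdaptedAt.span_frame₀_le_or (h : F.IsAdaptedAt x)
    (hdim : Module.finrank 𝕜 (E →L[ℝ] 𝕜) = 8) {σ τ : Fin 2 → E →L[ℝ] 𝕜}
    (hσ : ∃ X Y : (E →L[ℝ] 𝕜) →L[𝕜] 𝕜, (∀ α ∈ spanAt F.system x, X α = 0) ∧
      (∀ α ∈ spanAt F.system x, Y α = 0) ∧ X (σ 0) * Y (σ 1) - X (σ 1) * Y (σ 0) ≠ 0)
    (hd : ∀ i, ∃ e f : 𝕜, ∀ X Y : (E →L[ℝ] 𝕜) →L[𝕜] 𝕜, (∀ α ∈ spanAt F.system x, X α = 0) →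
      (∀ α ∈ spanAt F.system x, Y α = 0) →
      eval₂ X Y (extD (F.system i) x) = e * (X (σ 0) * Y (σ 1) - X (σ 1) * Y (σ 0)) +
        f * (X (τ 0) * Y (τ 1) - X (τ 1) * Y (τ 0))) :
    spanAt F.frame₀ x ≤ spanAt F.system x ⊔ Submodule.span 𝕜 (Set.range σ) ∨
      spanAt F.neg.frame₀ x ≤ spanAt F.system x ⊔ Submodule.span 𝕜 (Set.range σ) := by
  obtain ⟨h₁, h₂, hη⟩ := h.conn_mem
  have hk := h.k_ne
  have hann : ∀ X : (E →L[ℝ] 𝕜) →L[𝕜] 𝕜, X (F.ω₃ x) = 0 → X (F.θ₁ x) = 0 → X (F.θ₂ x) = 0 →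
      X (F.θ₃ x) = 0 → ∀ α ∈ spanAt F.system x, X α = 0 := by
    intro X e₀ e₁ e₂ e₃ α hα
    obtain ⟨c, rfl⟩ := (Submodule.mem_span_range_iff_exists_fun 𝕜).1 hα
    simp [system, Fin.sum_univ_four, e₀, e₁, e₂, e₃]
  have hann' : ∀ X : (E →L[ℝ] 𝕜) →L[𝕜] 𝕜, (∀ α ∈ spanAt F.system x, X α = 0) →
      X (F.ω₃ x) = 0 ∧ X (F.η₁ x) = X (F.ω₁ x) ∧ X (F.η₂ x) = X (F.ω₂ x) ∧
      X (F.ω₁₂ x) = X (F.η₁₂ x) := by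
    intro X hX
    have hm : ∀ i, X (F.system i x) = 0 := fun i =>
      hX _ (Submodule.subset_span (Set.mem_range_self i))
    have m₁ : X (F.ω₁ x - F.η₁ x) = 0 := hm 1
    have m₂ : X (F.ω₂ x - F.η₂ x) = 0 := hm 2
    have m₃ : X (F.ω₁₂ x - F.η₁₂ x) = 0 := hm 3
    rw [map_sub] at m₁ m₂ m₃
    exact ⟨hm 0, (sub_eq_zero.1 m₁).symm, (sub_eq_zero.1 m₂).symm, sub_eq_zero.1 m₃⟩
  obtain ⟨x₀, y₀, hd₀⟩ := hd 0
  obtain ⟨x₁, y₁, hd₁⟩ := hd 3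
  have hB₀ : ∀ X Y : (E →L[ℝ] 𝕜) →L[𝕜] 𝕜, eval₂ X Y (extD (F.system 0) x) =
      -(X (F.ψ₁ x) * Y (F.ω₁ x) - X (F.ω₁ x) * Y (F.ψ₁ x)) -
        (X (F.ψ₂ x) * Y (F.ω₂ x) - X (F.ω₂ x) * Y (F.ψ₂ x)) := by
    intro X Y
    have : extD (F.system 0) x = extD F.ω₃ x := rfl
    rw [this, h.d_ω₃, eval₂_sub, eval₂_neg, eval₂_wedge, eval₂_wedge]
  have hB₁ : ∀ X Y : (E →L[ℝ] 𝕜) →L[𝕜] 𝕜, (∀ α ∈ spanAt F.system x, X α = 0) →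
      (∀ α ∈ spanAt F.system x, Y α = 0) → eval₂ X Y (extD (F.system 3) x) =
      (X (F.ψ₁ x) * Y (F.ψ₂ x) - X (F.ψ₂ x) * Y (F.ψ₁ x)) +
        F.k x ^ 2 * (X (F.ω₁ x) * Y (F.ω₂ x) - X (F.ω₂ x) * Y (F.ω₁ x)) := by
    intro X Y hX hY
    have : extD (F.system 3) x = extD F.θ₃ x := rfl
    obtain ⟨-, e₁, e₂, -⟩ := hann' X hX
    obtain ⟨-, f₁, f₂, -⟩ := hann' Y hY
    rw [this, h.d_θ₃, h.d_ω₁₂, h.d_η₁₂, eval₂_sub, eval₂_smul, eval₂_wedge, eval₂_wedge, e₁, e₂,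
      f₁, f₂]
    ring
  obtain ⟨S₁, v1, v2, v3, v4, v5, v6, v7, v8, v9⟩ := h.exists_vector hη 0 0 0 0 1 0 0 0
  obtain ⟨S₂, w1, w2, w3, w4, w5, w6, w7, w8, w9⟩ := h.exists_vector hη 0 0 0 0 0 1 0 0
  obtain ⟨U₁, p1, p2, p3, p4, p5, p6, p7, p8, p9⟩ := h.exists_vector hη 0 0 0 0 0 (F.k x) 1 0
  obtain ⟨U₂, q1, q2, q3, q4, q5, q6, q7, q8, q9⟩ := h.exists_vector hη 0 0 0 0 (-F.k x) 0 0 1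
  have aS₁ := hann S₁ v3 (by simp [θ₁, v1, v7]) (by simp [θ₂, v2, v8]) (by simp [θ₃, v4, v9])
  have aS₂ := hann S₂ w3 (by simp [θ₁, w1, w7]) (by simp [θ₂, w2, w8]) (by simp [θ₃, w4, w9])
  have aU₁ := hann U₁ p3 (by simp [θ₁, p1, p7]) (by simp [θ₂, p2, p8]) (by simp [θ₃, p4, p9])
  have aU₂ := hann U₂ q3 (by simp [θ₁, q1, q7]) (by simp [θ₂, q2, q8]) (by simp [θ₃, q4, q9])
  have E₁₂ := hd₀ S₁ S₂ aS₁ aS₂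
  have G₁₂ := hd₁ S₁ S₂ aS₁ aS₂
  have E₁₁ := hd₀ S₁ U₁ aS₁ aU₁
  have G₁₁ := hd₁ S₁ U₁ aS₁ aU₁
  rw [hB₀] at E₁₂ E₁₁
  rw [hB₁ _ _ aS₁ aS₂] at G₁₂
  rw [hB₁ _ _ aS₁ aU₁] at G₁₁
  simp only [v1, v2, v5, v6, w1, w2, w5, w6, p1, p2, p5, p6] at E₁₂ G₁₂ E₁₁ G₁₁
  -- On the annihilator, `dω₃` and `dθ₃` are independent combinations of `σ₀ ∧ σ₁` and `τ₀ ∧ τ₁`, as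
  -- their values on `(S₁, S₂)` and `(S₁, U₁)` show; so the coefficient matrix is invertible.
  have hΔ : x₀ * y₁ - x₁ * y₀ ≠ 0 := by
    intro hΔ
    have hy₀ : y₀ = 0 := by linear_combination y₀ * G₁₂ - y₁ * E₁₂ -
      (S₁ (σ 0) * S₂ (σ 1) - S₁ (σ 1) * S₂ (σ 0)) * hΔ
    have hy₁ : y₁ = 0 := by linear_combination -y₁ * E₁₁ + y₀ * G₁₁ -
      (S₁ (σ 0) * U₁ (σ 1) - S₁ (σ 1) * U₁ (σ 0)) * hΔ
    subst hy₀ hy₁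
    have hx₀ : x₀ = 0 := by linear_combination x₀ * G₁₂ - x₁ * E₁₂
    subst hx₀
    exact one_ne_zero (α := 𝕜) (by linear_combination -E₁₁)
  obtain ⟨e, he⟩ : ∃ e, y₁ = e * (x₀ * y₁ - x₁ * y₀) := ⟨_, (div_mul_cancel₀ _ hΔ).symm⟩
  obtain ⟨f, hf⟩ : ∃ f, -y₀ = f * (x₀ * y₁ - x₁ * y₀) :=
    ⟨_, (div_mul_cancel₀ _ hΔ).symm⟩
  -- Inverting that matrix: `σ₀ ∧ σ₁ ≡ e dω₃ + f dθ₃`.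
  have hσσ : ∀ X Y : (E →L[ℝ] 𝕜) →L[𝕜] 𝕜, (∀ α ∈ spanAt F.system x, X α = 0) →
      (∀ α ∈ spanAt F.system x, Y α = 0) → X (σ 0) * Y (σ 1) - X (σ 1) * Y (σ 0) =
      e * (-(X (F.ψ₁ x) * Y (F.ω₁ x) - X (F.ω₁ x) * Y (F.ψ₁ x)) -
        (X (F.ψ₂ x) * Y (F.ω₂ x) - X (F.ω₂ x) * Y (F.ψ₂ x))) +
      f * ((X (F.ψ₁ x) * Y (F.ψ₂ x) - X (F.ψ₂ x) * Y (F.ψ₁ x)) +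
        F.k x ^ 2 * (X (F.ω₁ x) * Y (F.ω₂ x) - X (F.ω₂ x) * Y (F.ω₁ x))) := by
    intro X Y hX hY
    rw [← hB₀, ← hB₁ X Y hX hY]
    refine mul_left_cancel₀ hΔ ?_
    have e₀ := hd₀ X Y hX hY
    have e₁ := hd₁ X Y hX hY
    linear_combination eval₂ X Y (extD (F.system 0) x) * he +
      eval₂ X Y (extD (F.system 3) x) * hf - y₁ * e₀ + y₀ * e₁
  have H12 := hσσ S₁ S₂ aS₁ aS₂
  have H13 := hσσ S₁ U₁ aS₁ aU₁
  have H14 := hσσ S₁ U₂ aS₁ aU₂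
  have H23 := hσσ S₂ U₁ aS₂ aU₁
  have H24 := hσσ S₂ U₂ aS₂ aU₂
  have H34 := hσσ U₁ U₂ aU₁ aU₂
  simp only [v1, v2, v5, v6, w1, w2, w5, w6, p1, p2, p5, p6, q1, q2, q5, q6] at H12 H13 H14 H23
  simp only [w1, w2, w5, w6, p1, p2, p5, p6, q1, q2, q5, q6] at H24 H34
  -- The Plücker relation for the decomposable form `σ₀ ∧ σ₁`, on the basis `S₁, S₂, U₁, U₂`.
  have hpl : e ^ 2 = (f * F.k x) ^ 2 := by
    have hP : ∀ a₁ a₂ b₁ b₂ c₁ c₂ d₁ d₂ : 𝕜, (a₁ * b₂ - a₂ * b₁) * (c₁ * d₂ - c₂ * d₁) -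
        (a₁ * c₂ - a₂ * c₁) * (b₁ * d₂ - b₂ * d₁) +
        (a₁ * d₂ - a₂ * d₁) * (b₁ * c₂ - b₂ * c₁) = 0 := by
      intros; ring
    have := hP (S₁ (σ 0)) (S₁ (σ 1)) (S₂ (σ 0)) (S₂ (σ 1)) (U₁ (σ 0)) (U₁ (σ 1)) (U₂ (σ 0))
      (U₂ (σ 1))
    rw [H12, H13, H14, H23, H24, H34] at this
    linear_combination -this
  have hf0 : f ≠ 0 := by
    rintro rfl
    have he0 : e = 0 := by
      refine pow_eq_zero_iff (two_ne_zero) |>.1 (?_ : e ^ 2 = 0)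
      rw [hpl]; ring
    obtain ⟨X, Y, hX, hY, hXY⟩ := hσ
    apply hXY
    rw [hσσ X Y hX hY, he0]; ring
  have hc : ∀ r s : 𝕜, r • σ 0 + s • σ 1 ∈ Submodule.span 𝕜 (Set.range σ) := fun r s =>
    add_mem (Submodule.smul_mem _ _ (Submodule.subset_span (Set.mem_range_self 0)))
      (Submodule.smul_mem _ _ (Submodule.subset_span (Set.mem_range_self 1)))
  have hmem : ∀ {r s : 𝕜} {ζ : E →L[ℝ] 𝕜},
      (∀ X : (E →L[ℝ] 𝕜) →L[𝕜] 𝕜, (∀ α ∈ spanAt F.system x, X α = 0) →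
        f * X ζ = r * X (σ 0) + s * X (σ 1)) →
      ζ ∈ spanAt F.system x ⊔ Submodule.span 𝕜 (Set.range σ) := by
    intro r s ζ hζ
    have : ζ = (ζ - ((r / f) • σ 0 + (s / f) • σ 1)) + ((r / f) • σ 0 + (s / f) • σ 1) := by abel
    rw [this]
    refine Submodule.add_mem_sup (h.mem_span_system hdim fun X hX => ?_) (hc _ _)
    rw [map_sub, map_add, apply_smul, apply_smul]
    refine mul_left_cancel₀ hf0 ?_
    have := hζ X hX
    field_simp
    linear_combination this
  -- Contracting `σ₀ ∧ σ₁` with `S₁` and `S₂` gives combinations of `σ₀, σ₁`; for `e = -fk` they are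
  -- `f s₂` and `-f s₁`, for `e = fk` the same with `-k` in place of `k`.
  have K₁ : ∀ X : (E →L[ℝ] 𝕜) →L[𝕜] 𝕜, (∀ α ∈ spanAt F.system x, X α = 0) →
      S₁ (σ 0) * X (σ 1) - S₁ (σ 1) * X (σ 0) = f * X (F.ψ₂ x) - e * X (F.ω₁ x) := by
    intro X hX
    rw [hσσ S₁ X aS₁ hX, v1, v2, v5, v6]
    ring
  have K₂ : ∀ X : (E →L[ℝ] 𝕜) →L[𝕜] 𝕜, (∀ α ∈ spanAt F.system x, X α = 0) →
      S₂ (σ 0) * X (σ 1) - S₂ (σ 1) * X (σ 0) = -f * X (F.ψ₁ x) - e * X (F.ω₂ x) := by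
    intro X hX
    rw [hσσ S₂ X aS₂ hX, w1, w2, w5, w6]
    ring
  rcases sq_eq_sq_iff_eq_or_eq_neg.1 hpl with he' | he'
  · right
    refine F.neg.span_frame₀_le le_sup_left (hmem (r := S₂ (σ 1)) (s := -S₂ (σ 0)) ?_)
      (hmem (r := -S₁ (σ 1)) (s := S₁ (σ 0)) ?_)
    · intro X hX
      have e₁ : X (F.neg.s₁ x) = X (F.ψ₁ x) + F.k x * X (F.ω₂ x) := by
        simp [s₁, EmbeddingCoframe.neg]
      rw [e₁]
      linear_combination K₂ X hX - X (F.ω₂ x) * he'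
    · intro X hX
      have e₁ : X (F.neg.s₂ x) = X (F.ψ₂ x) - F.k x * X (F.ω₁ x) := by
        simp [s₂, EmbeddingCoframe.neg, sub_eq_add_neg]
      rw [e₁]
      linear_combination -K₁ X hX + X (F.ω₁ x) * he'
  · left
    refine F.span_frame₀_le le_sup_left (hmem (r := S₂ (σ 1)) (s := -S₂ (σ 0)) ?_)
      (hmem (r := -S₁ (σ 1)) (s := S₁ (σ 0)) ?_)
    · intro X hX
      have e₁ : X (F.s₁ x) = X (F.ψ₁ x) - F.k x * X (F.ω₂ x) := by
        simp [s₁]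
      rw [e₁]
      linear_combination K₂ X hX - X (F.ω₂ x) * he'
    · intro X hX
      have e₁ : X (F.s₂ x) = X (F.ψ₂ x) + F.k x * X (F.ω₁ x) := by
        simp [s₂]
      rw [e₁]
      linear_combination -K₁ X hX + X (F.ω₁ x) * he'

end EmbeddingCoframe
end Decomposition

section Decomposition

variable {𝕜 : Type*} [RCLike 𝕜] {E : Type*} [NormedAddCommGroup E] [NormedSpace ℝ E]

theorem IsDecomposition.linearIndependent_sum {n r p q s t : ℕ} {ϑ : Fin n → E → E →L[ℝ] 𝕜} {x : E}
    {θ : Fin r → E → E →L[ℝ] 𝕜} {σ : Fin p → E → E →L[ℝ] 𝕜} {τ : Fin q → E → E →L[ℝ] 𝕜}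
    {Φ : Fin s → E → E →L[ℝ] E →L[ℝ] 𝕜} {Ψ : Fin t → E → E →L[ℝ] E →L[ℝ] 𝕜}
    (h : IsDecomposition ϑ x θ σ τ Φ Ψ) : ∀ᶠ y in 𝓝 x, LinearIndependent 𝕜
      (Sum.elim (fun i => θ i y) (fun i => σ i y)) := by
  filter_upwards [h.linearIndependent] with y hy
  have := hy.comp (Sum.map id Sum.inl) (Function.injective_id.sumMap Sum.inl_injective)
  convert this using 1
  ext i
  rcases i with i | i <;> rfl

namespace EmbeddingCoframe

variable [FiniteDimensional ℝ E] {F : EmbeddingCoframe 𝕜 E} {x : E}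

theorem IsAdaptedAt.linearIndependent_system (h : F.IsAdaptedAt x) :
    LinearIndependent 𝕜 (fun i => F.system i x) := by
  have := h.linearIndependent_frame₀.comp (Fin.castLE (by norm_num : 4 ≤ 6))
    (Fin.castLE_injective _)
  convert this using 1
  ext i
  fin_cases i <;> rfl

/-- The forms `s₁` for `k` and `-k` differ by a multiple `2k` of `ω₂`, which is independent of
`frame₀`; this keeps the two candidate systems apart. -/
theorem IsAdaptedAt.s₁_neg_notMem (h : F.IsAdaptedAt x) : F.neg.s₁ x ∉ spanAt F.frame₀ x := by
  obtain ⟨h₁, h₂, hη⟩ := h.conn_mem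
  obtain ⟨U, q1, q2, q3, q4, q5, q6, q7, q8, q9⟩ := h.exists_vector hη 0 0 0 0 0 0 0 1
  intro hmem
  obtain ⟨c, hc⟩ := (Submodule.mem_span_range_iff_exists_fun 𝕜).1 hmem
  have := congrArg U hc
  simp [frame₀, θ₁, θ₂, θ₃, s₁, s₂, EmbeddingCoframe.neg, Fin.sum_univ_six, q1, q2, q3, q4, q5, q6,
    q7, q8, q9, map_add, map_sub] at this
  have h2 : 2 * F.k x = 0 := by linear_combination -this
  exact mul_ne_zero two_ne_zero h.k_ne h2

omit [FiniteDimensional ℝ E] in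
theorem spanAt_sup_le {r p : ℕ} {θ : Fin r → E → E →L[ℝ] 𝕜} {σ : Fin p → E → E →L[ℝ] 𝕜} {y : E} :
    spanAt θ y ⊔ spanAt σ y =
      Submodule.span 𝕜 (Set.range (Sum.elim (fun i => θ i y) (fun i => σ i y))) := by
  rw [Set.Sum.elim_range, Submodule.span_union]; rfl

/-- The singular system of a decomposition of the isometric embedding system is locally one of the
two systems determined by the square roots of minus the Gauss curvature. -/
theorem exists_eventually_le {s t r p q : ℕ} {θ : Fin r → E → E →L[ℝ] 𝕜}
    {σ : Fin p → E → E →L[ℝ] 𝕜} {τ : Fin q → E → E →L[ℝ] 𝕜}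
    {Φ : Fin s → E → E →L[ℝ] E →L[ℝ] 𝕜} {Ψ : Fin t → E → E →L[ℝ] E →L[ℝ] 𝕜}
    (h : ∀ᶠ y in 𝓝 x, F.IsAdaptedAt y) (hdim : Module.finrank 𝕜 (E →L[ℝ] 𝕜) = 8)
    (hD : IsDecomposition F.system x θ σ τ Φ Ψ) :
    r = 4 ∧ q = 2 ∧ ((∀ᶠ y in 𝓝 x, spanAt θ y ⊔ spanAt σ y ≤ spanAt F.frame₀ y) ∨
      (∀ᶠ y in 𝓝 x, spanAt θ y ⊔ spanAt σ y ≤ spanAt F.neg.frame₀ y)) := by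
  have hli := hD.linearIndependent.self_of_nhds
  have hr : r = 4 := by
    have h₁ : LinearIndependent 𝕜 (fun i => θ i x) := hli.comp Sum.inl Sum.inl_injective
    have h₂ := h.self_of_nhds.linearIndependent_system
    have h₃ := finrank_span_eq_card h₁
    have h₄ := finrank_span_eq_card h₂
    have h₅ : Submodule.span 𝕜 (Set.range fun i => θ i x) =
      Submodule.span 𝕜 (Set.range fun i => F.system i x) := hD.degree_one.self_of_nhds
    rw [h₅, h₄] at h₃
    simpa using h₃.symm
  have hpq : r + (p + q) = 8 := by
    have htop := hD.span_eq_top.self_of_nhds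
    have h₁ := finrank_span_eq_card hli
    have h₂ : Submodule.span 𝕜 (Set.range (Sum.elim (fun i => θ i x)
        (Sum.elim (fun i => σ i x) (fun i => τ i x)))) = ⊤ := by
      rw [Set.Sum.elim_range, Set.Sum.elim_range, Submodule.span_union, Submodule.span_union,
        ← sup_assoc]
      exact htop
    rw [h₂, finrank_top, hdim] at h₁
    simpa using h₁.symm
  -- With `r = 4` and total dimension 8, the bounds `p, q ≥ 2` are equalities.
  obtain rfl : p = 2 := by have := hD.two_le_p; have := hD.two_le_q; omega
  obtain rfl : q = 2 := by omega
  refine ⟨hr, rfl, ?_⟩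
  subst hr
  have hle : ∀ᶠ y in 𝓝 x, spanAt F.frame₀ y ≤ spanAt θ y ⊔ spanAt σ y ∨
      spanAt F.neg.frame₀ y ≤ spanAt θ y ⊔ spanAt σ y := by
    filter_upwards [h, hD.linearIndependent, hD.degree_one, hD.degree_two,
      Filter.eventually_all.2 hD.Φ_mem, Filter.eventually_all.2 hD.Ψ_mem]
      with y hy hly h₁ h₂ hΦ hΨ
    rw [h₁]
    refine hy.span_frame₀_le_or (σ := fun i => σ i y) (τ := fun i => τ i y) hdim ?_ fun i => ?_
    · obtain ⟨X, hX⟩ := exists_dual_of_linearIndependent hly (Sum.elim 0 (Sum.elim ![1, 0] 0))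
      obtain ⟨Y, hY⟩ := exists_dual_of_linearIndependent hly (Sum.elim 0 (Sum.elim ![0, 1] 0))
      have hann : ∀ Z : (E →L[ℝ] 𝕜) →L[𝕜] 𝕜, (∀ i, Z (θ i y) = 0) →
          ∀ α ∈ spanAt F.system y, Z α = 0 := by
        intro Z hZ α hα
        rw [← h₁] at hα
        obtain ⟨c, rfl⟩ := (Submodule.mem_span_range_iff_exists_fun 𝕜).1 hα
        simp [hZ]
      refine ⟨X, Y, hann X fun i => by simpa using hX (Sum.inl i),
        hann Y fun i => by simpa using hY (Sum.inl i), ?_⟩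
      have x₀ : X (σ 0 y) = 1 := hX (Sum.inr (Sum.inl 0))
      have x₁ : X (σ 1 y) = 0 := hX (Sum.inr (Sum.inl 1))
      have y₀ : Y (σ 0 y) = 0 := hY (Sum.inr (Sum.inl 0))
      have y₁ : Y (σ 1 y) = 1 := hY (Sum.inr (Sum.inl 1))
      simp [x₀, x₁, y₀, y₁]
    · refine eval₂_of_mem_ideal₂_sup (Φ := fun i => Φ i y) (Ψ := fun i => Ψ i y) hΦ hΨ ?_
      have : extD (F.system i) y ∈ pfaffian₂ F.system y :=
        Submodule.mem_sup_right (Submodule.subset_span (Set.mem_range_self i))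
      rw [← h₂, h₁] at this
      exact this
  have heq : ∀ᶠ y in 𝓝 x, spanAt θ y ⊔ spanAt σ y = spanAt F.frame₀ y ∨
      spanAt θ y ⊔ spanAt σ y = spanAt F.neg.frame₀ y := by
    filter_upwards [h, hle, hD.linearIndependent_sum] with y hy hy' hy''
    have hfin : ∀ {G : EmbeddingCoframe 𝕜 E}, G.IsAdaptedAt y →
        Module.finrank 𝕜 ↥(spanAt θ y ⊔ spanAt σ y) ≤ Module.finrank 𝕜 (spanAt G.frame₀ y) := by
      intro G hG
      have e₁ := finrank_span_eq_card hG.linearIndependent_frame₀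
      have e₂ := finrank_span_eq_card hy''
      rw [spanAt_sup_le, e₂]
      refine le_of_eq (Eq.trans ?_ e₁.symm)
      simp
    rcases hy' with hy' | hy'
    · exact Or.inl (Submodule.eq_of_le_of_finrank_le hy' (hfin hy)).symm
    · exact Or.inr (Submodule.eq_of_le_of_finrank_le hy' (hfin hy.neg)).symm
  -- The sign of `k` could a priori vary from point to point. Linear independence is an open
  -- condition, so the sign excluded at `x` stays excluded nearby.
  have hopen : ∀ {G : EmbeddingCoframe 𝕜 E}, G.IsAdaptedAt x →
      spanAt θ x ⊔ spanAt σ x = spanAt G.frame₀ x →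
      ∀ᶠ y in 𝓝 x, G.neg.s₁ y ∉ spanAt θ y ⊔ spanAt σ y := by
    intro G hG hx
    let f : E → Option (Fin 4 ⊕ Fin 2) → E →L[ℝ] 𝕜 := fun y o =>
      Option.casesOn' o (G.neg.s₁ y) (Sum.elim (fun i => θ i y) (fun i => σ i y))
    have hf : LinearIndependent 𝕜 (f x) := by
      refine linearIndependent_option'.2 ⟨hD.linearIndependent_sum.self_of_nhds, ?_⟩
      rw [← spanAt_sup_le, hx]
      exact hG.s₁_neg_notMem
    have hcont : ContinuousAt f x := by
      refine continuousAt_pi.2 fun o => ?_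
      rcases o with _ | i | i
      · exact hG.neg.diff_s₁.continuousAt
      · exact (hD.smooth_θ i).self_of_nhds.continuousAt
      · exact (hD.smooth_σ i).self_of_nhds.continuousAt
    filter_upwards [hcont.eventually hf.eventually] with y hy
    rw [spanAt_sup_le]
    exact (linearIndependent_option'.1 hy).2
  have hs : ∀ (G : EmbeddingCoframe 𝕜 E) (y : E), G.s₁ y ∈ spanAt G.frame₀ y := fun G y =>
    Submodule.subset_span (Set.mem_range_self (4 : Fin 6))
  have hnn : ∀ y, F.neg.neg.s₁ y = F.s₁ y := by
    intro y; simp [s₁, EmbeddingCoframe.neg]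
  rcases heq.self_of_nhds with hx | hx
  · left
    filter_upwards [heq, hopen h.self_of_nhds hx] with y hy hy'
    rcases hy with hy | hy
    · exact hy.le
    · exact absurd (hy ▸ hs F.neg y) hy'
  · right
    filter_upwards [heq, hopen h.self_of_nhds.neg hx] with y hy hy'
    rcases hy with hy | hy
    · rw [hnn] at hy'
      exact absurd (hy ▸ hs F y) hy'
    · exact hy.le

/-- The second order equation satisfied by the Gauss curvature of a metric whose isometric
embedding system is Darboux integrable. -/
theorem second_order_of_isDarbouxIntegrableAt
    (h : ∀ᶠ y in 𝓝 x, F.IsAdaptedAt y) (hdim : Module.finrank 𝕜 (E →L[ℝ] 𝕜) = 8)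
    (hD : IsDarbouxIntegrableAt F.system x) :
    F.k x * F.a x = -(F.k x ^ 2 + F.p x ^ 2) ∧ F.k x * F.b x = -(F.p x * F.q x) ∧
      F.k x * F.c x = -(F.k x ^ 2 + F.q x ^ 2) := by
  obtain ⟨r, p, q, s, t, θ, σ, τ, Φ, Ψ, hdec, -, -, hpair⟩ := hD
  obtain ⟨rfl, rfl, hV⟩ := exists_eventually_le h hdim hdec
  have hfin : 2 ≤ Module.finrank 𝕜 (derivedLimit (fun z => spanAt θ z ⊔ spanAt σ z) x) := by
    -- The span of `θ, τ` has rank at most `4 + 2`, so the derived limit must supply at least two of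
    -- the eight dimensions.
    have h₁ := hpair.self_of_nhds.sup_right
    have h₂ := Submodule.finrank_add_le_finrank_add_finrank (spanAt θ x ⊔ spanAt τ x)
      (derivedLimit (fun z => spanAt θ z ⊔ spanAt σ z) x)
    rw [h₁, finrank_top, hdim] at h₂
    have h₃ := Submodule.finrank_add_le_finrank_add_finrank (spanAt θ x) (spanAt τ x)
    have h₄ : Module.finrank 𝕜 (spanAt θ x) ≤ 4 :=
      (finrank_range_le_card (R := 𝕜) (fun i => θ i x)).trans (by simp)
    have h₅ : Module.finrank 𝕜 (spanAt τ x) ≤ 2 :=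
      (finrank_range_le_card (R := 𝕜) (fun i => τ i x)).trans (by simp)
    omega
  rcases hV with hV | hV
  · exact second_order_of_derivedLimit h hV hfin
  · obtain ⟨e₁, e₂, e₃⟩ := second_order_of_derivedLimit (h.mono fun y hy => hy.neg) hV hfin
    simp only [EmbeddingCoframe.neg, neg_mul_neg, neg_sq] at e₁ e₂ e₃
    exact ⟨e₁, e₂, e₃⟩

end EmbeddingCoframe
end Decomposition

theorem two_le_infty : (2 : WithTop ℕ∞) ≤ ∞ :=
  WithTop.coe_le_coe.2 (le_top : (2 : ℕ∞) ≤ ⊤)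

theorem one_add_one_le_infty : (1 : WithTop ℕ∞) + 1 ≤ ∞ :=
  one_add_one_eq_two.trans_le two_le_infty

/-! ### Pullbacks to the product and the structure equations of Euclidean frames. -/

section RealPullback

variable (𝕜 : Type*) [RCLike 𝕜] {E E' : Type*} [NormedAddCommGroup E] [NormedSpace ℝ E]
  [NormedAddCommGroup E'] [NormedSpace ℝ E']

/-- The pullback of a real `1`-form along a linear map, as a form with coefficients in `𝕜`. -/
def realPullback (A : E →L[ℝ] E') (ζ : E' → E' →L[ℝ] ℝ) (z : E) : E →L[ℝ] 𝕜 :=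
  RCLike.ofRealCLM.comp ((ζ (A z)).comp A)

@[simp]
theorem realPullback_apply (A : E →L[ℝ] E') (ζ : E' → E' →L[ℝ] ℝ) (z v : E) :
    realPullback 𝕜 A ζ z v = (ζ (A z) (A v) : 𝕜) := by
  simp [realPullback]

theorem hasFDerivAt_realPullback {A : E →L[ℝ] E'} {ζ : E' → E' →L[ℝ] ℝ} {z : E}
    (h : DifferentiableAt ℝ ζ (A z)) :
    HasFDerivAt (realPullback 𝕜 A ζ)
      ((ContinuousLinearMap.compL ℝ E ℝ 𝕜 RCLike.ofRealCLM).comp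
        (((ContinuousLinearMap.compL ℝ E E' ℝ).flip A).comp ((fderiv ℝ ζ (A z)).comp A))) z :=
  ((ContinuousLinearMap.compL ℝ E ℝ 𝕜 RCLike.ofRealCLM).hasFDerivAt).comp z
    ((((ContinuousLinearMap.compL ℝ E E' ℝ).flip A).hasFDerivAt).comp z
      (h.hasFDerivAt.comp z A.hasFDerivAt))

theorem extD_realPullback {A : E →L[ℝ] E'} {ζ : E' → E' →L[ℝ] ℝ} {z : E}
    (h : DifferentiableAt ℝ ζ (A z)) (v w : E) :
    extD (realPullback 𝕜 A ζ) z v w = (extD ζ (A z) (A v) (A w) : 𝕜) := by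
  simp [extD_apply, (hasFDerivAt_realPullback 𝕜 h).fderiv]

theorem finrank_covector [FiniteDimensional ℝ E] :
    Module.finrank 𝕜 (E →L[ℝ] 𝕜) = Module.finrank ℝ E := by
  let e : (E →L[ℝ] 𝕜) ≃ₗ[𝕜] (E →ₗ[ℝ] 𝕜) :=
    { toFun := fun f => f
      invFun := fun f => LinearMap.toContinuousLinearMap f
      left_inv := fun f => by ext; rfl
      right_inv := fun f => by ext; rfl
      map_add' := fun f g => rfl
      map_smul' := fun c f => rfl }
  rw [e.finrank_eq, Module.finrank_linearMap ℝ 𝕜 E 𝕜]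
  simp

/-- `n` real covectors without common zero in dimension `n` have a dual basis of real vectors, and
evaluation at these still separates them over `𝕜`. -/
theorem linearIndependent_of_forall_eq_zero [FiniteDimensional ℝ E] {n : ℕ}
    {w : Fin n → E →L[ℝ] ℝ} (hn : Module.finrank ℝ E = n)
    (h : ∀ v, (∀ i, w i v = 0) → v = 0) :
    LinearIndependent 𝕜 (fun i => (RCLike.ofRealCLM.comp (w i) : E →L[ℝ] 𝕜)) := by
  classical
  let A : E →ₗ[ℝ] (Fin n → ℝ) := LinearMap.pi fun i => (w i : E →ₗ[ℝ] ℝ)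
  have hinj : Function.Injective A := by
    rw [← LinearMap.ker_eq_bot, LinearMap.ker_eq_bot']
    exact fun v hv => h v fun i => congrFun hv i
  have hsurj : Function.Surjective A :=
    (LinearMap.injective_iff_surjective_of_finrank_eq_finrank (by simp [hn])).1 hinj
  choose u hu using fun i : Fin n => hsurj (Pi.single i 1)
  refine linearIndependent_of_dual (𝕜 := 𝕜) (V := E →L[ℝ] 𝕜)
    (X := fun i =>
      { toFun := fun f => f (u i)
        map_add' := fun f g => rfl
        map_smul' := fun c f => rfl }) fun i j => ?_
  have : w j (u i) = if i = j then 1 else 0 := by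
    have := congrFun (hu i) j
    simpa [A, Pi.single_apply, eq_comm] using this
  simp [this]

end RealPullback

namespace FrameCoordinates

/-- The terms with the second derivative of `Z` cancel by symmetry. Expanding the remaining inner
products in the frame yields the structure equations. -/
theorem extD_inner_fderiv {X Z : E6 → E3} {y : E6} (hX : ContDiffAt ℝ ∞ X y)
    (hZ : ContDiffAt ℝ ∞ Z y) (v w : E6) :
    extD (fun y => (innerSL ℝ (X y)).comp (fderiv ℝ Z y)) y v w =
      inner ℝ (fderiv ℝ X y v) (fderiv ℝ Z y w) - inner ℝ (fderiv ℝ X y w) (fderiv ℝ Z y v) := by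
  have h₁ : DifferentiableAt ℝ X y := hX.differentiableAt (by simp)
  have h₂ : DifferentiableAt ℝ (fderiv ℝ Z) y :=
    (hZ.fderiv_right (m := 1) one_add_one_le_infty).differentiableAt (by simp)
  have hs : IsSymmSndFDerivAt ℝ Z y := hZ.isSymmSndFDerivAt (by simpa using two_le_infty)
  have h₃ : HasFDerivAt (fun y => innerSL ℝ (X y)) ((innerSL ℝ).comp (fderiv ℝ X y)) y :=
    (innerSL ℝ (E := E3)).hasFDerivAt.comp y h₁.hasFDerivAt
  have h₄ := h₃.clm_comp h₂.hasFDerivAt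
  rw [extD_apply, h₄.fderiv]
  simp [hs.eq v w]

variable {Y : FrameCoordinates} {y : E6} (hy : y ∈ Y.domain)
include hy

theorem contDiffAt_ρ : ContDiffAt ℝ ∞ Y.ρ y := Y.smooth_ρ.contDiffAt (Y.isOpen_domain.mem_nhds hy)

theorem contDiffAt_e (a : Fin 3) : ContDiffAt ℝ ∞ (Y.e a) y :=
  (Y.smooth_e a).contDiffAt (Y.isOpen_domain.mem_nhds hy)

theorem differentiableAt_coform (a : Fin 3) : DifferentiableAt ℝ (Y.coform a) y := by
  have h₁ := (contDiffAt_e hy a).differentiableAt (by simp)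
  have h₂ : DifferentiableAt ℝ (fderiv ℝ Y.ρ) y :=
    ((contDiffAt_ρ hy).fderiv_right (m := 1) one_add_one_le_infty).differentiableAt (by simp)
  exact ((innerSL ℝ (E := E3)).differentiableAt.comp y h₁).clm_comp h₂

theorem differentiableAt_conn (a b : Fin 3) : DifferentiableAt ℝ (Y.conn a b) y := by
  have h₁ := (contDiffAt_e hy a).differentiableAt (by simp)
  have h₂ : DifferentiableAt ℝ (fderiv ℝ (Y.e b)) y :=
    ((contDiffAt_e hy b).fderiv_right (m := 1) one_add_one_le_infty).differentiableAt (by simp)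
  exact ((innerSL ℝ (E := E3)).differentiableAt.comp y h₁).clm_comp h₂

/-- The frame at a point, as an orthonormal basis. -/
def basis : OrthonormalBasis (Fin 3) ℝ E3 :=
  OrthonormalBasis.mk (Y.orthonormal y hy) (by
    have := (Y.orthonormal y hy).linearIndependent.span_eq_top_of_card_eq_finrank' (by simp)
    rw [this])

theorem inner_eq_sum (u w : E3) :
    inner ℝ u w = ∑ b, inner ℝ (Y.e b y) u * inner ℝ (Y.e b y) w := by
  rw [← (basis hy).sum_inner_mul_inner u w]
  simp [basis, real_inner_comm]

theorem conn_antisymm (a b : Fin 3) : Y.conn b a y = -Y.conn a b y := by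
  have h₁ := ((contDiffAt_e hy a).differentiableAt (by simp)).hasFDerivAt
  have h₂ := ((contDiffAt_e hy b).differentiableAt (by simp)).hasFDerivAt
  have h₃ := h₁.inner ℝ h₂
  have h₄ : (fun y => inner ℝ (Y.e a y) (Y.e b y)) =ᶠ[𝓝 y]
      fun _ => if a = b then (1 : ℝ) else 0 := by
    filter_upwards [Y.isOpen_domain.mem_nhds hy] with z hz
    exact orthonormal_iff_ite.1 (Y.orthonormal z hz) a b
  have h₅ := (h₄.hasFDerivAt_iff.1 h₃).unique (hasFDerivAt_const _ _)
  ext v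
  have := DFunLike.congr_fun h₅ v
  simp [real_inner_comm] at this
  simp [conn]
  linarith

theorem conn_self (a : Fin 3) : Y.conn a a y = 0 := by
  have := conn_antisymm hy a a
  ext v
  have := DFunLike.congr_fun this v
  simp at this ⊢
  linarith

theorem extD_coform (a : Fin 3) :
    extD (Y.coform a) y = ∑ b, wedge (Y.conn b a y) (Y.coform b y) := by
  ext v w
  have := extD_inner_fderiv (contDiffAt_e hy a) (contDiffAt_ρ hy) v w
  rw [inner_eq_sum hy, inner_eq_sum hy, ← Finset.sum_sub_distrib] at this
  rw [show Y.coform a = fun y => (innerSL ℝ (Y.e a y)).comp (fderiv ℝ Y.ρ y) from rfl, this]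
  simp [wedge_apply, coform, conn]

theorem extD_conn (a c : Fin 3) :
    extD (Y.conn a c) y = ∑ b, wedge (Y.conn b a y) (Y.conn b c y) := by
  ext v w
  have := extD_inner_fderiv (contDiffAt_e hy a) (contDiffAt_e hy c) v w
  rw [inner_eq_sum hy, inner_eq_sum hy, ← Finset.sum_sub_distrib] at this
  rw [show Y.conn a c = fun y => (innerSL ℝ (Y.e a y)).comp (fderiv ℝ (Y.e c) y) from rfl, this]
  simp [wedge_apply, conn]

/-- By antisymmetry of the connection forms, these six forms determine `dρ` and all `de_a`, so the
immersion condition makes them a coframe. -/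
theorem eq_zero_of_forms {v : E6} (h₀ : ∀ a, Y.coform a y v = 0) (h₁ : Y.conn 0 1 y v = 0)
    (h₂ : Y.conn 2 0 y v = 0) (h₃ : Y.conn 2 1 y v = 0) : v = 0 := by
  have key : ∀ w : E3, (∀ b, inner ℝ (Y.e b y) w = 0) → w = 0 := fun w hw => by
    rw [← inner_self_eq_zero (𝕜 := ℝ), inner_eq_sum hy]
    simp [hw]
  have hneg : ∀ a b, Y.conn a b y v = 0 → Y.conn b a y v = 0 := fun a b h => by
    rw [conn_antisymm hy a b]; simp [h]
  refine Y.immersion y hy v (key _ fun b => h₀ b) fun a => key _ fun b => ?_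
  change Y.conn b a y v = 0
  fin_cases a <;> fin_cases b <;> simp only [Fin.zero_eta, Fin.mk_one, Fin.reduceFinMk]
  all_goals first
    | (rw [conn_self hy]; rfl)
    | assumption
    | (apply hneg; assumption)

end FrameCoordinates

/-! ### Smoothness of the metric in coordinates and the calculus of an orthonormal framing. -/

section LocalMetric

variable {M : Type*} [TopologicalSpace M] [ChartedSpace E2 M] [IsManifold 𝓘(ℝ, E2) ∞ M]
  {g : Metric M} {φ : OpenPartialHomeomorph M E2}

theorem localMetric_symm (x a b : E2) : localMetric g φ x a b = localMetric g φ x b a :=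
  g.symm _ _ _

variable (hφ : φ ∈ IsManifold.maximalAtlas 𝓘(ℝ, E2) ∞ M)
include hφ

omit [IsManifold 𝓘(ℝ, E2) ∞ M] in
theorem mdifferentiable_of_mem_maximalAtlas :
    φ.MDifferentiable 𝓘(ℝ, E2) 𝓘(ℝ, E2) :=
  ⟨(contMDiffOn_of_mem_maximalAtlas hφ).mdifferentiableOn (by simp),
    (contMDiffOn_symm_of_mem_maximalAtlas hφ).mdifferentiableOn (by simp)⟩

theorem localMetric_pos {x : E2} (hx : x ∈ φ.target) {a : E2} (ha : a ≠ 0) :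
    0 < localMetric g φ x a a := by
  refine g.pos _ _ fun h => ha ?_
  exact (mdifferentiable_of_mem_maximalAtlas hφ).symm.mfderiv_injective hx
    (h.trans (map_zero _).symm)

theorem contMDiffAt_mfderiv_symm {x : E2} (hx : x ∈ φ.target) (a : E2) :
    ContMDiffAt 𝓘(ℝ, E2) (𝓘(ℝ, E2).prod 𝓘(ℝ, E2)) ∞
      (fun y => Bundle.TotalSpace.mk' E2 (E := fun p : M => TangentSpace 𝓘(ℝ, E2) p)
        (φ.symm y) (mfderiv 𝓘(ℝ, E2) 𝓘(ℝ, E2) φ.symm y a)) x := by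
  have h₁ := (contMDiffOn_symm_of_mem_maximalAtlas hφ).contMDiffOn_tangentMapWithin
    (m := ∞) (by simp) φ.open_target.uniqueMDiffOn
  have h₂ : ContMDiff 𝓘(ℝ, E2) (𝓘(ℝ, E2).prod 𝓘(ℝ, E2)) ∞
      (fun y : E2 => (⟨y, a⟩ : TangentBundle 𝓘(ℝ, E2) E2)) :=
    contMDiff_vectorSpace_iff_contDiff.2 contDiff_const
  have h₃ := h₁.comp h₂.contMDiffOn (s := φ.target) (fun y hy => hy)
  refine (h₃.contMDiffAt (φ.open_target.mem_nhds hx)).congr_of_eventuallyEq ?_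
  filter_upwards [φ.open_target.mem_nhds hx] with y hy
  simp only [tangentMapWithin, Function.comp]
  rw [mfderivWithin_of_isOpen φ.open_target hy]

theorem contDiffOn_localMetric : ContDiffOn ℝ ∞ (localMetric g φ) φ.target := by
  rw [contDiffOn_clm_apply]
  intro a
  rw [contDiffOn_clm_apply]
  intro b x hx
  have hψ : ContMDiffAt 𝓘(ℝ, E2) (𝓘(ℝ, E2).prod 𝓘(ℝ, E2 →L[ℝ] E2 →L[ℝ] ℝ)) ∞
      (fun y => Bundle.TotalSpace.mk' (E2 →L[ℝ] E2 →L[ℝ] ℝ)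
        (E := fun p : M => TangentSpace 𝓘(ℝ, E2) p →L[ℝ] TangentSpace 𝓘(ℝ, E2) p →L[ℝ] ℝ)
        (φ.symm y) (g.inner (φ.symm y))) x :=
    g.contMDiff.contMDiffAt.comp x
      ((contMDiffOn_symm_of_mem_maximalAtlas hφ).contMDiffAt (φ.open_target.mem_nhds hx))
  have : ContMDiffAt 𝓘(ℝ, E2) (𝓘(ℝ, E2).prod 𝓘(ℝ)) ∞
      (fun y => Bundle.TotalSpace.mk' ℝ (E := Bundle.Trivial M ℝ) (φ.symm y)
        (g.inner (φ.symm y) (mfderiv 𝓘(ℝ, E2) 𝓘(ℝ, E2) φ.symm y a)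
          (mfderiv 𝓘(ℝ, E2) 𝓘(ℝ, E2) φ.symm y b))) x :=
    ContMDiffAt.clm_bundle_apply₂ (F₁ := E2) (F₂ := E2) hψ
      (contMDiffAt_mfderiv_symm hφ hx a) (contMDiffAt_mfderiv_symm hφ hx b)
  simp only [Bundle.contMDiffAt_totalSpace] at this
  exact (contMDiffAt_iff_contDiffAt.1 this.2).contDiffWithinAt

end LocalMetric

section FramingCalculus

variable {M : Type*} [TopologicalSpace M] [ChartedSpace E2 M] [IsManifold 𝓘(ℝ, E2) ∞ M]

theorem contDiffAt_extD_apply {E : Type*} [NormedAddCommGroup E] [NormedSpace ℝ E]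
    {ζ : E → E →L[ℝ] ℝ} {v w : E → E} {x : E} (h : ContDiffAt ℝ ∞ ζ x) (hv : ContDiffAt ℝ ∞ v x)
    (hw : ContDiffAt ℝ ∞ w x) : ContDiffAt ℝ ∞ (fun y => extD ζ y (v y) (w y)) x := by
  have h₁ : ContDiffAt ℝ ∞ (fderiv ℝ ζ) x := h.fderiv_right (by simp)
  simp only [extD_apply]
  exact ((h₁.clm_apply hv).clm_apply hw).sub ((h₁.clm_apply hw).clm_apply hv)

theorem extD_fderiv {E : Type*} [NormedAddCommGroup E] [NormedSpace ℝ E]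
    {f : E → ℝ} {x : E} (h : ContDiffAt ℝ ∞ f x) : extD (fderiv ℝ f) x = 0 := by
  have hs : IsSymmSndFDerivAt ℝ f x := h.isSymmSndFDerivAt (by simpa using two_le_infty)
  ext v w
  simp [extD_apply, hs.eq v w]

namespace Framing

variable {g : Metric M} {F : Framing g} {x : E2} (hx : x ∈ F.chart.target)
include hx

theorem contDiffAt_v (i : Fin 2) : ContDiffAt ℝ ∞ (F.v i) x :=
  (F.smooth i).contDiffAt (F.chart.open_target.mem_nhds hx)

theorem contDiffAt_η (i : Fin 2) : ContDiffAt ℝ ∞ (F.η i) x :=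
  ((contDiffOn_localMetric F.chart_mem).contDiffAt (F.chart.open_target.mem_nhds hx)).clm_apply
    (contDiffAt_v hx i)

theorem contDiffAt_conn : ContDiffAt ℝ ∞ F.conn x := by
  have h : ∀ i, ContDiffAt ℝ ∞ (fun y => extD (F.η i) y (F.v 0 y) (F.v 1 y)) x := fun i =>
    contDiffAt_extD_apply (contDiffAt_η hx i) (contDiffAt_v hx 0) (contDiffAt_v hx 1)
  exact ((h 0).neg.smul (contDiffAt_η hx 0)).sub ((h 1).smul (contDiffAt_η hx 1))

theorem contDiffAt_K : ContDiffAt ℝ ∞ F.K x :=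
  contDiffAt_extD_apply (contDiffAt_conn hx) (contDiffAt_v hx 0) (contDiffAt_v hx 1)

theorem η_v (i j : Fin 2) : F.η i x (F.v j x) = if i = j then 1 else 0 :=
  F.orthonormal x hx i j

theorem eq_sum_v (a : E2) : a = F.η 0 x a • F.v 0 x + F.η 1 x a • F.v 1 x := by
  have hli : LinearIndependent ℝ (fun i => F.v i x) :=
    linearIndependent_of_dual (X := fun i => (F.η i x : E2 →ₗ[ℝ] ℝ)) fun i j => η_v hx i j
  have hspan := hli.span_eq_top_of_card_eq_finrank' (by simp)
  obtain ⟨c, hc⟩ := (Submodule.mem_span_range_iff_exists_fun ℝ).1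
    (hspan.symm ▸ Submodule.mem_top : a ∈ Submodule.span ℝ (Set.range fun i => F.v i x))
  rw [← hc]
  simp [Fin.sum_univ_two, η_v hx]

theorem localMetric_eq (a b : E2) :
    localMetric g F.chart x a b = F.η 0 x a * F.η 0 x b + F.η 1 x a * F.η 1 x b := by
  conv_lhs => rw [eq_sum_v hx a]
  simp [η]

theorem clm_eq {G : Type*} [NormedAddCommGroup G] [NormedSpace ℝ G] (ξ : E2 →L[ℝ] G) (a : E2) :
    ξ a = F.η 0 x a • ξ (F.v 0 x) + F.η 1 x a • ξ (F.v 1 x) := by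
  conv_lhs => rw [eq_sum_v hx a]
  simp

/-- The space of alternating forms on the plane is a line, so each structure equation needs checking
only on `(v₀, v₁)`. -/
theorem eq_of_alternating {B C : E2 →L[ℝ] E2 →L[ℝ] ℝ} (hB : ∀ v w, B v w = -B w v)
    (hC : ∀ v w, C v w = -C w v) (h : B (F.v 0 x) (F.v 1 x) = C (F.v 0 x) (F.v 1 x)) :
    B = C := by
  have h₀ : ∀ D : E2 →L[ℝ] E2 →L[ℝ] ℝ, (∀ v w, D v w = -D w v) → ∀ v, D v v = 0 :=
    fun D hD v => by linarith [hD v v]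
  ext a b
  rw [clm_eq hx B a, clm_eq hx C a]
  simp only [add_apply, smul_apply]
  rw [clm_eq hx (B (F.v 0 x)) b, clm_eq hx (B (F.v 1 x)) b, clm_eq hx (C (F.v 0 x)) b,
    clm_eq hx (C (F.v 1 x)) b, h₀ B hB, h₀ B hB, h₀ C hC, h₀ C hC, hB (F.v 1 x), hC (F.v 1 x), h]

omit hx in
theorem extD_alternating {E : Type*} [NormedAddCommGroup E] [NormedSpace ℝ E]
    (ζ : E → E →L[ℝ] ℝ) (x v w : E) : extD ζ x v w = -extD ζ x w v := by
  simp [extD_apply]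

omit hx in
theorem wedge_alternating {E : Type*} [NormedAddCommGroup E] [NormedSpace ℝ E]
    (α β : E →L[ℝ] ℝ) (v w : E) : wedge α β v w = -wedge α β w v := by
  simp [wedge_apply]

theorem extD_η_zero : extD (F.η 0) x = -wedge (F.conn x) (F.η 1 x) := by
  refine eq_of_alternating hx (extD_alternating _ _) (fun v w => ?_) ?_
  · simp [wedge_apply]
  · simp [wedge_apply, η_v hx, conn]

theorem extD_η_one : extD (F.η 1) x = wedge (F.conn x) (F.η 0 x) := by
  refine eq_of_alternating hx (extD_alternating _ _) (wedge_alternating _ _) ?_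
  simp [wedge_apply, η_v hx, conn]

theorem extD_conn : extD F.conn x = F.K x • wedge (F.η 0 x) (F.η 1 x) := by
  refine eq_of_alternating hx (extD_alternating _ _) (fun v w => ?_) ?_
  · simp [wedge_apply]; ring
  · simp [wedge_apply, η_v hx, K]

omit hx in
/-- The components of `dK / 4K`. -/
def P (F : Framing g) (i : Fin 2) (x : E2) : ℝ :=
  fderiv ℝ F.K x (F.v i x) / (4 * F.K x)

omit hx in
/-- The components of the covariant derivative of `dK / 4K`. -/
def DP (F : Framing g) (i : Fin 2) (x : E2) : Fin 2 → ℝ :=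
  ![fderiv ℝ (F.P 0) x (F.v i x) + F.P 1 x * F.conn x (F.v i x),
    fderiv ℝ (F.P 1) x (F.v i x) - F.P 0 x * F.conn x (F.v i x)]

variable (hK : F.K x ≠ 0)
include hK

theorem contDiffAt_P (i : Fin 2) : ContDiffAt ℝ ∞ (F.P i) x := by
  have h₁ : ContDiffAt ℝ ∞ (fderiv ℝ F.K) x := (contDiffAt_K hx).fderiv_right (by simp)
  exact (h₁.clm_apply (contDiffAt_v hx i)).div (contDiffAt_const.mul (contDiffAt_K hx))
    (by simpa using hK)

theorem contDiffAt_DP (i j : Fin 2) : ContDiffAt ℝ ∞ (fun y => F.DP i y j) x := by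
  have h₁ : ∀ j, ContDiffAt ℝ ∞ (fun y => fderiv ℝ (F.P j) y (F.v i y)) x := fun j =>
    ((contDiffAt_P hx hK j).fderiv_right (by simp)).clm_apply (contDiffAt_v hx i)
  have h₂ : ContDiffAt ℝ ∞ (fun y => F.conn y (F.v i y)) x :=
    (contDiffAt_conn hx).clm_apply (contDiffAt_v hx i)
  fin_cases j
  · exact (h₁ 0).add ((contDiffAt_P hx hK 1).mul h₂)
  · exact (h₁ 1).sub ((contDiffAt_P hx hK 0).mul h₂)

theorem fderiv_K :
    fderiv ℝ F.K x = (4 * F.K x) • (F.P 0 x • F.η 0 x + F.P 1 x • F.η 1 x) := by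
  ext a
  rw [clm_eq hx (fderiv ℝ F.K x) a]
  simp only [smul_eq_mul, smul_apply, add_apply, P]
  field_simp

omit hK in
theorem fderiv_P_zero : fderiv ℝ (F.P 0) x =
    (-F.P 1 x) • F.conn x + F.DP 0 x 0 • F.η 0 x + F.DP 1 x 0 • F.η 1 x := by
  ext a
  rw [clm_eq hx (fderiv ℝ (F.P 0) x) a]
  simp only [add_apply, smul_apply]
  rw [clm_eq hx (F.conn x) a]
  simp [DP]; ring

omit hK in
theorem fderiv_P_one : fderiv ℝ (F.P 1) x =
    F.P 0 x • F.conn x + F.DP 0 x 1 • F.η 0 x + F.DP 1 x 1 • F.η 1 x := by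
  ext a
  rw [clm_eq hx (fderiv ℝ (F.P 1) x) a]
  simp only [add_apply, smul_apply]
  rw [clm_eq hx (F.conn x) a]
  simp [DP]; ring

/-- `dK / 4K` is a quarter of `d log |K|`, hence closed, so its covariant derivative is symmetric.
-/
theorem DP_symm : F.DP 0 x 1 = F.DP 1 x 0 := by
  have hne : ∀ᶠ y in 𝓝 x, y ∈ F.chart.target ∧ F.K y ≠ 0 :=
    (F.chart.open_target.eventually_mem hx).and ((contDiffAt_K hx).continuousAt.eventually_ne hK)
  have h₁ : (fun y => F.P 0 y • F.η 0 y + F.P 1 y • F.η 1 y) =ᶠ[𝓝 x]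
      fun y => (4 * F.K y)⁻¹ • fderiv ℝ F.K y := by
    filter_upwards [hne] with y hy
    rw [fderiv_K hy.1 hy.2, inv_smul_smul₀ (by simpa using hy.2)]
  have hd : ∀ i, DifferentiableAt ℝ (F.P i) x := fun i =>
    (contDiffAt_P hx hK i).differentiableAt (by simp)
  have he : ∀ i, DifferentiableAt ℝ (F.η i) x := fun i =>
    (contDiffAt_η hx i).differentiableAt (by simp)
  have hKd : DifferentiableAt ℝ F.K x := (contDiffAt_K hx).differentiableAt (by simp)
  have hKd' : DifferentiableAt ℝ (fun y => (4 * F.K y)⁻¹) x :=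
    (hKd.const_mul 4).inv (by simpa using hK)
  have hKdd : DifferentiableAt ℝ (fderiv ℝ F.K) x :=
    ((contDiffAt_K hx).fderiv_right (m := 1) one_add_one_le_infty).differentiableAt (by simp)
  have hinv : HasFDerivAt (fun y => (4 * F.K y)⁻¹)
      ((-((4 * F.K x) ^ 2)⁻¹ * 4) • fderiv ℝ F.K x) x := by
    have := (hasDerivAt_inv (show (4 * F.K x) ≠ 0 by simpa using hK)).comp_hasFDerivAt x
      (hKd.hasFDerivAt.const_mul 4)
    rw [smul_smul] at this
    exact this
  have h₂ := Filter.EventuallyEq.extD_eq h₁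
  rw [extD_fun_smul hKd' hKdd, extD_fderiv (contDiffAt_K hx), hinv.fderiv,
    extD_fun_add ((hd 0).fun_smul (he 0)) ((hd 1).fun_smul (he 1)), extD_fun_smul (hd 0) (he 0),
    extD_fun_smul (hd 1) (he 1), extD_η_zero hx, extD_η_one hx] at h₂
  have h₃ := DFunLike.congr_fun (DFunLike.congr_fun h₂ (F.v 0 x)) (F.v 1 x)
  simp [wedge_apply, η_v hx] at h₃
  simp [DP]
  linarith

end Framing
end FramingCalculus

/-! ### The coframe of the isometric embedding system and the resulting equation for the curvature.
-/

section EmbeddingSystem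

variable {M : Type*} [TopologicalSpace M] [ChartedSpace E2 M] [IsManifold 𝓘(ℝ, E2) ∞ M]

theorem hasFDerivAt_ofReal_comp (𝕜 : Type*) [RCLike 𝕜] {E E' : Type*} [NormedAddCommGroup E]
    [NormedSpace ℝ E] [NormedAddCommGroup E'] [NormedSpace ℝ E'] {A : E →L[ℝ] E'} {f : E' → ℝ}
    {z : E} (hf : DifferentiableAt ℝ f (A z)) :
    HasFDerivAt (fun y => (f (A y) : 𝕜)) (RCLike.ofRealCLM.comp ((fderiv ℝ f (A z)).comp A)) z :=
  (RCLike.ofRealCLM (K := 𝕜)).hasFDerivAt.comp z (hf.hasFDerivAt.comp z A.hasFDerivAt)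

namespace Framing

variable {g : Metric M} {𝕜 : Type*} [RCLike 𝕜]

/-- The forms and functions on the product of a surface and the frame bundle of `ℝ³` that enter the
study of the embedding system; here `κ` is a square root of minus the Gauss curvature. -/
def embeddingCoframe (F : Framing g) (Y : FrameCoordinates) (κ : E2 → 𝕜) :
    EmbeddingCoframe 𝕜 (E2 × E6) :=
  let π₁ := ContinuousLinearMap.fst ℝ E2 E6
  let π₂ := ContinuousLinearMap.snd ℝ E2 E6
  { ω₁ := realPullback 𝕜 π₂ (Y.coform 0)
    ω₂ := realPullback 𝕜 π₂ (Y.coform 1)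
    ω₃ := realPullback 𝕜 π₂ (Y.coform 2)
    ω₁₂ := realPullback 𝕜 π₂ (Y.conn 0 1)
    ψ₁ := realPullback 𝕜 π₂ (Y.conn 2 0)
    ψ₂ := realPullback 𝕜 π₂ (Y.conn 2 1)
    η₁ := realPullback 𝕜 π₁ (F.η 0)
    η₂ := realPullback 𝕜 π₁ (F.η 1)
    η₁₂ := realPullback 𝕜 π₁ F.conn
    k := fun z => κ (π₁ z)
    p := fun z => (F.P 0 (π₁ z) : 𝕜)
    q := fun z => (F.P 1 (π₁ z) : 𝕜)
    a := fun z =>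
      ((F.P 0 (π₁ z) : 𝕜) ^ 2 - κ (π₁ z) ^ 2 - (F.DP 0 (π₁ z) 0 : 𝕜)) / (2 * κ (π₁ z))
    b := fun z =>
      ((F.P 0 (π₁ z) : 𝕜) * (F.P 1 (π₁ z) : 𝕜) - (F.DP 1 (π₁ z) 0 : 𝕜)) / (2 * κ (π₁ z))
    c := fun z =>
      ((F.P 1 (π₁ z) : 𝕜) ^ 2 - κ (π₁ z) ^ 2 - (F.DP 1 (π₁ z) 1 : 𝕜)) / (2 * κ (π₁ z)) }

theorem embeddingCoframe_system (F : Framing g) (Y : FrameCoordinates) (κ : E2 → 𝕜) :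
    (F.embeddingCoframe Y κ).system = F.θExt 𝕜 Y := by
  funext i z
  refine ContinuousLinearMap.ext fun v => ?_
  fin_cases i <;>
  simp [EmbeddingCoframe.system, EmbeddingCoframe.θ₁, EmbeddingCoframe.θ₂, EmbeddingCoframe.θ₃,
    embeddingCoframe, θExt, θ]

variable {F : Framing g} {Y : FrameCoordinates} {κ : E2 → 𝕜}

theorem linearIndependent_embeddingCoframe {x : E2} {y : E6} (hx : x ∈ F.chart.target)
    (hy : y ∈ Y.domain) :
    LinearIndependent 𝕜
      ![(F.embeddingCoframe Y κ).ω₁ (x, y), (F.embeddingCoframe Y κ).ω₂ (x, y),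
        (F.embeddingCoframe Y κ).ω₃ (x, y), (F.embeddingCoframe Y κ).ω₁₂ (x, y),
        (F.embeddingCoframe Y κ).ψ₁ (x, y), (F.embeddingCoframe Y κ).ψ₂ (x, y),
        (F.embeddingCoframe Y κ).η₁ (x, y), (F.embeddingCoframe Y κ).η₂ (x, y)] := by
  let π₁ := ContinuousLinearMap.fst ℝ E2 E6
  let π₂ := ContinuousLinearMap.snd ℝ E2 E6
  have h := linearIndependent_of_forall_eq_zero 𝕜 (E := E2 × E6)
    (w := ![(Y.coform 0 y).comp π₂, (Y.coform 1 y).comp π₂, (Y.coform 2 y).comp π₂,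
      (Y.conn 0 1 y).comp π₂, (Y.conn 2 0 y).comp π₂, (Y.conn 2 1 y).comp π₂,
      (F.η 0 x).comp π₁, (F.η 1 x).comp π₁]) (by simp) (by
      rintro ⟨v₁, v₂⟩ h
      have hη₀ : F.η 0 x v₁ = 0 := h 6
      have hη₁ : F.η 1 x v₁ = 0 := h 7
      have h₁ : v₁ = 0 := by
        rw [eq_sum_v hx v₁, hη₀, hη₁]; simp
      have h₂ : v₂ = 0 := FrameCoordinates.eq_zero_of_forms hy
        (fun a => by fin_cases a; exacts [h 0, h 1, h 2]) (h 3) (h 4) (h 5)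
      rw [h₁, h₂]; rfl)
  convert h using 1
  funext i
  fin_cases i <;> rfl

theorem exists_fderiv_comp_fst {x : E2} {y : E6} (hx : x ∈ F.chart.target) {f : E2 → 𝕜}
    (hf : DifferentiableAt ℝ f x) :
    ∃ u v : 𝕜, fderiv ℝ (fun z : E2 × E6 => f (ContinuousLinearMap.fst ℝ E2 E6 z)) (x, y) =
      u • (F.embeddingCoframe Y κ).η₁ (x, y) + v • (F.embeddingCoframe Y κ).η₂ (x, y) := by
  have h := HasFDerivAt.comp (x, y) (f := ContinuousLinearMap.fst ℝ E2 E6) hf.hasFDerivAt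
    (ContinuousLinearMap.fst ℝ E2 E6).hasFDerivAt
  refine ⟨fderiv ℝ f x (F.v 0 x), fderiv ℝ f x (F.v 1 x), ?_⟩
  refine h.fderiv.trans (ContinuousLinearMap.ext fun v => ?_)
  simp only [ContinuousLinearMap.comp_apply, add_apply, smul_apply, embeddingCoframe,
    realPullback_apply]
  rw [clm_eq hx (fderiv ℝ f x)]
  simp [RCLike.real_smul_eq_coe_mul, mul_comm]

-- The relation `κ² = -K` is assumed near `x` because differentiating it yields `d_k`. The functions
-- `a, b, c` are defined by solving `d_p` and `d_q` for them, which is consistent by `DP_symm`.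
set_option maxHeartbeats 1000000 in
theorem isAdaptedAt_embeddingCoframe {x : E2} {y : E6} (hx : x ∈ F.chart.target)
    (hy : y ∈ Y.domain) (hK : F.K x ≠ 0) (hκ : ContDiffAt ℝ ∞ κ x)
    (hκK : ∀ᶠ x' in 𝓝 x, κ x' ^ 2 = -(F.K x' : 𝕜)) :
    (F.embeddingCoframe Y κ).IsAdaptedAt (x, y) := by
  have hx' : ContinuousLinearMap.fst ℝ E2 E6 (x, y) = x := rfl
  have hη : ∀ i, DifferentiableAt ℝ (F.η i) x := fun i =>
    (contDiffAt_η hx i).differentiableAt (by simp)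
  have hconn : DifferentiableAt ℝ F.conn x := (contDiffAt_conn hx).differentiableAt (by simp)
  have hP : ∀ i, DifferentiableAt ℝ (F.P i) x := fun i =>
    (contDiffAt_P hx hK i).differentiableAt (by simp)
  have hDP : ∀ i j, DifferentiableAt ℝ (fun y => F.DP i y j) x := fun i j =>
    (contDiffAt_DP hx hK i j).differentiableAt (by simp)
  have hk : DifferentiableAt ℝ κ x := hκ.differentiableAt (by simp)
  have hκ₀ : κ x ≠ 0 := fun h => by
    have := hκK.self_of_nhds
    rw [h] at this
    simp [hK] at this
  have cast : ∀ {f : E2 → ℝ}, DifferentiableAt ℝ f x →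
      DifferentiableAt ℝ (fun x => (f x : 𝕜)) x := fun h =>
    (RCLike.ofRealCLM (K := 𝕜)).differentiableAt.comp x h
  have hinv : DifferentiableAt ℝ (fun x => (2 * κ x)⁻¹) x :=
    (hk.const_mul 2).fun_inv (by simpa using hκ₀)
  have ha : DifferentiableAt ℝ
      (fun x => ((F.P 0 x : 𝕜) ^ 2 - κ x ^ 2 - (F.DP 0 x 0 : 𝕜)) / (2 * κ x)) x := by
    simp only [div_eq_mul_inv]
    exact ((((cast (hP 0)).pow 2).sub (hk.pow 2)).sub (cast (hDP 0 0))).mul hinv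
  have hb : DifferentiableAt ℝ
      (fun x => ((F.P 0 x : 𝕜) * (F.P 1 x : 𝕜) - (F.DP 1 x 0 : 𝕜)) / (2 * κ x)) x := by
    simp only [div_eq_mul_inv]
    exact (((cast (hP 0)).mul (cast (hP 1))).sub (cast (hDP 1 0))).mul hinv
  have hc : DifferentiableAt ℝ
      (fun x => ((F.P 1 x : 𝕜) ^ 2 - κ x ^ 2 - (F.DP 1 x 1 : 𝕜)) / (2 * κ x)) x := by
    simp only [div_eq_mul_inv]
    exact ((((cast (hP 1)).pow 2).sub (hk.pow 2)).sub (cast (hDP 1 1))).mul hinv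
  have hfst : ∀ {f : E2 → 𝕜}, DifferentiableAt ℝ f x →
      DifferentiableAt ℝ (fun z : E2 × E6 => f (ContinuousLinearMap.fst ℝ E2 E6 z)) (x, y) :=
    fun h => DifferentiableAt.comp (x, y) (f := ContinuousLinearMap.fst ℝ E2 E6) h
      (ContinuousLinearMap.fst ℝ E2 E6).differentiableAt
  have hω := FrameCoordinates.differentiableAt_coform hy
  have hψ := FrameCoordinates.differentiableAt_conn hy
  have dω : ∀ i v w, extD (realPullback 𝕜 (ContinuousLinearMap.snd ℝ E2 E6) (Y.coform i))
      (x, y) v w = (extD (Y.coform i) y v.2 w.2 : 𝕜) := fun i v w =>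
    extD_realPullback 𝕜 (A := ContinuousLinearMap.snd ℝ E2 E6) (z := (x, y)) (hω i) v w
  have dψ : ∀ i j v w, extD (realPullback 𝕜 (ContinuousLinearMap.snd ℝ E2 E6) (Y.conn i j))
      (x, y) v w = (extD (Y.conn i j) y v.2 w.2 : 𝕜) := fun i j v w =>
    extD_realPullback 𝕜 (A := ContinuousLinearMap.snd ℝ E2 E6) (z := (x, y)) (hψ i j) v w
  have dη : ∀ i v w, extD (realPullback 𝕜 (ContinuousLinearMap.fst ℝ E2 E6) (F.η i))
      (x, y) v w = (extD (F.η i) x v.1 w.1 : 𝕜) := fun i v w =>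
    extD_realPullback 𝕜 (A := ContinuousLinearMap.fst ℝ E2 E6) (z := (x, y)) (hη i) v w
  have dconn : ∀ v w, extD (realPullback 𝕜 (ContinuousLinearMap.fst ℝ E2 E6) F.conn)
      (x, y) v w = (extD F.conn x v.1 w.1 : 𝕜) := fun v w =>
    extD_realPullback 𝕜 (A := ContinuousLinearMap.fst ℝ E2 E6) (z := (x, y)) hconn v w
  have hself := FrameCoordinates.conn_self hy
  have h10 : Y.conn 1 0 y = -Y.conn 0 1 y := FrameCoordinates.conn_antisymm hy 0 1
  have h12 : Y.conn 1 2 y = -Y.conn 2 1 y := FrameCoordinates.conn_antisymm hy 2 1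
  have h02 : Y.conn 0 2 y = -Y.conn 2 0 y := FrameCoordinates.conn_antisymm hy 2 0
  have hκx : κ x ^ 2 = -(F.K x : 𝕜) := hκK.self_of_nhds
  exact
  { indep := linearIndependent_embeddingCoframe hx hy
    conn_mem := by
      refine ⟨(F.conn x (F.v 0 x) : 𝕜), (F.conn x (F.v 1 x) : 𝕜),
        ContinuousLinearMap.ext fun v => ?_⟩
      simp only [embeddingCoframe, add_apply, smul_apply, realPullback_apply]
      rw [hx', clm_eq hx (F.conn x)]
      simp [mul_comm]
    k_ne := hκ₀
    diff_ω₁ := (hasFDerivAt_realPullback 𝕜 (z := (x, y)) (hω 0)).differentiableAt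
    diff_ω₂ := (hasFDerivAt_realPullback 𝕜 (z := (x, y)) (hω 1)).differentiableAt
    diff_ω₃ := (hasFDerivAt_realPullback 𝕜 (z := (x, y)) (hω 2)).differentiableAt
    diff_ω₁₂ := (hasFDerivAt_realPullback 𝕜 (z := (x, y)) (hψ 0 1)).differentiableAt
    diff_ψ₁ := (hasFDerivAt_realPullback 𝕜 (z := (x, y)) (hψ 2 0)).differentiableAt
    diff_ψ₂ := (hasFDerivAt_realPullback 𝕜 (z := (x, y)) (hψ 2 1)).differentiableAt
    diff_η₁ := (hasFDerivAt_realPullback 𝕜 (z := (x, y)) (hη 0)).differentiableAt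
    diff_η₂ := (hasFDerivAt_realPullback 𝕜 (z := (x, y)) (hη 1)).differentiableAt
    diff_η₁₂ := (hasFDerivAt_realPullback 𝕜 (z := (x, y)) hconn).differentiableAt
    diff_k := hfst hk
    diff_p := hfst (cast (hP 0))
    diff_q := hfst (cast (hP 1))
    diff_a := hfst ha
    diff_b := hfst hb
    diff_c := hfst hc
    d_ω₁ := by
      refine ContinuousLinearMap.ext fun v => ContinuousLinearMap.ext fun w => ?_
      simp [embeddingCoframe, dω, FrameCoordinates.extD_coform hy, Fin.sum_univ_three,
        wedge_apply, hself, h10]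
      ring
    d_ω₂ := by
      refine ContinuousLinearMap.ext fun v => ContinuousLinearMap.ext fun w => ?_
      simp [embeddingCoframe, dω, FrameCoordinates.extD_coform hy, Fin.sum_univ_three,
        wedge_apply, hself]
      ring
    d_ω₃ := by
      refine ContinuousLinearMap.ext fun v => ContinuousLinearMap.ext fun w => ?_
      simp [embeddingCoframe, dω, FrameCoordinates.extD_coform hy, Fin.sum_univ_three,
        wedge_apply, hself, h02, h12]
      ring
    d_ω₁₂ := by
      refine ContinuousLinearMap.ext fun v => ContinuousLinearMap.ext fun w => ?_
      simp [embeddingCoframe, dψ, FrameCoordinates.extD_conn hy, Fin.sum_univ_three,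
        wedge_apply, hself]
    d_ψ₁ := by
      refine ContinuousLinearMap.ext fun v => ContinuousLinearMap.ext fun w => ?_
      simp [embeddingCoframe, dψ, FrameCoordinates.extD_conn hy, Fin.sum_univ_three,
        wedge_apply, hself, h10, h12]
    d_ψ₂ := by
      refine ContinuousLinearMap.ext fun v => ContinuousLinearMap.ext fun w => ?_
      simp [embeddingCoframe, dψ, FrameCoordinates.extD_conn hy, Fin.sum_univ_three,
        wedge_apply, hself, h02]
      ring
    d_η₁ := by
      refine ContinuousLinearMap.ext fun v => ContinuousLinearMap.ext fun w => ?_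
      simp [embeddingCoframe, dη, extD_η_zero hx, wedge_apply]
    d_η₂ := by
      refine ContinuousLinearMap.ext fun v => ContinuousLinearMap.ext fun w => ?_
      simp [embeddingCoframe, dη, extD_η_one hx, wedge_apply]
    d_η₁₂ := by
      refine ContinuousLinearMap.ext fun v => ContinuousLinearMap.ext fun w => ?_
      simp [embeddingCoframe, dconn, extD_conn hx, wedge_apply, hκx]
    d_k := by
      have h₁ : fderiv ℝ (fun x => κ x ^ 2) x = fderiv ℝ (fun x => -(F.K x : 𝕜)) x :=
        Filter.EventuallyEq.fderiv_eq hκK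
      have h₂ : HasFDerivAt (fun x => (F.K x : 𝕜)) (RCLike.ofRealCLM.comp (fderiv ℝ F.K x)) x :=
        (RCLike.ofRealCLM (K := 𝕜)).hasFDerivAt.comp x
          ((contDiffAt_K hx).differentiableAt (by simp)).hasFDerivAt
      have h₀ := HasFDerivAt.fun_mul (𝕜 := ℝ) hk.hasFDerivAt hk.hasFDerivAt
      simp only [pow_two] at h₁
      rw [h₀.fderiv, h₂.fun_neg.fderiv, fderiv_K hx hK] at h₁
      have h₃ := HasFDerivAt.comp (x, y) (f := ContinuousLinearMap.fst ℝ E2 E6) hk.hasFDerivAt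
        (ContinuousLinearMap.fst ℝ E2 E6).hasFDerivAt
      refine h₃.fderiv.trans (ContinuousLinearMap.ext fun v => ?_)
      have h₄ := DFunLike.congr_fun h₁ v.1
      simp only [neg_apply, ContinuousLinearMap.comp_apply, add_apply, smul_apply, smul_eq_mul,
        RCLike.ofRealCLM_apply] at h₄
      push_cast at h₄
      simp [embeddingCoframe]
      have hKκ : (F.K x : 𝕜) = -κ x ^ 2 := by rw [hκx]; ring
      refine mul_left_cancel₀ (mul_ne_zero two_ne_zero hκ₀) ?_
      linear_combination h₄ - 4 * ((F.P 0 x : 𝕜) * (F.η 0 x v.1 : 𝕜) +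
        (F.P 1 x : 𝕜) * (F.η 1 x v.1 : 𝕜)) * hKκ
    d_p := by
      refine (hasFDerivAt_ofReal_comp 𝕜 (A := ContinuousLinearMap.fst ℝ E2 E6) (z := (x, y))
        (hP 0)).fderiv.trans (ContinuousLinearMap.ext fun v => ?_)
      simp [embeddingCoframe, fderiv_P_zero hx]
      field_simp
      ring
    d_q := by
      refine (hasFDerivAt_ofReal_comp 𝕜 (A := ContinuousLinearMap.fst ℝ E2 E6) (z := (x, y))
        (hP 1)).fderiv.trans (ContinuousLinearMap.ext fun v => ?_)
      simp [embeddingCoframe, fderiv_P_one hx, DP_symm hx hK]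
      field_simp
      ring
    d_a := exists_fderiv_comp_fst hx ha
    d_b := exists_fderiv_comp_fst hx hb
    d_c := exists_fderiv_comp_fst hx hc }

/-- The second order equation satisfied by the Gauss curvature of a metric whose isometric
embedding system is Darboux integrable. -/
theorem DP_of_embeddingIntegrable (h : EmbeddingIntegrable 𝕜 g)
    (hK : ∀ x ∈ F.chart.target, F.K x ≠ 0) (hκ : ∀ x ∈ F.chart.target, ContDiffAt ℝ ∞ κ x)
    (hκK : ∀ x ∈ F.chart.target, κ x ^ 2 = -(F.K x : 𝕜)) {x : E2} (hx : x ∈ F.chart.target) :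
    F.DP 0 x 0 = 3 * F.P 0 x ^ 2 - F.K x ∧ F.DP 1 x 0 = 3 * F.P 0 x * F.P 1 x ∧
      F.DP 1 x 1 = 3 * F.P 1 x ^ 2 - F.K x := by
  -- The equation involves only the surface point, so any single Euclidean frame will do: here the
  -- standard one at the origin.
  obtain ⟨Y, y, hy, -, -, hD⟩ := h F x hx 0 (EuclideanSpace.basisFun (Fin 3) ℝ)
    (EuclideanSpace.basisFun (Fin 3) ℝ).orthonormal
  rw [← embeddingCoframe_system F Y κ] at hD
  have hopen : F.chart.target ×ˢ Y.domain ∈ 𝓝 (x, y) :=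
    (F.chart.open_target.prod Y.isOpen_domain).mem_nhds ⟨hx, hy⟩
  obtain ⟨e₁, e₂, e₃⟩ := EmbeddingCoframe.second_order_of_isDarbouxIntegrableAt (by
    filter_upwards [hopen] with z hz
    exact isAdaptedAt_embeddingCoframe hz.1 hz.2 (hK _ hz.1) (hκ _ hz.1)
      (Filter.mem_of_superset (F.chart.open_target.mem_nhds hz.1) hκK))
    (by rw [finrank_covector]; simp) hD
  have hκx := hκK x hx
  have hκ₀ : κ x ≠ 0 := fun h => by
    rw [h] at hκx
    simp [hK x hx] at hκx
  have hKκ : (F.K x : 𝕜) = -κ x ^ 2 := by rw [hκx]; ring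
  simp only [embeddingCoframe, ContinuousLinearMap.coe_fst'] at e₁ e₂ e₃
  -- Clearing the denominators `2κ` leaves identities between real quantities, once `κ²` is replaced
  -- by `-K`; they descend from `𝕜` to `ℝ`.
  field_simp at e₁ e₂ e₃
  refine ⟨?_, ?_, ?_⟩ <;> apply (RCLike.ofReal_injective (K := 𝕜)) <;> push_cast
  · linear_combination -e₁ + hKκ
  · linear_combination -e₂
  · linear_combination -e₃ + hKκ

end Framing
end EmbeddingSystem

/-! ### Passing to new coordinates on the surface. -/

section LocalForm

variable {M : Type*} [TopologicalSpace M] [ChartedSpace E2 M] [IsManifold 𝓘(ℝ, E2) ∞ M]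
  {φ : OpenPartialHomeomorph M E2}

theorem trans_mem_maximalAtlas (hφ : φ ∈ IsManifold.maximalAtlas 𝓘(ℝ, E2) ∞ M)
    {ψ : OpenPartialHomeomorph E2 E2} (h₁ : ContDiffOn ℝ ∞ ψ ψ.source)
    (h₂ : ContDiffOn ℝ ∞ ψ.symm ψ.target) :
    φ ≫ₕ ψ ∈ IsManifold.maximalAtlas 𝓘(ℝ, E2) ∞ M := by
  have hψ : ψ ∈ contDiffGroupoid ∞ 𝓘(ℝ, E2) := by
    rw [contDiffGroupoid, mem_groupoid_of_pregroupoid]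
    simpa [contDiffPregroupoid] using And.intro h₁ h₂
  rw [IsManifold.mem_maximalAtlas_iff, mem_maximalAtlas_iff]
  intro e he
  have he' : e ∈ IsManifold.maximalAtlas 𝓘(ℝ, E2) ∞ M := IsManifold.subset_maximalAtlas he
  constructor
  · rw [OpenPartialHomeomorph.trans_symm_eq_symm_trans_symm, OpenPartialHomeomorph.trans_assoc]
    exact StructureGroupoid.trans _ (StructureGroupoid.symm _ hψ)
      (StructureGroupoid.compatible_of_mem_maximalAtlas hφ he')
  · rw [← OpenPartialHomeomorph.trans_assoc]
    exact StructureGroupoid.trans _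
      (StructureGroupoid.compatible_of_mem_maximalAtlas he' hφ) hψ

variable {g : Metric M}

theorem localMetric_trans (hφ : φ ∈ IsManifold.maximalAtlas 𝓘(ℝ, E2) ∞ M)
    {ψ : OpenPartialHomeomorph E2 E2} {x : E2} (hx : x ∈ (φ ≫ₕ ψ).target)
    (hψ : DifferentiableAt ℝ ψ.symm x) (a b : E2) :
    localMetric g (φ ≫ₕ ψ) x a b =
      localMetric g φ (ψ.symm x) (fderiv ℝ ψ.symm x a) (fderiv ℝ ψ.symm x b) := by
  have hx' : ψ.symm x ∈ φ.target := by
    simp only [OpenPartialHomeomorph.trans_target] at hx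
    exact hx.2
  have h : mfderiv 𝓘(ℝ, E2) 𝓘(ℝ, E2) (φ ≫ₕ ψ).symm x =
      (mfderiv 𝓘(ℝ, E2) 𝓘(ℝ, E2) φ.symm (ψ.symm x)).comp (fderiv ℝ ψ.symm x) := by
    have h₁ := mfderiv_comp (I' := 𝓘(ℝ, E2)) x
      ((mdifferentiable_of_mem_maximalAtlas hφ).mdifferentiableAt_symm hx') hψ.mdifferentiableAt
    rw [mfderiv_eq_fderiv] at h₁
    exact h₁
  rw [localMetric_apply, h]
  rfl

/-- A vector killed by `du` and `dv` has length zero by `hg`, so positivity of the metric makes `(u,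
v)` a local diffeomorphism. -/
theorem hasLocalForm_of_coordinates (hφ : φ ∈ IsManifold.maximalAtlas 𝓘(ℝ, E2) ∞ M)
    {s : Set E2} (hs : IsOpen s) (hsφ : s ⊆ φ.target) {u v : E2 → ℝ}
    (hu : ∀ x ∈ s, ContDiffAt ℝ ∞ u x) (hv : ∀ x ∈ s, ContDiffAt ℝ ∞ v x)
    {I : Set ℝ} (hI : ∀ x ∈ s, u x ∈ I) {A B : ℝ → ℝ}
    (hg : ∀ x ∈ s, ∀ a b, localMetric g φ x a b = A (u x) * (fderiv ℝ u x a * fderiv ℝ u x b) +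
      B (u x) * (fderiv ℝ v x a * fderiv ℝ v x b))
    {p : M} (hp : p ∈ φ.source) (hps : φ p ∈ s) : HasLocalForm g p I A B := by
  let Ψ : E2 → E2 := fun x => !₂[u x, v x]
  have hΨ : ∀ x ∈ s, ContDiffAt ℝ ∞ Ψ x := by
    intro x hx
    rw [contDiffAt_euclidean]
    intro i
    fin_cases i
    · exact hu x hx
    · exact hv x hx
  have hcoord : ∀ x ∈ s, ∀ a, fderiv ℝ Ψ x a = !₂[fderiv ℝ u x a, fderiv ℝ v x a] := by
    intro x hx a
    have h := ((hΨ x hx).differentiableAt (by simp)).hasFDerivAt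
    have h' := fun i => ((hasFDerivWithinAt_euclidean (t := Set.univ)).1 h.hasFDerivWithinAt i)
    simp only [hasFDerivWithinAt_univ] at h'
    ext i
    fin_cases i
    · exact (DFunLike.congr_fun (h' 0).fderiv a).symm
    · exact (DFunLike.congr_fun (h' 1).fderiv a).symm
  have hequiv : ∀ x ∈ s, ∃ L : E2 ≃L[ℝ] E2, HasFDerivAt Ψ (L : E2 →L[ℝ] E2) x := by
    intro x hx
    have hinj : Function.Injective (fderiv ℝ Ψ x) := by
      rw [injective_iff_map_eq_zero]
      intro a ha
      by_contra hne
      have hpos := localMetric_pos (g := g) hφ (hsφ hx) hne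
      rw [hcoord x hx] at ha
      have h0 : fderiv ℝ u x a = 0 := congrFun (congrArg WithLp.ofLp ha) 0
      have h1 : fderiv ℝ v x a = 0 := congrFun (congrArg WithLp.ofLp ha) 1
      rw [hg x hx, h0, h1] at hpos
      simp at hpos
    let L := LinearEquiv.ofInjectiveEndo (fderiv ℝ Ψ x : E2 →ₗ[ℝ] E2) hinj
    refine ⟨L.toContinuousLinearEquiv, ?_⟩
    have hL : (L.toContinuousLinearEquiv : E2 →L[ℝ] E2) = fderiv ℝ Ψ x :=
      ContinuousLinearMap.ext fun a => rfl
    rw [hL]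
    exact ((hΨ x hx).differentiableAt (by simp)).hasFDerivAt
  obtain ⟨L₀, hL₀⟩ := hequiv _ hps
  -- Restriction to `s` makes the differential invertible on the whole source, so the inverse is
  -- smooth on the whole target.
  let ψ := ((hΨ _ hps).toOpenPartialHomeomorph Ψ hL₀ (by simp)).restrOpen s hs
  have hψs : ψ.source ⊆ s := fun x hx => hx.2
  have hψ : ∀ x, ψ x = Ψ x := fun x => rfl
  have hsymm : ∀ x ∈ ψ.target, ContDiffAt ℝ ∞ ψ.symm x := by
    intro x hx
    have hx' := hψs (ψ.map_target hx)
    obtain ⟨L, hL⟩ := hequiv _ hx'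
    exact ψ.contDiffAt_symm hx hL (hΨ _ hx')
  refine ⟨φ ≫ₕ ψ, trans_mem_maximalAtlas hφ (fun x hx => (hΨ x (hψs hx)).contDiffWithinAt)
    (fun x hx => (hsymm x hx).contDiffWithinAt), ?_, ?_⟩
  · rw [OpenPartialHomeomorph.trans_source]
    exact ⟨hp, (hΨ _ hps).mem_toOpenPartialHomeomorph_source hL₀ (by simp), hps⟩
  · intro x hx
    have hxt : x ∈ ψ.target := by
      simp only [OpenPartialHomeomorph.trans_target] at hx
      exact hx.1
    have hxs := hψs (ψ.map_target hxt)
    have hd : DifferentiableAt ℝ ψ.symm x := (hsymm x hxt).differentiableAt (by simp)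
    have hid : ∀ y ∈ ψ.target, !₂[u (ψ.symm y), v (ψ.symm y)] = y := fun y hy => ψ.right_inv hy
    have h0 : u (ψ.symm x) = x 0 := congrFun (congrArg WithLp.ofLp (hid x hxt)) 0
    have hcomp : (fderiv ℝ Ψ (ψ.symm x)).comp (fderiv ℝ ψ.symm x) =
        ContinuousLinearMap.id ℝ E2 := by
      have h₁ := ((hΨ _ hxs).differentiableAt (by simp)).hasFDerivAt.comp x hd.hasFDerivAt
      refine (h₁.congr_of_eventuallyEq (f₁ := id) ?_).unique (hasFDerivAt_id x)
      filter_upwards [ψ.open_target.mem_nhds hxt] with y hy using (hid y hy).symm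
    have ha : ∀ a, fderiv ℝ u (ψ.symm x) (fderiv ℝ ψ.symm x a) = a 0 ∧
        fderiv ℝ v (ψ.symm x) (fderiv ℝ ψ.symm x a) = a 1 := by
      intro a
      have := DFunLike.congr_fun hcomp a
      rw [ContinuousLinearMap.comp_apply, hcoord _ hxs] at this
      exact ⟨congrFun (congrArg WithLp.ofLp this) 0, congrFun (congrArg WithLp.ofLp this) 1⟩
    refine ⟨h0 ▸ hI _ hxs, fun a b => ?_⟩
    rw [localMetric_trans hφ hx hd, hg _ hxs, (ha a).1, (ha a).2, (ha b).1, (ha b).2, h0]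

end LocalForm

/-! ### Integration of the second order equation: the warped product form. -/

section Warped

variable {M : Type*} [TopologicalSpace M] [ChartedSpace E2 M] [IsManifold 𝓘(ℝ, E2) ∞ M]

namespace Framing

variable {g : Metric M}

/-- The Gauss curvature has the sign `ε = ±1` and satisfies the second order equation that Darboux
integrability of the isometric embedding system imposes. -/
structure IsSpecial (F : Framing g) (ε : ℝ) : Prop where
  sq_eps : ε ^ 2 = 1
  pos : ∀ x ∈ F.chart.target, 0 < ε * F.K x
  DP_zero_zero : ∀ x ∈ F.chart.target, F.DP 0 x 0 = 3 * F.P 0 x ^ 2 - F.K x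
  DP_one_zero : ∀ x ∈ F.chart.target, F.DP 1 x 0 = 3 * F.P 0 x * F.P 1 x
  DP_one_one : ∀ x ∈ F.chart.target, F.DP 1 x 1 = 3 * F.P 1 x ^ 2 - F.K x

/-- The function `|K| ^ (-1/4)`. -/
def w (F : Framing g) (ε : ℝ) (x : E2) : ℝ := (ε * F.K x) ^ (-1 / 4 : ℝ)

/-- The components of `w² dw`, where `w = |K| ^ (-1/4)`. -/
def H (F : Framing g) (ε : ℝ) (i : Fin 2) (x : E2) : ℝ := -(F.w ε x ^ 3 * F.P i x)

namespace IsSpecial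

variable {F : Framing g} {ε : ℝ} (h : F.IsSpecial ε) {x : E2} (hx : x ∈ F.chart.target)
include h hx

theorem K_ne_zero : F.K x ≠ 0 := (right_ne_zero_of_mul (h.pos x hx).ne')

theorem w_pos : 0 < F.w ε x := Real.rpow_pos_of_pos (h.pos x hx) _

theorem K_eq : F.K x = ε / F.w ε x ^ 4 := by
  have hp := h.pos x hx
  have h₁ : F.w ε x ^ 4 = (ε * F.K x)⁻¹ := by
    rw [w, ← Real.rpow_natCast, ← Real.rpow_mul hp.le, ← Real.rpow_neg_one]
    norm_num
  rw [h₁]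
  have := h.sq_eps
  field_simp
  linear_combination -F.K x * this

theorem contDiffAt_w : ContDiffAt ℝ ∞ (F.w ε) x :=
  (contDiffAt_const.mul (contDiffAt_K hx)).rpow_const_of_ne (h.pos x hx).ne'

theorem contDiffAt_H (i : Fin 2) : ContDiffAt ℝ ∞ (F.H ε i) x :=
  (((h.contDiffAt_w hx).pow 3).mul (contDiffAt_P hx (h.K_ne_zero hx) i)).neg

theorem hasFDerivAt_w :
    HasFDerivAt (F.w ε) ((-F.w ε x) • (F.P 0 x • F.η 0 x + F.P 1 x • F.η 1 x)) x := by
  have hp := h.pos x hx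
  have h₁ := ((contDiffAt_K hx).differentiableAt (by simp)).hasFDerivAt
  have h₂ := (h₁.const_mul ε).rpow_const (p := -1 / 4) (Or.inl hp.ne')
  refine h₂.congr_fderiv ?_
  rw [fderiv_K hx (h.K_ne_zero hx), Real.rpow_sub_one hp.ne', smul_smul, smul_smul]
  congr 1
  have hK := h.K_ne_zero hx
  have hε := left_ne_zero_of_mul hp.ne'
  change -1 / 4 * (F.w ε x / (ε * F.K x)) * ε * (4 * F.K x) = _
  field_simp

/-- With its companion `hasFDerivAt_H_one`, this says `∇(w² dw) = (ε/w) g`: the `P⊗P` terms from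
differentiating `w³` and from `∇P` cancel, and `w³ K = ε/w`. -/
theorem hasFDerivAt_H_zero :
    HasFDerivAt (F.H ε 0) ((-F.H ε 1 x) • F.conn x + (ε / F.w ε x) • F.η 0 x) x := by
  have hw := (h.w_pos hx).ne'
  have hP := (contDiffAt_P hx (h.K_ne_zero hx) 0).differentiableAt (by simp) |>.hasFDerivAt
  refine (((h.hasFDerivAt_w hx).pow 3).mul hP).neg.congr_fderiv ?_
  rw [fderiv_P_zero hx, h.DP_zero_zero x hx, h.DP_one_zero x hx, h.K_eq hx]
  ext a
  simp [H]
  field_simp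
  ring

theorem hasFDerivAt_H_one :
    HasFDerivAt (F.H ε 1) (F.H ε 0 x • F.conn x + (ε / F.w ε x) • F.η 1 x) x := by
  have hw := (h.w_pos hx).ne'
  have hP := (contDiffAt_P hx (h.K_ne_zero hx) 1).differentiableAt (by simp) |>.hasFDerivAt
  refine (((h.hasFDerivAt_w hx).pow 3).mul hP).neg.congr_fderiv ?_
  rw [fderiv_P_one hx, DP_symm hx (h.K_ne_zero hx), h.DP_one_zero x hx, h.DP_one_one x hx,
    h.K_eq hx]
  ext a
  simp [H]
  field_simp
  ring

/-- The Hessian equation gives `d|w² dw|² = (2ε/w) w² dw = d(εw²)`, a first integral. -/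
theorem hasFDerivAt_sq_sub :
    HasFDerivAt (fun x => F.H ε 0 x ^ 2 + F.H ε 1 x ^ 2 - ε * F.w ε x ^ 2)
      (0 : E2 →L[ℝ] ℝ) x := by
  have hw := (h.w_pos hx).ne'
  refine ((((h.hasFDerivAt_H_zero hx).pow 2).add ((h.hasFDerivAt_H_one hx).pow 2)).sub
    (((h.hasFDerivAt_w hx).pow 2).const_mul ε)).congr_fderiv ?_
  ext a
  simp [H]
  field_simp
  ring

/-- The form `⋆(w² dw) / |w² dw|²` is closed. -/
theorem extD_star (hR : F.H ε 0 x ^ 2 + F.H ε 1 x ^ 2 ≠ 0) :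
    extD (fun x => (F.H ε 0 x ^ 2 + F.H ε 1 x ^ 2)⁻¹ •
      (F.H ε 0 x • F.η 1 x - F.H ε 1 x • F.η 0 x)) x = 0 := by
  have hw := (h.w_pos hx).ne'
  have hη : ∀ i, DifferentiableAt ℝ (F.η i) x := fun i =>
    (contDiffAt_η hx i).differentiableAt (by simp)
  have h₀ := h.hasFDerivAt_H_zero hx
  have h₁ := h.hasFDerivAt_H_one hx
  have hinv : HasFDerivAt (fun x => (F.H ε 0 x ^ 2 + F.H ε 1 x ^ 2)⁻¹) _ x :=
    (hasDerivAt_inv hR).comp_hasFDerivAt x ((h₀.pow 2).fun_add (h₁.pow 2))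
  have h₃ : extD (fun x => F.H ε 0 x • F.η 1 x - F.H ε 1 x • F.η 0 x) x =
      (2 * (ε / F.w ε x)) • wedge (F.η 0 x) (F.η 1 x) := by
    rw [extD_fun_sub (h₀.differentiableAt.fun_smul (hη 1)) (h₁.differentiableAt.fun_smul (hη 0)),
      extD_fun_smul h₀.differentiableAt (hη 1), extD_fun_smul h₁.differentiableAt (hη 0),
      h₀.fderiv, h₁.fderiv, extD_η_zero hx, extD_η_one hx]
    ext a b
    simp [wedge_apply]
    ring
  have hd : DifferentiableAt ℝ (fun x => F.H ε 0 x • F.η 1 x - F.H ε 1 x • F.η 0 x) x :=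
    (h₀.differentiableAt.fun_smul (hη 1)).fun_sub (h₁.differentiableAt.fun_smul (hη 0))
  rw [extD_fun_smul hinv.differentiableAt hd, hinv.fderiv, h₃]
  ext a b
  simp [wedge_apply]
  field_simp
  ring

end IsSpecial

theorem IsSpecial.exists_warped {F : Framing g} {ε : ℝ} (h : F.IsSpecial ε) {x₀ : E2}
    (hx₀ : x₀ ∈ F.chart.target) (hK : fderiv ℝ F.K x₀ ≠ 0) :
    ∃ (C : ℝ) (s : Set E2) (v : E2 → ℝ), IsOpen s ∧ x₀ ∈ s ∧ s ⊆ F.chart.target ∧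
      ∀ x ∈ s, ContDiffAt ℝ ∞ v x ∧ 0 < ε * F.w ε x ^ 2 + C ∧ ∀ a b,
        localMetric g F.chart x a b =
          F.w ε x ^ 4 / (ε * F.w ε x ^ 2 + C) *
            (fderiv ℝ (F.w ε) x a * fderiv ℝ (F.w ε) x b) +
          (ε * F.w ε x ^ 2 + C) * (fderiv ℝ v x a * fderiv ℝ v x b) := by
  -- `w² dw` is a nonvanishing multiple of `dK`.
  have hR₀ : 0 < F.H ε 0 x₀ ^ 2 + F.H ε 1 x₀ ^ 2 := by
    have hw := (h.w_pos hx₀).ne'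
    by_contra hcon
    have e₀ : F.H ε 0 x₀ = 0 := by nlinarith [sq_nonneg (F.H ε 0 x₀), sq_nonneg (F.H ε 1 x₀)]
    have e₁ : F.H ε 1 x₀ = 0 := by nlinarith [sq_nonneg (F.H ε 0 x₀), sq_nonneg (F.H ε 1 x₀)]
    have e₀' : F.P 0 x₀ = 0 := by simpa [H, hw] using e₀
    have e₁' : F.P 1 x₀ = 0 := by simpa [H, hw] using e₁
    apply hK
    rw [fderiv_K hx₀ (h.K_ne_zero hx₀), e₀', e₁']
    simp
  have hcont : ContinuousAt (fun x => F.H ε 0 x ^ 2 + F.H ε 1 x ^ 2) x₀ :=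
    ((h.contDiffAt_H hx₀ 0).continuousAt.pow 2).add ((h.contDiffAt_H hx₀ 1).continuousAt.pow 2)
  obtain ⟨r, hr, hball⟩ := Metric.eventually_nhds_iff_ball.1
    ((F.chart.open_target.eventually_mem hx₀).and (hcont.eventually_const_lt hR₀))
  obtain ⟨C, hC⟩ := Metric.isOpen_ball.exists_is_const_of_fderiv_eq_zero
    (𝕜 := ℝ) (convex_ball x₀ r).isPreconnected
    (fun x hx => (h.hasFDerivAt_sq_sub (hball x hx).1).differentiableAt.differentiableWithinAt)
    (fun x hx => (h.hasFDerivAt_sq_sub (hball x hx).1).fderiv)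
  let ν : E2 → E2 →L[ℝ] ℝ := fun x => (F.H ε 0 x ^ 2 + F.H ε 1 x ^ 2)⁻¹ •
      (F.H ε 0 x • F.η 1 x - F.H ε 1 x • F.η 0 x)
  have hν : ∀ x ∈ Metric.ball x₀ r, ContDiffAt ℝ ∞ ν x := fun x hx => by
    have hx' := (hball x hx).1
    have hH := h.contDiffAt_H hx'
    exact ((((hH 0).pow 2).add ((hH 1).pow 2)).inv (hball x hx).2.ne').smul
      (((hH 0).smul (contDiffAt_η hx' 1)).sub ((hH 1).smul (contDiffAt_η hx' 0)))
  -- The Poincaré lemma on the ball, applied to the closed form `⋆(w² dw) / |w² dw|²`.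
  obtain ⟨v, hv⟩ := (convex_ball x₀ r).exists_forall_hasFDerivAt_of_fderiv_symmetric
    Metric.isOpen_ball
    (show DifferentiableOn ℝ ν (Metric.ball x₀ r) from
      fun x hx => ((hν x hx).differentiableAt (by simp)).differentiableWithinAt)
    (fun x hx a b => by
      have := DFunLike.congr_fun (DFunLike.congr_fun
        (h.extD_star (hball x hx).1 (hball x hx).2.ne') a) b
      rw [extD_apply] at this
      exact sub_eq_zero.1 this)
  refine ⟨C, Metric.ball x₀ r, v, Metric.isOpen_ball, Metric.mem_ball_self hr,
    fun x hx => (hball x hx).1, fun x hx => ?_⟩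
  have hx' := (hball x hx).1
  have hR : ε * F.w ε x ^ 2 + C = F.H ε 0 x ^ 2 + F.H ε 1 x ^ 2 := by
    rw [← hC x hx]; ring
  have hpos := (hball x hx).2
  refine ⟨?_, hR ▸ hpos, fun a b => ?_⟩
  · have : ContDiffOn ℝ ∞ v (Metric.ball x₀ r) := by
      rw [contDiffOn_infty_iff_fderiv_of_isOpen Metric.isOpen_ball]
      refine ⟨fun y hy => (hv y hy).differentiableAt.differentiableWithinAt, fun y hy =>
        ((hν y hy).contDiffWithinAt).congr (fun z hz => (hv z hz).fderiv) (hv y hy).fderiv⟩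
    exact this.contDiffAt (Metric.isOpen_ball.mem_nhds hx)
  -- For a nonzero covector `H`, the metric is `(H² + (⋆H)²) / |H|²`; here `H = w² dw` and `⋆H =
  -- |H|² dv`.
  · rw [localMetric_eq hx', hR, (hv x hx).fderiv, (h.hasFDerivAt_w hx').fderiv]
    have hw := (h.w_pos hx').ne'
    have hP : ∀ i, F.P i x = -F.H ε i x / F.w ε x ^ 3 := fun i => by
      simp only [H]; field_simp
    simp only [ν, smul_apply, sub_apply, add_apply, smul_eq_mul, hP]
    have := hpos.ne'
    field_simp
    ring

end Framing
end Warped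

/-! ### The normal forms, existence of framings and density. -/

section NormalForms

variable {M : Type*} [TopologicalSpace M] [ChartedSpace E2 M] [IsManifold 𝓘(ℝ, E2) ∞ M]
  {g : Metric M}

/-- It remains to substitute `u = f(w)` and rescale `v` by `l`. The point `t` with `εt² + C > 0` is
kept because it forces `C > 0` when `ε = -1`. -/
theorem Framing.IsSpecial.exists_hasLocalForm {F : Framing g} {ε : ℝ} (h : F.IsSpecial ε) {p : M}
    (hp : p ∈ F.chart.source) (hK : fderiv ℝ F.K (F.chart p) ≠ 0) :
    ∃ C : ℝ, (∃ t : ℝ, 0 < ε * t ^ 2 + C) ∧ ∀ (I : Set ℝ) (A B f f' : ℝ → ℝ) (l : ℝ),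
      (∀ t, 0 < t → 0 < ε * t ^ 2 + C → ContDiffAt ℝ ∞ f t ∧ HasDerivAt f (f' t) t ∧ f t ∈ I ∧
        A (f t) * f' t ^ 2 = t ^ 4 / (ε * t ^ 2 + C) ∧ B (f t) * l ^ 2 = ε * t ^ 2 + C) →
      HasLocalForm g p I A B := by
  have hp' := F.chart.map_source hp
  obtain ⟨C, s, v, hs, hps, hsF, hv⟩ := h.exists_warped hp' hK
  refine ⟨C, ⟨F.w ε (F.chart p), (hv _ hps).2.1⟩, fun I A B f f' l hf => ?_⟩
  have hf' := fun x (hx : x ∈ s) => hf _ (h.w_pos (hsF hx)) (hv x hx).2.1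
  refine hasLocalForm_of_coordinates F.chart_mem hs hsF (u := fun x => f (F.w ε x))
    (v := fun x => l * v x)
    (fun x hx => (hf' x hx).1.comp x (h.contDiffAt_w (hsF hx)))
    (fun x hx => contDiffAt_const.mul (hv x hx).1) (fun x hx => (hf' x hx).2.2.1)
    (fun x hx a b => ?_) hp hps
  obtain ⟨-, h₁, -, h₂, h₃⟩ := hf' x hx
  have hw := ((h.contDiffAt_w (hsF hx)).differentiableAt (by simp)).hasFDerivAt
  have e₁ : fderiv ℝ (fun x => f (F.w ε x)) x = f' (F.w ε x) • fderiv ℝ (F.w ε) x :=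
    (h₁.comp_hasFDerivAt x hw).fderiv
  have e₂ : fderiv ℝ (fun x => l * v x) x = l • fderiv ℝ v x :=
    ((((hv x hx).1.differentiableAt (by simp)).hasFDerivAt).const_mul l).fderiv
  rw [(hv x hx).2.2 a b, ← h₂, ← h₃, e₁, e₂]
  simp only [smul_apply, smul_eq_mul]
  ring

theorem Framing.IsSpecial.hasLocalForm_cos {F : Framing g} (h : F.IsSpecial (-1)) {p : M}
    (hp : p ∈ F.chart.source) (hK : fderiv ℝ F.K (F.chart p) ≠ 0) :
    ∃ c : ℝ, 0 < c ∧ HasLocalForm g p (Set.Ioo 0 (Real.pi / 2))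
      (fun u => c * Real.cos u ^ 4) (fun u => c * Real.sin u ^ 2) := by
  obtain ⟨C, ⟨t₀, ht₀⟩, hC⟩ := h.exists_hasLocalForm hp hK
  obtain ⟨r, hr, rfl⟩ : ∃ r : ℝ, 0 < r ∧ C = r ^ 2 :=
    have hpos : 0 < C := by nlinarith [sq_nonneg t₀]
    ⟨√C, Real.sqrt_pos.2 hpos, (Real.sq_sqrt hpos.le).symm⟩
  -- The substitution is `w = r cos u` with `C = r²`, so `r² - w² = r² sin² u`; replacing `v` by `v
  -- / r` makes `r⁴` a common factor.
  refine ⟨r ^ 4, by positivity, hC _ _ _ (fun t => Real.arccos (t / r))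
    (fun t => -(1 / √(1 - (t / r) ^ 2)) * (1 / r)) (1 / r) fun t ht hpos => ?_⟩
  have hlt : t / r < 1 := (div_lt_one hr).2 (by nlinarith)
  have hgt : 0 < t / r := by positivity
  have h₁ : 0 < 1 - (t / r) ^ 2 := by nlinarith
  have hne : t / r ≠ -1 := by linarith
  have hcos : Real.cos (Real.arccos (t / r)) = t / r := Real.cos_arccos (by linarith) hlt.le
  have h₂ : -1 * t ^ 2 + r ^ 2 = r ^ 2 * (1 - (t / r) ^ 2) := by field_simp; ring
  refine ⟨ContDiffAt.comp (g := Real.arccos) t (Real.contDiffAt_arccos hne hlt.ne)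
      (contDiffAt_id.div_const r),
    HasDerivAt.comp (h₂ := Real.arccos) t (Real.hasDerivAt_arccos hne hlt.ne)
      ((hasDerivAt_id t).div_const r),
    ⟨Real.arccos_pos.2 hlt, Real.arccos_lt_pi_div_two.2 hgt⟩, ?_, ?_⟩
  · rw [hcos, h₂, mul_pow, neg_sq, div_pow 1, Real.sq_sqrt h₁.le]
    field_simp
  · rw [Real.sin_arccos, Real.sq_sqrt h₁.le, h₂]
    field_simp

theorem Framing.IsSpecial.hasLocalForm_elliptic {F : Framing g} (h : F.IsSpecial 1) {p : M}
    (hp : p ∈ F.chart.source) (hK : fderiv ℝ F.K (F.chart p) ≠ 0) :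
    (∃ c : ℝ, 0 < c ∧ HasLocalForm g p (Set.Ioi 0)
      (fun u => c * Real.cosh u ^ 4) (fun u => c * Real.sinh u ^ 2)) ∨
    (∃ c : ℝ, 0 < c ∧ HasLocalForm g p (Set.Ioi 0)
      (fun u => c * Real.sinh u ^ 4) (fun u => c * Real.cosh u ^ 2)) ∨
    HasLocalForm g p (Set.Ioi 0) (fun u => u ^ 2) (fun u => u ^ 2) := by
  obtain ⟨C, -, hC⟩ := h.exists_hasLocalForm hp hK
  rcases lt_trichotomy C 0 with hneg | rfl | hpos
  · left
    obtain ⟨r, hr, rfl⟩ : ∃ r : ℝ, 0 < r ∧ C = -r ^ 2 :=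
      ⟨√(-C), Real.sqrt_pos.2 (by linarith), by rw [Real.sq_sqrt (by linarith)]; ring⟩
    -- Here `w = r cosh u` with `C = -r²`; positivity of `w² - r²` gives `w > r`, hence `u > 0`.
    refine ⟨r ^ 4, by positivity, hC _ _ _ (fun t => Real.arcosh (t / r))
      (fun t => (√((t / r) ^ 2 - 1))⁻¹ * (1 / r)) (1 / r) fun t ht hpos => ?_⟩
    have hlt : 1 < t / r := (one_lt_div hr).2 (by nlinarith)
    have h₁ : 0 < (t / r) ^ 2 - 1 := by nlinarith
    have h₂ : 1 * t ^ 2 + -r ^ 2 = r ^ 2 * ((t / r) ^ 2 - 1) := by field_simp; ring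
    refine ⟨ContDiffAt.comp (g := Real.arcosh) t (Real.contDiffAt_arcosh hlt)
        (contDiffAt_id.div_const r),
      HasDerivAt.comp (h₂ := Real.arcosh) t (Real.hasDerivAt_arcosh hlt)
        ((hasDerivAt_id t).div_const r),
      Real.arcosh_pos hlt, ?_, ?_⟩
    · rw [Real.cosh_arcosh hlt.le, h₂, mul_pow, inv_pow, Real.sq_sqrt h₁.le]
      field_simp
    · rw [Real.sinh_arcosh hlt.le, Real.sq_sqrt h₁.le, h₂]
      field_simp
  · right; right
    refine hC _ _ _ id (fun _ => 1) 1 fun t ht _ =>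
      ⟨contDiffAt_id, hasDerivAt_id t, ht, ?_, ?_⟩
    · simp only [id]
      field_simp
      ring
    · simp
  · right; left
    obtain ⟨r, hr, rfl⟩ : ∃ r : ℝ, 0 < r ∧ C = r ^ 2 :=
      ⟨√C, Real.sqrt_pos.2 hpos, (Real.sq_sqrt hpos.le).symm⟩
    -- Here `w = r sinh u` with `C = r²`.
    refine ⟨r ^ 4, by positivity, hC _ _ _ (fun t => Real.arsinh (t / r))
      (fun t => (√(1 + (t / r) ^ 2))⁻¹ * (1 / r)) (1 / r) fun t ht _ => ?_⟩
    have h₁ : 0 < 1 + (t / r) ^ 2 := by positivity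
    have h₂ : 1 * t ^ 2 + r ^ 2 = r ^ 2 * (1 + (t / r) ^ 2) := by field_simp; ring
    refine ⟨Real.contDiff_arsinh.contDiffAt.comp t (contDiffAt_id.div_const r),
      HasDerivAt.comp (h₂ := Real.arsinh) t (Real.hasDerivAt_arsinh _)
        ((hasDerivAt_id t).div_const r),
      Real.arsinh_pos_iff.2 (by positivity), ?_, ?_⟩
    · rw [Real.sinh_arsinh, h₂, mul_pow, inv_pow, Real.sq_sqrt h₁.le]
      field_simp
    · rw [Real.cosh_arsinh, Real.sq_sqrt h₁.le, h₂]
      field_simp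

/-- Gram–Schmidt applied to the coordinate fields of a chart. -/
theorem exists_framing (g : Metric M) (p : M) : ∃ F : Framing g, p ∈ F.chart.source := by
  let φ := chartAt E2 p
  have hφ : φ ∈ IsManifold.maximalAtlas 𝓘(ℝ, E2) ∞ M := IsManifold.chart_mem_maximalAtlas p
  have hG : ContDiffOn ℝ ∞ (localMetric g φ) φ.target := contDiffOn_localMetric hφ
  let N : (E2 → E2) → E2 → E2 := fun X x => (√(localMetric g φ x (X x) (X x)))⁻¹ • X x
  have hN : ∀ X : E2 → E2, ContDiffOn ℝ ∞ X φ.target → (∀ x ∈ φ.target, X x ≠ 0) →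
      ContDiffOn ℝ ∞ (N X) φ.target ∧
        ∀ x ∈ φ.target, localMetric g φ x (N X x) (N X x) = 1 := by
    intro X hX hne
    have hpos : ∀ x ∈ φ.target, 0 < localMetric g φ x (X x) (X x) := fun x hx =>
      localMetric_pos hφ hx (hne x hx)
    refine ⟨((((hG.clm_apply hX).clm_apply hX).sqrt fun x hx => (hpos x hx).ne').inv
      fun x hx => (Real.sqrt_pos.2 (hpos x hx)).ne').smul hX, fun x hx => ?_⟩
    have h₁ := (Real.sqrt_pos.2 (hpos x hx)).ne'
    have h₂ := Real.sq_sqrt (hpos x hx).le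
    simp only [N, map_smul, smul_apply, smul_eq_mul]
    field_simp
    exact h₂.symm
  let X₀ : E2 → E2 := fun _ => EuclideanSpace.single 0 1
  obtain ⟨h₀, h₀'⟩ := hN X₀ contDiffOn_const fun x _ => by simp [X₀]
  let v₀ := N X₀
  -- Hence the second component of `X₁` is `1`, so `X₁` has no zeros and can be normalised.
  have hv₀ : ∀ x, v₀ x 1 = 0 := fun x => by simp [v₀, N, X₀]
  let X₁ : E2 → E2 := fun x => EuclideanSpace.single 1 1 -
    localMetric g φ x (v₀ x) (EuclideanSpace.single 1 1) • v₀ x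
  obtain ⟨h₁, h₁'⟩ := hN X₁
    (contDiffOn_const.sub (((hG.clm_apply h₀).clm_apply contDiffOn_const).smul h₀)) fun x _ h => by
      have := congrFun (congrArg WithLp.ofLp h) 1
      simp [X₁, hv₀] at this
  have hproj : ∀ (L : E2 →L[ℝ] ℝ) (e z : E2), L z = 1 → L (e - L e • z) = 0 := fun L e z hz => by
    simp [hz]
  have h₀₁ : ∀ x ∈ φ.target, localMetric g φ x (v₀ x) (N X₁ x) = 0 := fun x hx => by
    have h₂ : localMetric g φ x (v₀ x) (v₀ x) = 1 := h₀' x hx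
    change localMetric g φ x (v₀ x) ((√(localMetric g φ x (X₁ x) (X₁ x)))⁻¹ • X₁ x) = 0
    have h₃ : localMetric g φ x (v₀ x) (X₁ x) = 0 := hproj _ _ _ h₂
    exact (map_smul _ _ _).trans (by rw [h₃, smul_zero])
  refine ⟨⟨φ, ![v₀, N X₁], hφ, fun i => ?_, fun x hx i j => ?_⟩, mem_chart_source E2 p⟩
  · fin_cases i
    · exact h₀
    · exact h₁
  · fin_cases i <;> fin_cases j
    · exact h₀' x hx
    · exact h₀₁ x hx
    · exact (localMetric_symm _ _ _).trans (h₀₁ x hx)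
    · exact h₁' x hx

/-- If `dK = 0` on an open set, then `P` and its covariant derivative vanish there, and `∇P = 3 P⊗P
- K g` reduces to `K = 0`. -/
theorem dense_curvatureRegularAt {ε : ℝ} (h : ∀ F : Framing g, F.IsSpecial ε) :
    Dense {p : M | CurvatureRegularAt g p} := by
  rw [dense_iff_inter_open]
  rintro O hO ⟨p, hpO⟩
  by_contra hemp
  obtain ⟨F, hp⟩ := exists_framing g p
  have hzero : ∀ᶠ x in 𝓝 (F.chart p), x ∈ F.chart.target ∧ fderiv ℝ F.K x = 0 := by
    have h₁ := F.chart.open_target.mem_nhds (F.chart.map_source hp)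
    have h₂ : ∀ᶠ x in 𝓝 (F.chart p), F.chart.symm x ∈ O :=
      (F.chart.continuousAt_symm (F.chart.map_source hp)).eventually_mem
        (by rw [F.chart.left_inv hp]; exact hO.mem_nhds hpO)
    filter_upwards [h₁, h₂] with x hx hxO
    refine ⟨hx, by_contra fun hne => hemp ⟨F.chart.symm x, hxO, F, F.chart.map_target hx, ?_⟩⟩
    rwa [F.chart.right_inv hx]
  have hP : ∀ i, F.P i =ᶠ[𝓝 (F.chart p)] fun _ => 0 := fun i => by
    filter_upwards [hzero] with x hx
    simp [Framing.P, hx.2]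
  have hx := F.chart.map_source hp
  have hDP := (h F).DP_zero_zero _ hx
  simp only [Framing.DP, Matrix.cons_val_zero, (hP 0).fderiv_eq, (hP 0).self_of_nhds,
    (hP 1).self_of_nhds] at hDP
  simp at hDP
  exact (h F).K_ne_zero hx hDP

theorem isSpecial_of_isElliptic (hg : IsElliptic g) (h : EmbeddingIntegrable ℂ g)
    (F : Framing g) : F.IsSpecial 1 := by
  have hDP := fun x (hx : x ∈ F.chart.target) => Framing.DP_of_embeddingIntegrable (F := F)
    (κ := fun x => Complex.I * ((√(F.K x) : ℝ) : ℂ)) h (fun x hx => (hg F x hx).ne')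
    (fun x hx => contDiffAt_const.mul (Complex.ofRealCLM.contDiff.contDiffAt.comp x
      ((Framing.contDiffAt_K hx).sqrt (hg F x hx).ne')))
    (fun x hx => by
      rw [mul_pow, Complex.I_sq, ← Complex.ofReal_pow, Real.sq_sqrt (hg F x hx).le]
      simp) hx
  exact ⟨one_pow 2, fun x hx => by simpa using hg F x hx, fun x hx => (hDP x hx).1,
    fun x hx => (hDP x hx).2.1, fun x hx => (hDP x hx).2.2⟩

theorem isSpecial_of_isHyperbolic (hg : IsHyperbolic g) (h : EmbeddingIntegrable ℝ g)
    (F : Framing g) : F.IsSpecial (-1) := by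
  have hpos : ∀ x ∈ F.chart.target, 0 < -F.K x := fun x hx => neg_pos.2 (hg F x hx)
  have hDP := fun x (hx : x ∈ F.chart.target) => Framing.DP_of_embeddingIntegrable (F := F)
    (κ := fun x => √(-F.K x)) h (fun x hx => (hg F x hx).ne)
    (fun x hx => (Framing.contDiffAt_K hx).neg.sqrt (hpos x hx).ne')
    (fun x hx => Real.sq_sqrt (hpos x hx).le) hx
  exact ⟨by norm_num, fun x hx => by simpa using hg F x hx, fun x hx => (hDP x hx).1,
    fun x hx => (hDP x hx).2.1, fun x hx => (hDP x hx).2.2⟩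

end NormalForms

end DarbouxEmbedding

end

theorem mainTheorem4 {M : Type*} [TopologicalSpace M] [ChartedSpace E2 M]
    [IsManifold 𝓘(ℝ, E2) ∞ M] (g : Metric M) :
    (IsElliptic g → EmbeddingIntegrable ℂ g →
      Dense {p : M | CurvatureRegularAt g p} ∧
      ∀ p : M, CurvatureRegularAt g p →
        (∃ c : ℝ, 0 < c ∧ HasLocalForm g p (Set.Ioi 0)
          (fun u => c * Real.cosh u ^ 4) (fun u => c * Real.sinh u ^ 2)) ∨
        (∃ c : ℝ, 0 < c ∧ HasLocalForm g p (Set.Ioi 0)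
          (fun u => c * Real.sinh u ^ 4) (fun u => c * Real.cosh u ^ 2)) ∨
        HasLocalForm g p (Set.Ioi 0) (fun u => u ^ 2) (fun u => u ^ 2)) ∧
    (IsHyperbolic g → EmbeddingIntegrable ℝ g →
      Dense {p : M | CurvatureRegularAt g p} ∧
      ∀ p : M, CurvatureRegularAt g p →
        ∃ c : ℝ, 0 < c ∧ HasLocalForm g p (Set.Ioo 0 (Real.pi / 2))
          (fun u => c * Real.cos u ^ 4) (fun u => c * Real.sin u ^ 2)) := by
  refine ⟨fun hg h => ?_, fun hg h => ?_⟩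
  · have hs := isSpecial_of_isElliptic hg h
    exact ⟨dense_curvatureRegularAt hs, fun p ⟨F, hp, hK⟩ => (hs F).hasLocalForm_elliptic hp hK⟩
  · have hs := isSpecial_of_isHyperbolic hg h
    exact ⟨dense_curvatureRegularAt hs, fun p ⟨F, hp, hK⟩ => (hs F).hasLocalForm_cos hp hK⟩
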